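/- **Setting.** Fix $n$, $t^A,t^B\ge 0$ and integer vectors $\mathbf s^A,\mathbf k^A\in\mathbb N^{t^A}$, $\mathbf s^B,\mathbf k^B\in\mathbb N^{t^B}$, known to both parties. Alice has $x\in\{0,1\}^n$ and pairwise disjoint sets $S^A_1,\dots,S^A_{t^A}\subseteq[n]$ with $|S^A_i|=s^A_i$; Bob has $y\in\{0,1\}^n$ and pairwise disjoint sets $S^B_1,\dots,S^B_{t^B}\subseteq[n]$ with $|S^B_i|=s^B_i$. The input is *consistent* if $x,y$ differ in at most $k^A_i$ positions of $S^A_i$ and in at most $k^B_i$ positions of $S^B_i$, for every $i$, and in no position outside $\bigcup_i S^A_i\cup\bigcup_i S^B_i$. Put $s^A=\sum_i s^A_i$, $s^B=\sum_i s^B_i$, $k^A=\sum_i k^A_i$, $$\mathsf H(s,k)=\log_2\sum_{j=0}^{k}\binom sj,\qquad \mathsf H(\mathbf s,\mathbf k)=\sum_i\mathsf H(s_i,k_i),$$ and let $\chi(\mathbf s^B,\mathbf k^B,t^B)$ be the number of intervals $I_j=[2^{10^{j-1}},2^{10^j})$, $j\ge1$, that contain at least one of the ratios $s^B_i/k^B_i$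 (an index with $k^B_i=0$ contributes nothing). Let $\mu$ be the minimum of $k^A$ and all $k^B_i$, that is, $\mu=\min(k^B_{t^B},k^A)$ if $t^B\ge1$ and $k^B_1\ge\dots\ge k^B_{t^B}$. A one-round protocol uses a shared uniformly random bit string of length polynomial in $n+t^A+t^B+2$: Alice sends Bob one message, computed from the parameters, $x$, $(S^A_i)_i$ and the shared string, and Bob outputs an $n$-bit string, computed from the parameters, $y$, $(S^B_i)_i$, the shared string and the message. It is *explicit* if both computations are carried out by two fixed programs (one for each party, the same for all parameters and inputs) in a number of steps that is polynomial in $n+t^A+t^B+2$ for Alice, and in this quantity plus the message length for Bob; the programs are those of a random access machine with addition and truncated subtraction at unit cost. **Theorem.** There is a constant $\delta>0$ such that for every integer $c\ge0$ there are a constant $C>0$ and an explicit one-round protocol with the following properties, for all parameters and all consistent inputs. 1. For every value of the shared string, Alice's message has at most $$C\,\bigl(\chi(\mathbf s^B,\mathbf k^B,t^B)+1\bigr)^2\bigl(\mathsf H(n-s^B,k^A)+\mathsf H(\mathbf s^B,\mathbf k^B)\bigr)$$ bits. 2. With probability at least $1-2^{-\delta\mu}-\dfrac1{(s^A+s^B+1)^c}$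 over the shared string, Bob outputs $x$. -/

import Mathlib

open Finset

/-! ### Random access machines with a step count -/

namespace RAM

/-- The memory: array number `a` holds the natural number `σ a i` at position `i`.
A program mentions finitely many arrays. -/
abbrev Store := ℕ → ℕ → ℕ

/-- Expressions: constants, (indirect) array reads, addition and truncated subtraction. There is
no multiplication, so counting one step per operation is polynomially equivalent to counting
bit operations (or Turing machine steps). -/
inductive Expr : Type
  | const (c : ℕ) : Expr
  | read (a : ℕ) (i : Expr) : Expr
  | add (e f : Expr) : Expr
  | sub (e f : Expr) : Expr

/-- The value of an expression. -/
def Expr.eval (σ : Store) : Expr → ℕ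
  | .const c => c
  | .read a i => σ a (i.eval σ)
  | .add e f => e.eval σ + f.eval σ
  | .sub e f => e.eval σ - f.eval σ

/-- The number of steps needed to evaluate an expression: one per operation. -/
def Expr.cost : Expr → ℕ
  | .const _ => 1
  | .read _ i => i.cost + 1
  | .add e f => e.cost + f.cost + 1
  | .sub e f => e.cost + f.cost + 1

/-- Programs. `ifPos` and `loop` test whether an expression is nonzero. -/
inductive Prog : Type
  | skip : Prog
  | write (a : ℕ) (i e : Expr) : Prog
  | seq (p q : Prog) : Prog
  | ifPos (e : Expr) (p q : Prog) : Prog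
  | loop (e : Expr) (p : Prog) : Prog

/-- The memory after storing `v` at position `i` of array `a`. -/
def Store.set (σ : Store) (a i v : ℕ) : Store :=
  fun b j => if b = a ∧ j = i then v else σ b j

/-- `Runs p σ σ' T`: started in memory `σ`, the program `p` halts after exactly `T` steps, in
memory `σ'`. -/
inductive Runs : Prog → Store → Store → ℕ → Prop
  | skip (σ : Store) : Runs .skip σ σ 1
  | write (a : ℕ) (i e : Expr) (σ : Store) :
      Runs (.write a i e) σ (σ.set a (i.eval σ) (e.eval σ)) (i.cost + e.cost + 1)
  | seq {p q : Prog} {σ σ' σ'' : Store} {T T' : ℕ} :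
      Runs p σ σ' T → Runs q σ' σ'' T' → Runs (.seq p q) σ σ'' (T + T')
  | ifTrue {e : Expr} {p q : Prog} {σ σ' : Store} {T : ℕ} :
      e.eval σ ≠ 0 → Runs p σ σ' T → Runs (.ifPos e p q) σ σ' (e.cost + 1 + T)
  | ifFalse {e : Expr} {p q : Prog} {σ σ' : Store} {T : ℕ} :
      e.eval σ = 0 → Runs q σ σ' T → Runs (.ifPos e p q) σ σ' (e.cost + 1 + T)
  | loopStop {e : Expr} {p : Prog} {σ : Store} :
      e.eval σ = 0 → Runs (.loop e p) σ σ (e.cost + 1)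
  | loopStep {e : Expr} {p : Prog} {σ σ' σ'' : Store} {T T' : ℕ} :
      e.eval σ ≠ 0 → Runs p σ σ' T → Runs (.loop e p) σ' σ'' T' →
        Runs (.loop e p) σ σ'' (e.cost + 1 + T + T')

/-- The contents of an array holding `f 0, …, f (m - 1)`, followed by zeros. -/
def arrayOf {m : ℕ} (f : Fin m → ℕ) : ℕ → ℕ :=
  fun i => if h : i < m then f ⟨i, h⟩ else 0

end RAM

/-! ### Document exchange with two-sided asymmetric information -/

/-- The parameters of a two-sided asymmetric document exchange problem, known to both parties:
the length `n` of the strings, and the vectors of set sizes and of error bounds of the two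
parties. -/
structure DEParams where
  n : ℕ
  tA : ℕ
  tB : ℕ
  sA : Fin tA → ℕ
  kA : Fin tA → ℕ
  sB : Fin tB → ℕ
  kB : Fin tB → ℕ

/-- The set of positions in `S` where the strings `x` and `y` differ; its cardinality is the
Hamming distance of `x` and `y` within `S`. -/
def diffIn {n : ℕ} (x y : Fin n → Bool) (S : Finset (Fin n)) : Finset (Fin n) :=
  S.filter (fun p => x p ≠ y p)

/-- `S` is a vector of pairwise disjoint subsets of the positions, with sizes given by `s`. -/
structure IsSetVector {n t : ℕ} (s : Fin t → ℕ) (S : Fin t → Finset (Fin n)) : Prop where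
  disjoint : ∀ i j, i ≠ j → Disjoint (S i) (S j)
  card_eq : ∀ i, (S i).card = s i

namespace DEParams

variable (P : DEParams)

/-- The size of an input, up to polynomial factors. -/
def size : ℕ := P.n + P.tA + P.tB + 2

def totalSA : ℕ := ∑ i, P.sA i
def totalSB : ℕ := ∑ i, P.sB i
def totalKA : ℕ := ∑ i, P.kA i

/-- The minimum of `k^A = ∑ k^A_i` and of all the `k^B_i`. -/
def minK : ℕ := (insert P.totalKA (univ.image P.kB)).min' (insert_nonempty _ _)

/-- The sets of Alice (`SA`) and Bob (`SB`) and their strings (`x` and `y`) are consistent with the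
parameters: the sets have the prescribed sizes, the Hamming distance within each set respects
the corresponding bound, and the strings differ only at positions covered by the sets. -/
structure IsConfig (SA : Fin P.tA → Finset (Fin P.n)) (SB : Fin P.tB → Finset (Fin P.n))
    (x y : Fin P.n → Bool) : Prop where
  setsA : IsSetVector P.sA SA
  setsB : IsSetVector P.sB SB
  distA : ∀ i, (diffIn x y (SA i)).card ≤ P.kA i
  distB : ∀ i, (diffIn x y (SB i)).card ≤ P.kB i
  covered : ∀ p, x p ≠ y p → (∃ i, p ∈ SA i) ∨ (∃ i, p ∈ SB i)

end DEParams

/-! ### The quantities in the bound -/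

noncomputable section

/-- `H(s, k) = log₂ (∑_{j ≤ k} binom(s, j))` for integers. -/
def Hnat (s k : ℕ) : ℝ := Real.logb 2 (∑ j ∈ range (k + 1), (s.choose j : ℝ))

/-- `H(s, k) = ∑ i, log₂ (∑_{j ≤ k_i} binom(s_i, j))` for vectors. -/
def Hvec {t : ℕ} (s k : Fin t → ℕ) : ℝ := ∑ i, Hnat (s i) (k i)

/-- `χ(s, k, t)`: the number of intervals `I_j = [2^(10^(j-1)), 2^(10^j))`, `j ≥ 1`, which contain
at least one of the ratios `s_i / k_i`. -/
def chi {t : ℕ} (s k : Fin t → ℕ) : ℕ :=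
  Set.ncard {j : ℕ | 1 ≤ j ∧ ∃ i, (s i : ℝ) / (k i : ℝ) ∈
    Set.Ico ((2 : ℝ) ^ (10 ^ (j - 1))) ((2 : ℝ) ^ (10 ^ j))}

end

/-! ### Protocols -/

/-- A one-round protocol with shared randomness in which Alice sends one message to Bob. The shared
random string is uniform and has length `size ^ randExp`. Alice's message depends on the parameters,
her string, her sets and the shared random string; Bob's output depends on the parameters, his
string, his sets, the shared random string and Alice's message. -/
structure OneRoundProtocol where
  randExp : ℕ
  enc : (P : DEParams) → (Fin P.n → Bool) → (Fin P.tA → Finset (Fin P.n)) →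
    (Fin (P.size ^ randExp) → Bool) → List Bool
  dec : (P : DEParams) → (Fin P.n → Bool) → (Fin P.tB → Finset (Fin P.n)) →
    (Fin (P.size ^ randExp) → Bool) → List Bool → (Fin P.n → Bool)

namespace OneRoundProtocol

open RAM

/-- A vector of disjoint sets is stored as a table: position `p` gets the label `i + 1` if it is in
the set number `i` (counting from `0`), and the label `0` if it is in none of the sets. -/
def setTable {n t : ℕ} (S : Fin t → Finset (Fin n)) : Fin n → ℕ :=
  fun p => ∑ i, if p ∈ S i then (i : ℕ) + 1 else 0

/-- The initial memory of a party with string `z`, set vector `S`, shared random string `r` and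
received message `w`. -/
def input (P : DEParams) {t ℓ : ℕ} (z : Fin P.n → Bool) (S : Fin t → Finset (Fin P.n))
    (r : Fin ℓ → Bool) (w : List Bool) : Store
  | 0 => arrayOf ![P.n, P.tA, P.tB]
  | 1 => arrayOf P.sA
  | 2 => arrayOf P.kA
  | 3 => arrayOf P.sB
  | 4 => arrayOf P.kB
  | 5 => arrayOf (fun p => (z p).toNat)
  | 6 => arrayOf (setTable S)
  | 7 => arrayOf (fun i => (r i).toNat)
  | 8 => arrayOf ![w.length]
  | 9 => fun i => (w.getD i false).toNat
  | _ => fun _ => 0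

/-- The message that Alice leaves in memory: its length in array `8`, its bits in array `9`. -/
def outMessage (σ : Store) : List Bool :=
  (List.range (σ 8 0)).map (fun i => decide (σ 9 i ≠ 0))

/-- The string that Bob leaves in memory, in array `10`. -/
def outString (n : ℕ) (σ : Store) : Fin n → Bool :=
  fun p => decide (σ 10 p ≠ 0)

/-- A protocol is explicit if the computations of both parties are carried out, for all parameters
and inputs, by two fixed programs running in polynomial time. -/
def IsExplicit (Q : OneRoundProtocol) : Prop :=
  ∃ (alice bob : Prog) (d : ℕ), ∀ (P : DEParams) (r : Fin (P.size ^ Q.randExp) → Bool),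
    (∀ (x : Fin P.n → Bool) (SA : Fin P.tA → Finset (Fin P.n)), IsSetVector P.sA SA →
      ∃ (σ : Store) (T : ℕ), Runs alice (input P x SA r []) σ T ∧ T ≤ P.size ^ d ∧
        outMessage σ = Q.enc P x SA r) ∧
    (∀ (y : Fin P.n → Bool) (SB : Fin P.tB → Finset (Fin P.n)) (w : List Bool),
      IsSetVector P.sB SB →
      ∃ (σ : Store) (T : ℕ), Runs bob (input P y SB r w) σ T ∧ T ≤ (P.size + w.length) ^ d ∧
        outString P.n σ = Q.dec P y SB r w)

/-- The probability, over the shared random string, that Bob outputs Alice's string. -/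
noncomputable def successProb (Q : OneRoundProtocol) (P : DEParams)
    (SA : Fin P.tA → Finset (Fin P.n)) (SB : Fin P.tB → Finset (Fin P.n))
    (x y : Fin P.n → Bool) : ℝ :=
  ((univ.filter (fun r : Fin (P.size ^ Q.randExp) → Bool =>
      Q.dec P y SB r (Q.enc P x SA r) = x)).card : ℝ) / (2 : ℝ) ^ (P.size ^ Q.randExp)

end OneRoundProtocol

/-! Split the positions, as Bob sees them, into classes: each of his sets, and the complement of
their union, where at most `k^A` errors occur because only Alice's sets cover them. A class of size
`s` with error bound `k` (truncated at `s`) has a weight of about `log₂(s/k) + 1`, and errors times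
weight is at most `2 H(s, k)` (`mul_size_le_two_mul_Hnat`).

In stage `r`, `D * 2 ^ r` random hash functions distribute the positions to buckets, and Alice sends
the parity of her string in each bucket. Bob flips a position of weight at most `2 ^ r` if more than
half of the functions show a parity mismatch between the two strings in its bucket. A vote can be
wrong only if the position collides with another current error. Hence every error left after the
stage either is an original one of weight above `2 ^ r`, or sits at a bad position, one that
collides for at least half of the functions (`mem_errSeq_succ`).

The number of buckets exceeds `2 ^ 20` times a bound `load r` for the current errors. Collisions at
different positions are dependent, but revealing the hash values in a suitable order bounds an
exponential moment of their number (`expect_collSet_le`). Thus a fixed set `T` is entirely bad with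
probability at most `16 ^ (-D * 2 ^ r * #T)` (`prob_badSet_eq_le`), and a binomial expansion with
Markov's inequality gives a tail bound for the number of bad positions (`prob_le_card_badSet_le`).
At most `totalErr * 2 ^ 2 ^ r` positions take part in stage `r`, so more than `totalErr / 4 ^ (r +
1) + slack` bad ones are very unlikely. Each stage uses fresh randomness, so its bound applies to
the random error set left by earlier stages (`prob_stage_le`). In the last stage all positions take
part and no bad one is tolerated.

For the length, a class is charged only while `2 ^ r` is below twice its weight, so the geometric
sum of the charges is of the order of errors times weight; the term `totalErr / 4 ^ r` decays faster
than the number of functions grows. The term `slack`, the minimum of `μ` and the bit length of `n`,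
secures the failure probability. Its cost is of the order of `slack * log n`, and the entropy pays
for it because `slack` is below all error bounds, whence `H(n, slack)` is at most the sum of the
class entropies (`lenBits_mul_slack_le`). The resulting bound is linear in the entropy; the factor
with `χ` enters only through being at least `1`.

For explicitness, both parties run the same program. It adds parities of the own string to array
`9`, which is zero for Alice and holds her message for Bob; only Bob's version flips entries. -/

/-! ### Programs with counted loops: semantics, frame rule and running time. -/

namespace RAM

/-- The size parameter, read from the initial memory. -/
def sizeExpr : Expr :=
  .add (.add (.add (.read 0 (.const 0)) (.read 0 (.const 1))) (.read 0 (.const 2))) (.const 2)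

/-- The value of `sizeExpr`. -/
def Store.size (σ : Store) : ℕ := σ 0 0 + σ 0 1 + σ 0 2 + 2

theorem eval_sizeExpr (σ : Store) : sizeExpr.eval σ = σ.size := rfl

/-- Multiplication of an expression by a constant. -/
def Expr.mulc : ℕ → Expr → Expr
  | 0, _ => .const 0
  | k + 1, e => .add (Expr.mulc k e) e

@[simp] theorem Expr.eval_mulc (σ : Store) (k : ℕ) (e : Expr) :
    (Expr.mulc k e).eval σ = k * e.eval σ := by
  induction k with
  | zero => simp [Expr.mulc, Expr.eval]
  | succ k ih => simp [Expr.mulc, Expr.eval, ih, Nat.succ_mul]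

@[simp] theorem Expr.eval_const (σ : Store) (c : ℕ) : (Expr.const c).eval σ = c := rfl
@[simp] theorem Expr.eval_read (σ : Store) (a : ℕ) (i : Expr) :
    (Expr.read a i).eval σ = σ a (i.eval σ) := rfl
@[simp] theorem Expr.eval_add (σ : Store) (e f : Expr) :
    (Expr.add e f).eval σ = e.eval σ + f.eval σ := rfl
@[simp] theorem Expr.eval_sub (σ : Store) (e f : Expr) :
    (Expr.sub e f).eval σ = e.eval σ - f.eval σ := rfl

/-- The scalar variable stored at position `0` of array `a`. -/
abbrev Expr.var (a : ℕ) : Expr := .read a (.const 0)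

theorem Store.set_ne {σ : Store} {a b i v : ℕ} (h : b ≠ a) : σ.set a i v b = σ b := by
  funext j; simp [Store.set, h]

theorem Store.set_apply (σ : Store) (a i v b j : ℕ) :
    σ.set a i v b j = if b = a ∧ j = i then v else σ b j := rfl

/-- Programs in which every loop runs over an index from `0` to a constant multiple of the size. -/
inductive Cmd : Type
  | skip : Cmd
  | write (a : ℕ) (i e : Expr) : Cmd
  | seq (p q : Cmd) : Cmd
  | ite (e : Expr) (p q : Cmd) : Cmd
  | rep (k c : ℕ) (p : Cmd) : Cmd

namespace Cmd

/-- The test of a loop that runs `k * size` times with index `c`. -/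
def repTest (k c : ℕ) : Expr := .sub (Expr.mulc k sizeExpr) (.var c)

/-- The translation into programs of the random access machine. -/
def toProg : Cmd → Prog
  | skip => .skip
  | write a i e => .write a i e
  | seq p q => .seq p.toProg q.toProg
  | ite e p q => .ifPos e p.toProg q.toProg
  | rep k c p => .seq (.write c (.const 0) (.const 0))
      (.loop (repTest k c)
        (.seq p.toProg (.write c (.const 0) (.add (.var c) (.const 1)))))

/-- The memory after the execution of a program. -/
def den : Cmd → Store → Store
  | skip, σ => σ
  | write a i e, σ => σ.set a (i.eval σ) (e.eval σ)
  | seq p q, σ => q.den (p.den σ)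
  | ite e p q, σ => if e.eval σ ≠ 0 then p.den σ else q.den σ
  | rep k c p, σ =>
      (fun τ => (p.den τ).set c 0 (p.den τ c 0 + 1))^[k * σ.size] (σ.set c 0 0)

/-- The arrays that a program may modify. -/
def writes : Cmd → List ℕ
  | skip => []
  | write a _ _ => [a]
  | seq p q => p.writes ++ q.writes
  | ite _ p q => p.writes ++ q.writes
  | rep _ c p => c :: p.writes

/-- Loop indices are not modified by loop bodies. -/
def WF : Cmd → Prop
  | skip => True
  | write _ _ _ => True
  | seq p q => p.WF ∧ q.WF
  | ite _ p q => p.WF ∧ q.WF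
  | rep _ c p => c ∉ p.writes ∧ p.WF

/-- An upper bound for the number of steps, in terms of the size. -/
def bound : Cmd → ℕ → ℕ
  | skip, _ => 1
  | write _ i e, _ => i.cost + e.cost + 1
  | seq p q, N => p.bound N + q.bound N
  | ite e p q, N => e.cost + 1 + (p.bound N + q.bound N)
  | rep k c p, N => 3 + ((repTest k c).cost + 1 +
      k * N * ((repTest k c).cost + 1 + (p.bound N + 6)))

/-- The frame rule. It carries arrays across subprograms, and it keeps the size, and with it all
loop lengths, fixed as long as array `0` is never written. -/
theorem den_frame (p : Cmd) {a : ℕ} (ha : a ∉ p.writes) (σ : Store) : p.den σ a = σ a := by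
  induction p generalizing σ with
  | skip => rfl
  | write b i e =>
      simp only [writes, List.mem_singleton] at ha
      exact Store.set_ne ha
  | seq p q ihp ihq =>
      simp only [writes, List.mem_append, not_or] at ha
      simp [den, ihp ha.1, ihq ha.2]
  | ite e p q ihp ihq =>
      simp only [writes, List.mem_append, not_or] at ha
      simp only [den]
      split_ifs
      · exact ihp ha.1 σ
      · exact ihq ha.2 σ
  | rep k c p ih =>
      simp only [writes, List.mem_cons, not_or] at ha
      simp only [den]
      have key : ∀ m : ℕ, ((fun τ => (p.den τ).set c 0 (p.den τ c 0 + 1))^[m] (σ.set c 0 0)) a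
          = σ a := by
        intro m
        induction m with
        | zero => exact Store.set_ne ha.1
        | succ m ihm =>
            rw [Function.iterate_succ_apply', Store.set_ne ha.1, ih ha.2, ihm]
      exact key _

theorem size_den (p : Cmd) (h : 0 ∉ p.writes) (σ : Store) : (p.den σ).size = σ.size := by
  simp [Store.size, den_frame p h]

/-- Induction on the number `m` of remaining iterations: the body leaves the counter and the size
alone, so each round brings the counter exactly one step closer to `k * N`. -/
theorem loop_runs {k c : ℕ} {p : Cmd} (hc : c ∉ p.writes) (h0 : 0 ∉ p.writes) (hc0 : c ≠ 0)
    {N B : ℕ} (hp : ∀ σ : Store, σ.size = N → ∃ T, Runs p.toProg σ (p.den σ) T ∧ T ≤ B)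
    (m : ℕ) : ∀ σ : Store, σ.size = N → σ c 0 + m = k * N →
    ∃ T, Runs (.loop (repTest k c)
        (.seq p.toProg (.write c (.const 0) (.add (.var c) (.const 1))))) σ
      ((fun τ => (p.den τ).set c 0 (p.den τ c 0 + 1))^[m] σ) T ∧
      T ≤ (repTest k c).cost + 1 + m * ((repTest k c).cost + 1 + (B + 6)) := by
  induction m with
  | zero =>
      intro σ hN hm
      refine ⟨_, Runs.loopStop ?_, by omega⟩
      simp only [repTest, Expr.eval_sub, Expr.eval_mulc, eval_sizeExpr, Expr.eval_read,
        Expr.eval_const, hN]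
      omega
  | succ m ih =>
      intro σ hN hm
      obtain ⟨T, hT, hTB⟩ := hp σ hN
      have hs : ((p.den σ).set c 0 (p.den σ c 0 + 1)).size = N := by
        have := size_den p h0 σ
        simp only [Store.size] at this hN ⊢
        rw [Store.set_ne (Ne.symm hc0)]
        omega
      obtain ⟨T', hT', hTB'⟩ := ih _ hs (by
        rw [Store.set_apply, if_pos ⟨rfl, rfl⟩, den_frame p hc]; omega)
      have hw := Runs.write c (.const 0) (.add (.var c) (.const 1)) (p.den σ)
      rw [Function.iterate_succ_apply]
      refine ⟨_, Runs.loopStep ?_ (Runs.seq hT hw) hT', ?_⟩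
      · simp only [repTest, Expr.eval_sub, Expr.eval_mulc, eval_sizeExpr, Expr.eval_read,
          Expr.eval_const, hN]
        omega
      · have e1 : (Expr.const 0).cost + (Expr.add (.var c) (.const 1)).cost + 1 = 6 := rfl
        rw [e1, Nat.succ_mul]
        omega

theorem runs (p : Cmd) (hwf : p.WF) (h0 : 0 ∉ p.writes) (σ : Store) :
    ∃ T, Runs p.toProg σ (p.den σ) T ∧ T ≤ p.bound σ.size := by
  induction p generalizing σ with
  | skip => exact ⟨1, Runs.skip σ, le_rfl⟩
  | write a i e => exact ⟨_, Runs.write a i e σ, le_rfl⟩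
  | seq p q ihp ihq =>
      simp only [writes, List.mem_append, not_or] at h0
      obtain ⟨T, hT, hB⟩ := ihp hwf.1 h0.1 σ
      obtain ⟨T', hT', hB'⟩ := ihq hwf.2 h0.2 (p.den σ)
      rw [size_den p h0.1] at hB'
      exact ⟨_, Runs.seq hT hT', Nat.add_le_add hB hB'⟩
  | ite e p q ihp ihq =>
      simp only [writes, List.mem_append, not_or] at h0
      obtain ⟨T, hT, hB⟩ := ihp hwf.1 h0.1 σ
      obtain ⟨T', hT', hB'⟩ := ihq hwf.2 h0.2 σ
      by_cases he : e.eval σ = 0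
      · refine ⟨e.cost + 1 + T', ?_, ?_⟩
        · simp only [den, he, ne_eq, not_true_eq_false, if_false]
          exact Runs.ifFalse he hT'
        · simp only [bound]; omega
      · refine ⟨e.cost + 1 + T, ?_, ?_⟩
        · simp only [den, he, ne_eq, not_false_eq_true, if_true]
          exact Runs.ifTrue he hT
        · simp only [bound]; omega
  | rep k c p ih =>
      simp only [writes, List.mem_cons, not_or] at h0
      have hs : (σ.set c 0 0).size = σ.size := by
        simp [Store.size, Store.set_ne h0.1]
      obtain ⟨T, hT, hB⟩ := loop_runs (k := k) (N := σ.size) (B := p.bound σ.size) hwf.1 h0.2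
        (Ne.symm h0.1) (fun τ hτ => by rw [← hτ]; exact ih hwf.2 h0.2 τ) (k * σ.size)
        (σ.set c 0 0) hs (by rw [Store.set_apply, if_pos ⟨rfl, rfl⟩]; omega)
      exact ⟨_, Runs.seq (Runs.write c (.const 0) (.const 0) σ) hT, Nat.add_le_add le_rfl hB⟩

/-- The bound is built from constants and `N` by sums and products; for `N ≥ 2`, constants and the
factor `2` of a sum are absorbed into the exponent. -/
theorem exists_pow_bound (p : Cmd) : ∃ d : ℕ, ∀ N : ℕ, 2 ≤ N → p.bound N ≤ N ^ d := by
  have hconst : ∀ c N : ℕ, 2 ≤ N → c ≤ N ^ c := fun c N hN =>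
    (Nat.lt_pow_self (by omega : 1 < N)).le
  have hadd : ∀ (f g : ℕ → ℕ), (∃ d, ∀ N, 2 ≤ N → f N ≤ N ^ d) → (∃ d, ∀ N, 2 ≤ N → g N ≤ N ^ d) →
      ∃ d, ∀ N, 2 ≤ N → f N + g N ≤ N ^ d := by
    rintro f g ⟨a, ha⟩ ⟨b, hb⟩
    refine ⟨max a b + 1, fun N hN => ?_⟩
    have h1 : N ^ a ≤ N ^ max a b := Nat.pow_le_pow_right (by omega) (le_max_left _ _)
    have h2 : N ^ b ≤ N ^ max a b := Nat.pow_le_pow_right (by omega) (le_max_right _ _)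
    have h3 : N ^ max a b * 2 ≤ N ^ max a b * N := Nat.mul_le_mul_left _ hN
    have := ha N hN
    have := hb N hN
    rw [pow_succ]
    omega
  have hmul : ∀ (f g : ℕ → ℕ), (∃ d, ∀ N, 2 ≤ N → f N ≤ N ^ d) → (∃ d, ∀ N, 2 ≤ N → g N ≤ N ^ d) →
      ∃ d, ∀ N, 2 ≤ N → f N * g N ≤ N ^ d := by
    rintro f g ⟨a, ha⟩ ⟨b, hb⟩
    refine ⟨a + b, fun N hN => ?_⟩
    rw [pow_add]
    exact Nat.mul_le_mul (ha N hN) (hb N hN)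
  have hc : ∀ c : ℕ, ∃ d, ∀ N, 2 ≤ N → (fun _ : ℕ => c) N ≤ N ^ d := fun c => ⟨c, hconst c⟩
  induction p with
  | skip => exact hc 1
  | write a i e => exact hc _
  | seq p q ihp ihq => exact hadd _ _ ihp ihq
  | ite e p q ihp ihq => exact hadd _ _ (hc _) (hadd _ _ ihp ihq)
  | rep k c p ih =>
      exact hadd _ _ (hc _) (hadd _ _ (hc _) (hmul _ _
        (hmul _ _ (hc k) ⟨1, fun N _ => by simp⟩) (hadd _ _ (hc _) (hadd _ _ ih (hc 6)))))

/-- The loop `for c = 0, …, B - 1`, where the bound `B` is at most `k * size`. -/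
def forLt (k c : ℕ) (B : Expr) (p : Cmd) : Cmd :=
  rep k c (ite (.sub B (.var c)) p skip)

/-- The invariant rule. The loop always makes `k * size` rounds and idles once the counter reaches
`b`, so after `m` rounds the invariant holds at `min m b`. The counter itself is written in every
round, which is why `I` must be insensitive to it (`hI`). -/
theorem forLt_spec {k c : ℕ} {B : Expr} {p : Cmd} {σ : Store} (I : ℕ → Store → Prop) (b : ℕ)
    (hb : b ≤ k * σ.size)
    (hc : c ∉ p.writes)
    (hB : ∀ τ : Store, (∀ a, a ∉ c :: p.writes → τ a = σ a) → B.eval τ = b)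
    (hI : ∀ j τ x, I j τ → I j (τ.set c 0 x))
    (h0 : I 0 σ)
    (hs : ∀ j < b, ∀ τ : Store, (∀ a, a ∉ c :: p.writes → τ a = σ a) → τ c 0 = j → I j τ →
      I (j + 1) (p.den τ)) :
    I b ((forLt k c B p).den σ) := by
  set q : Cmd := ite (.sub B (.var c)) p skip with hq
  have hqw : q.writes = p.writes := by simp [hq, writes]
  have key : ∀ m : ℕ, let τ := (fun τ => (q.den τ).set c 0 (q.den τ c 0 + 1))^[m] (σ.set c 0 0)
      (∀ a, a ∉ c :: p.writes → τ a = σ a) ∧ τ c 0 = m ∧ I (min m b) τ := by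
    intro m
    induction m with
    | zero =>
        refine ⟨fun a ha => ?_, ?_, ?_⟩
        · simp only [List.mem_cons, not_or] at ha
          exact Store.set_ne ha.1
        · simp [Store.set_apply]
        · simpa using hI 0 σ 0 h0
    | succ m ih =>
        simp only at ih ⊢
        rw [Function.iterate_succ_apply']
        set τ := (fun τ => (q.den τ).set c 0 (q.den τ c 0 + 1))^[m] (σ.set c 0 0)
        obtain ⟨ih1, ih2, ih3⟩ := ih
        refine ⟨fun a ha => ?_, ?_, hI _ _ _ ?_⟩
        · have ha' := ha
          simp only [List.mem_cons, not_or] at ha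
          rw [Store.set_ne ha.1, den_frame q (by rw [hqw]; exact ha.2), ih1 a ha']
        · rw [Store.set_apply, if_pos ⟨rfl, rfl⟩, den_frame q (by rw [hqw]; exact hc), ih2]
        · have hev : (Expr.sub B (.var c)).eval τ = b - m := by
            simp [hB τ ih1, ih2]
          by_cases hm : m < b
          · have : q.den τ = p.den τ := by
              simp only [hq, den]; rw [if_pos]; rw [hev]; omega
            rw [this, Nat.min_eq_left hm]
            rw [Nat.min_eq_left hm.le] at ih3
            exact hs m hm τ ih1 ih2 ih3
          · have : q.den τ = τ := by
              simp only [hq, den]; rw [if_neg]; rw [hev]; omega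
            rw [this]
            rwa [Nat.min_eq_right (by omega)] at ih3 ⊢
  have := (key (k * σ.size)).2.2
  rwa [Nat.min_eq_right hb] at this

end Cmd
end RAM

/-! ### Subroutines for bit lengths of quotients and for sums. -/

namespace RAM.Cmd

open RAM.Expr

/-- Doubling: `tmp = x * 2 ^ w` for the least `w` with `b < x * 2 ^ w`, and `out = w`. -/
def dbl (k c out tmp : ℕ) (X B : Expr) : Cmd :=
  seq (seq (write tmp (const 0) X) (write out (const 0) (const 0)))
    (forLt k c (mulc k sizeExpr)
      (ite (sub (add B (const 1)) (var tmp))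
        (seq (write tmp (const 0) (add (var tmp) (var tmp)))
          (write out (const 0) (add (var out) (const 1)))) skip))

/-- Doubling replaces division: `x * 2 ^ j ≤ b` holds exactly when `j` is below the bit length of `b
/ x`. -/
theorem dbl_spec {k c out tmp : ℕ} {X B : Expr} {σ : Store} (x b : ℕ)
    (hd : c ≠ out ∧ c ≠ tmp ∧ out ≠ tmp ∧ c ≠ 0 ∧ out ≠ 0 ∧ tmp ≠ 0)
    (hX : X.eval σ = x) (hx : 0 < x)
    (hB : ∀ τ : Store, (∀ a, a ∉ [c, tmp, out] → τ a = σ a) → B.eval τ = b)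
    (hL : Nat.size (b / x) ≤ k * σ.size) :
    (dbl k c out tmp X B).den σ out 0 = Nat.size (b / x) ∧
      (dbl k c out tmp X B).den σ tmp 0 = x * 2 ^ Nat.size (b / x) := by
  obtain ⟨h1, h2, h3, h4, h5, h6⟩ := hd
  set σ' := (σ.set tmp 0 x).set out 0 0 with hσ'
  have hden : (dbl k c out tmp X B).den σ = (forLt k c (mulc k sizeExpr)
      (ite (sub (add B (const 1)) (var tmp))
        (seq (write tmp (const 0) (add (var tmp) (var tmp)))
          (write out (const 0) (add (var out) (const 1)))) skip)).den σ' := by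
    simp [dbl, den, hX, hσ']
  have hfr : ∀ a, a ∉ [c, tmp, out] → σ' a = σ a := by
    intro a ha
    simp only [List.mem_cons, not_or] at ha
    rw [hσ', Store.set_ne ha.2.2.1, Store.set_ne ha.2.1]
  have hsz : σ'.size = σ.size := by
    rw [Store.size, hfr 0 (by simp [h4.symm, h5.symm, h6.symm])]; rfl
  have hw : ∀ τ : Store, (∀ a, a ∉ c :: (ite (sub (add B (const 1)) (var tmp))
        (seq (write tmp (const 0) (add (var tmp) (var tmp)))
          (write out (const 0) (add (var out) (const 1)))) skip).writes → τ a = σ' a) →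
      ∀ a, a ∉ [c, tmp, out] → τ a = σ a := by
    intro τ hτ a ha
    rw [← hfr a ha]
    exact hτ a (by simpa [writes] using ha)
  rw [hden]
  have := forLt_spec (σ := σ') (k := k) (c := c) (B := mulc k sizeExpr)
    (p := ite (sub (add B (const 1)) (var tmp))
        (seq (write tmp (const 0) (add (var tmp) (var tmp)))
          (write out (const 0) (add (var out) (const 1)))) skip)
    (fun j τ => τ out 0 = min j (Nat.size (b / x)) ∧ τ tmp 0 = x * 2 ^ min j (Nat.size (b / x)))
    (k * σ.size) (by rw [hsz]) (by simp [writes, h1, h2]) ?_ ?_ ?_ ?_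
  · simpa [Nat.min_eq_right hL] using this
  · intro τ hτ
    have := hw τ hτ 0 (by simp [h4.symm, h5.symm, h6.symm])
    rw [eval_mulc, eval_sizeExpr, Store.size, this]; rfl
  · intro j τ y h
    rw [Store.set_ne h1.symm, Store.set_ne h2.symm]; exact h
  · simp [hσ', Store.set_apply, h3.symm]
  · intro j _ τ hτ _ hI
    have hBτ := hB τ (hw τ hτ)
    have hlt : j < Nat.size (b / x) ↔ x * 2 ^ j ≤ b := by
      rw [Nat.lt_size, Nat.le_div_iff_mul_le hx, mul_comm]
    by_cases hj : j < Nat.size (b / x)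
    · have hm : min j (Nat.size (b / x)) = j := Nat.min_eq_left hj.le
      rw [hm] at hI
      have hle := hlt.1 hj
      rw [den, if_pos (by simp [hBτ, hI.2]; omega), Nat.min_eq_left hj]
      simp [den, Store.set_apply, h3, h3.symm, hI.1, hI.2, pow_succ]
      ring
    · have hm : min j (Nat.size (b / x)) = Nat.size (b / x) := Nat.min_eq_right (by omega)
      have hm' : min (j + 1) (Nat.size (b / x)) = Nat.size (b / x) := Nat.min_eq_right (by omega)
      rw [hm] at hI
      have hlt' : b < x * 2 ^ Nat.size (b / x) := by
        have := Nat.lt_size_self (b / x)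
        rw [Nat.div_lt_iff_lt_mul hx] at this
        rwa [mul_comm]
      rw [den, if_neg (by simp [hBτ, hI.2]; omega), hm']
      exact hI

/-- The sum of the first entries of an array. -/
def sumInto (c dst src : ℕ) (B : Expr) : Cmd :=
  seq (write dst (const 0) (const 0))
    (forLt 1 c B (write dst (const 0) (add (var dst) (read src (var c)))))

theorem sumInto_spec {c dst src : ℕ} {B : Expr} {σ : Store} (b : ℕ)
    (hd : c ≠ dst ∧ c ≠ src ∧ dst ≠ src ∧ c ≠ 0 ∧ dst ≠ 0) (hb : b ≤ σ.size)
    (hB : ∀ τ : Store, (∀ a, a ∉ [c, dst] → τ a = σ a) → B.eval τ = b) :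
    (sumInto c dst src B).den σ dst 0 = ∑ i ∈ range b, σ src i := by
  obtain ⟨h1, h2, h3, h4, h5⟩ := hd
  set σ' := σ.set dst 0 0 with hσ'
  have hfr : ∀ a, a ∉ [c, dst] → σ' a = σ a := by
    intro a ha
    simp only [List.mem_cons, not_or] at ha
    rw [hσ', Store.set_ne ha.2.1]
  have hsz : σ'.size = σ.size := by
    rw [Store.size, hfr 0 (by simp [h4.symm, h5.symm])]; rfl
  refine forLt_spec (σ := σ') (fun j τ => τ dst 0 = ∑ i ∈ range j, σ src i) b
    (by rw [hsz]; omega) (by simp [writes, h1]) ?_ ?_ ?_ ?_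
  · intro τ hτ
    refine hB τ fun a ha => ?_
    rw [← hfr a ha]
    exact hτ a (by simpa [writes] using ha)
  · intro j τ y h
    rw [Store.set_ne h1.symm]; exact h
  · simp [hσ', Store.set_apply]
  · intro j _ τ hτ hc hI
    have : τ src = σ src := by
      rw [hτ src (by simp [writes, h2.symm, h3.symm]), hfr src (by simp [h2.symm, h3.symm])]
    simp [den, Store.set_apply, hI, hc, this, sum_range_succ]

end RAM.Cmd

/-! ### Classes, weights and loads of the stages. -/

namespace DEParams

open RAM

/-- The sizes of the classes of positions, as seen by Bob: class `0` consists of the positions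
outside all his sets, class `i + 1` is his set number `i`. -/
def classSize (P : DEParams) : ℕ → ℕ
  | 0 => P.n - P.totalSB
  | i + 1 => arrayOf P.sB i

/-- The bounds for the numbers of errors in the classes. -/
def classCap (P : DEParams) : ℕ → ℕ
  | 0 => P.totalKA
  | i + 1 => arrayOf P.kB i

/-- The bounds for the numbers of errors, truncated at the sizes of the classes. -/
def classErr (P : DEParams) (i : ℕ) : ℕ := min (P.classCap i) (P.classSize i)

/-- The weight of a class: approximately the logarithm of its ratio of size and errors. -/
def classWeight (P : DEParams) (i : ℕ) : ℕ := Nat.size (P.classSize i / max (P.classErr i) 1)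

/-- The bit length of the number of positions. -/
def lenBits (P : DEParams) : ℕ := Nat.size P.n

/-- The minimum of `lenBits` and of the error bounds of the first `i` classes. -/
def slackTo (P : DEParams) : ℕ → ℕ
  | 0 => P.lenBits
  | i + 1 => min (P.slackTo i) (P.classCap i)

/-- The minimum of `lenBits` and of all error bounds. -/
def slack (P : DEParams) : ℕ := P.slackTo (P.tB + 1)

/-- The bound for the total number of errors. -/
def totalErr (P : DEParams) : ℕ := ∑ i ∈ range (P.tB + 1), P.classErr i

/-- The number of stages of the protocol. -/
def numStages (P : DEParams) : ℕ := if P.slack = 0 then 0 else Nat.size (2 * P.lenBits - 1)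

/-- The bound for the number of errors that are left when stage `r` starts. -/
def load (P : DEParams) (r : ℕ) : ℕ :=
  P.totalErr / 4 ^ r + P.slack +
    ∑ i ∈ range (P.tB + 1), if 2 ^ r < 2 * P.classWeight i then P.classErr i else 0

/-- The bit length of the hash values in stage `r`. -/
def width (P : DEParams) (r : ℕ) : ℕ := Nat.size (2 ^ 20 * P.load r)

/-- The part of the message that precedes stage `r`, which has `D * 2 ^ r` hash functions. -/
def offset (P : DEParams) (D r : ℕ) : ℕ := ∑ q ∈ range r, D * 2 ^ q * 2 ^ P.width q

theorem sum_arrayOf {t : ℕ} (f : Fin t → ℕ) : ∑ i ∈ range t, arrayOf f i = ∑ i, f i := by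
  rw [← Fin.sum_univ_eq_sum_range]
  exact sum_congr rfl fun i _ => by simp [arrayOf]

theorem sum_classSize (P : DEParams) (h : P.totalSB ≤ P.n) :
    ∑ i ∈ range (P.tB + 1), P.classSize i = P.n := by
  rw [sum_range_succ']
  have : ∑ i ∈ range P.tB, P.classSize (i + 1) = P.totalSB := by
    simpa [classSize, totalSB] using sum_arrayOf P.sB
  rw [this, classSize]
  omega

theorem classSize_le (P : DEParams) (h : P.totalSB ≤ P.n) {i : ℕ} (hi : i < P.tB + 1) :
    P.classSize i ≤ P.n := by
  rw [← P.sum_classSize h]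
  exact single_le_sum (f := P.classSize) (fun _ _ => Nat.zero_le _) (mem_range.2 hi)

theorem totalErr_le (P : DEParams) (h : P.totalSB ≤ P.n) : P.totalErr ≤ P.n := by
  rw [← P.sum_classSize h]
  exact sum_le_sum fun i _ => min_le_right _ _

theorem slackTo_le (P : DEParams) (i : ℕ) : P.slackTo i ≤ P.lenBits := by
  induction i with
  | zero => exact le_rfl
  | succ i ih => exact (min_le_left _ _).trans ih

theorem size_le_self (m : ℕ) : Nat.size m ≤ m := Nat.size_le.2 Nat.lt_two_pow_self

theorem load_le (P : DEParams) (h : P.totalSB ≤ P.n) (r : ℕ) : P.load r ≤ 3 * P.n := by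
  have h1 : P.totalErr / 4 ^ r ≤ P.n := (Nat.div_le_self _ _).trans (P.totalErr_le h)
  have h2 : P.slack ≤ P.n := (P.slackTo_le _).trans (size_le_self _)
  have h3 : (∑ i ∈ range (P.tB + 1), if 2 ^ r < 2 * P.classWeight i then P.classErr i else 0)
      ≤ P.totalErr := sum_le_sum fun i _ => by split_ifs <;> omega
  have := P.totalErr_le h
  unfold load
  omega

/-- Since `2 ^ 20 * (3 * n) < 2 ^ (size + 25)`, a block of `size + 25` random bits suffices for a
hash value of any stage; this fixes the layout of the random string. -/
theorem width_le (P : DEParams) (h : P.totalSB ≤ P.n) (r : ℕ) : P.width r ≤ P.size + 25 := by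
  refine Nat.size_le.2 ?_
  have h1 := P.load_le h r
  have h2 : P.n < 2 ^ P.n := Nat.lt_two_pow_self
  have h3 : (2 : ℕ) ^ P.n ≤ 2 ^ P.size := Nat.pow_le_pow_right (by norm_num) (by unfold size; omega)
  rw [pow_add]
  norm_num
  omega

/-- Keeps the number of hash functions per stage linear in the size. -/
theorem numStages_pow_lt (P : DEParams) {r : ℕ} (hr : r < P.numStages) :
    2 ^ r < 2 * P.lenBits := by
  unfold numStages at hr
  split_ifs at hr with h
  · omega
  · rw [Nat.lt_size] at hr
    have : 0 < 2 ^ r := by positivity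
    omega

theorem lenBits_le (P : DEParams) : P.lenBits ≤ P.n := size_le_self _

theorem numStages_le (P : DEParams) : P.numStages ≤ 2 * P.n := by
  unfold numStages
  have := P.lenBits_le
  have := size_le_self (2 * P.lenBits - 1)
  split_ifs <;> omega

end DEParams

/-! ### Computation of the parameter tables. -/

namespace RAM.Cmd

open RAM.Expr

/-- The memory contains the parameters. -/
structure HasParams (P : DEParams) (σ : Store) : Prop where
  n : σ 0 0 = P.n
  tA : σ 0 1 = P.tA
  tB : σ 0 2 = P.tB
  kA : σ 2 = arrayOf P.kA
  sB : σ 3 = arrayOf P.sB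
  kB : σ 4 = arrayOf P.kB

theorem HasParams.size {P : DEParams} {σ : Store} (h : HasParams P σ) : σ.size = P.size := by
  simp [Store.size, h.n, h.tA, h.tB, DEParams.size]

theorem HasParams.congr {P : DEParams} {σ τ : Store} (h : HasParams P σ)
    (h0 : τ 0 = σ 0) (h2 : τ 2 = σ 2) (h3 : τ 3 = σ 3) (h4 : τ 4 = σ 4) : HasParams P τ :=
  ⟨by rw [h0, h.n], by rw [h0, h.tA], by rw [h0, h.tB], by rw [h2, h.kA], by rw [h3, h.sB],
    by rw [h4, h.kB]⟩

/-- Computes the sizes (array `11`) and the error bounds (array `12`) of the classes. -/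
def classTables : Cmd :=
  seq (sumInto 45 20 2 (read 0 (const 1)))
    (seq (sumInto 45 21 3 (read 0 (const 2)))
      (seq (write 11 (const 0) (sub (read 0 (const 0)) (var 21)))
        (seq (write 12 (const 0) (var 20))
          (forLt 1 45 (read 0 (const 2))
            (seq (write 11 (add (var 45) (const 1)) (read 3 (var 45)))
              (write 12 (add (var 45) (const 1)) (read 4 (var 45))))))))

theorem classTables_spec {P : DEParams} {σ : Store} (h : HasParams P σ) :
    ∀ i < P.tB + 1, classTables.den σ 11 i = P.classSize i ∧
      classTables.den σ 12 i = P.classCap i := by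
  set σ1 := (sumInto 45 20 2 (read 0 (const 1))).den σ with hσ1
  have e1 : σ1 20 0 = P.totalKA := by
    rw [hσ1, sumInto_spec P.tA (by decide) (by rw [h.size, DEParams.size]; omega)
      (fun τ hτ => by simp [hτ 0 (by decide), h.tA]), h.kA, DEParams.sum_arrayOf]; rfl
  have f1 : ∀ a, a ∉ [20, 45] → σ1 a = σ a := fun a ha =>
    den_frame _ (by simp at ha; simp [sumInto, forLt, writes]; tauto) σ
  have hp1 : HasParams P σ1 := h.congr (f1 _ (by decide)) (f1 _ (by decide)) (f1 _ (by decide))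
    (f1 _ (by decide))
  set σ2 := (sumInto 45 21 3 (read 0 (const 2))).den σ1 with hσ2
  have e2 : σ2 21 0 = P.totalSB := by
    rw [hσ2, sumInto_spec P.tB (by decide) (by rw [hp1.size, DEParams.size]; omega)
      (fun τ hτ => by simp [hτ 0 (by decide), hp1.tB]), hp1.sB, DEParams.sum_arrayOf]; rfl
  have f2 : ∀ a, a ∉ [21, 45] → σ2 a = σ1 a := fun a ha =>
    den_frame _ (by simp at ha; simp [sumInto, forLt, writes]; tauto) σ1
  have hp2 : HasParams P σ2 := hp1.congr (f2 _ (by decide)) (f2 _ (by decide)) (f2 _ (by decide))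
    (f2 _ (by decide))
  set σ3 := (σ2.set 11 0 (P.n - P.totalSB)).set 12 0 P.totalKA with hσ3
  have f3 : ∀ a, a ∉ [11, 12] → σ3 a = σ2 a := by
    intro a ha
    simp only [List.mem_cons, not_or] at ha
    rw [hσ3, Store.set_ne ha.2.1, Store.set_ne ha.1]
  have hp3 : HasParams P σ3 := hp2.congr (f3 _ (by decide)) (f3 _ (by decide)) (f3 _ (by decide))
    (f3 _ (by decide))
  have hden : classTables.den σ = (forLt 1 45 (read 0 (const 2))
            (seq (write 11 (add (var 45) (const 1)) (read 3 (var 45)))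
              (write 12 (add (var 45) (const 1)) (read 4 (var 45))))).den σ3 := by
    simp only [classTables, den, ← hσ1, ← hσ2]
    have e1' : σ2 20 0 = P.totalKA := by rw [f2 20 (by decide), e1]
    have : (σ2.set 11 0 (P.n - P.totalSB)) 20 0 = P.totalKA := by
      rw [Store.set_ne (by decide), e1']
    simp [e2, hp2.n, hσ3, this]
  rw [hden]
  refine forLt_spec (σ := σ3) (fun j τ => ∀ i < j + 1, τ 11 i = P.classSize i ∧
      τ 12 i = P.classCap i) P.tB (by rw [hp3.size, DEParams.size]; omega) (by decide) ?_ ?_ ?_ ?_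
  · intro τ hτ
    simp [hτ 0 (by decide), hp3.tB]
  · intro j τ x hI
    rwa [Store.set_ne (by decide), Store.set_ne (by decide)]
  · intro i hi
    obtain rfl : i = 0 := by omega
    simp [hσ3, Store.set_apply, DEParams.classSize, DEParams.classCap]
  · intro j _ τ hτ hc hI i hi
    have h3 : τ 3 = arrayOf P.sB := by rw [hτ 3 (by decide), hp3.sB]
    have h4 : τ 4 = arrayOf P.kB := by rw [hτ 4 (by decide), hp3.kB]
    by_cases hij : i = j + 1
    · subst hij
      simp [den, Store.set_apply, hc, h3, h4, DEParams.classSize, DEParams.classCap]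
    · have := hI i (by omega)
      simp [den, Store.set_apply, hc, hij, this]

/-- Computes `slack` in `14`, from `lenBits` in `15`. -/
def minTables : Cmd :=
  seq (dbl 1 44 15 22 (const 1) (read 0 (const 0)))
    (seq (write 14 (const 0) (var 15))
      (forLt 1 45 (add (read 0 (const 2)) (const 1))
        (ite (sub (var 14) (read 12 (var 45))) (write 14 (const 0) (read 12 (var 45))) skip)))

theorem minTables_spec {P : DEParams} {σ : Store} (h : HasParams P σ)
    (h12 : ∀ i < P.tB + 1, σ 12 i = P.classCap i) :
    minTables.den σ 15 0 = P.lenBits ∧ minTables.den σ 14 0 = P.slack := by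
  set σ1 := (dbl 1 44 15 22 (const 1) (read 0 (const 0))).den σ with hσ1
  have e1 : σ1 15 0 = P.lenBits := by
    rw [hσ1, (dbl_spec 1 P.n (by decide) rfl one_pos
      (fun τ hτ => by simp [hτ 0 (by decide), h.n]) ?_).1, Nat.div_one]; rfl
    rw [h.size, Nat.div_one, DEParams.size]
    have := DEParams.size_le_self P.n
    omega
  have f1 : ∀ a, a ∉ [15, 22, 44] → σ1 a = σ a := fun a ha =>
    den_frame _ (by simp at ha; simp [dbl, forLt, writes]; tauto) σ
  have hp1 : HasParams P σ1 := h.congr (f1 _ (by decide)) (f1 _ (by decide)) (f1 _ (by decide))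
    (f1 _ (by decide))
  set σ2 := σ1.set 14 0 P.lenBits with hσ2
  have f2 : ∀ a, a ≠ 14 → σ2 a = σ1 a := fun a ha => Store.set_ne ha
  have hp2 : HasParams P σ2 := hp1.congr (f2 _ (by decide)) (f2 _ (by decide)) (f2 _ (by decide))
    (f2 _ (by decide))
  have hden : minTables.den σ = (forLt 1 45 (add (read 0 (const 2)) (const 1))
        (ite (sub (var 14) (read 12 (var 45))) (write 14 (const 0) (read 12 (var 45))) skip)).den
        σ2 := by
    simp [minTables, den, ← hσ1, e1, hσ2]
  refine ⟨?_, ?_⟩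
  · rw [hden, den_frame _ (by decide), f2 _ (by decide), e1]
  rw [hden]
  refine forLt_spec (σ := σ2) (fun j τ => τ 14 0 = P.slackTo j) (P.tB + 1)
    (by rw [hp2.size, DEParams.size]; omega) (by decide) ?_ ?_ ?_ ?_
  · intro τ hτ
    simp [hτ 0 (by decide), hp2.tB]
  · intro j τ x hI
    rwa [Store.set_ne (by decide)]
  · simp [hσ2, Store.set_apply, DEParams.slackTo]
  · intro j hj τ hτ hc hI
    have h4 : τ 12 j = P.classCap j := by
      rw [hτ 12 (by decide), f2 12 (by decide), f1 12 (by decide), h12 j hj]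
    by_cases hlt : P.slackTo j ≤ P.classCap j
    · rw [den, if_neg (by simp [hI, hc, h4]; omega)]
      simp [den, hI, DEParams.slackTo, hlt]
    · rw [den, if_pos (by simp [hI, hc, h4]; omega)]
      simp [den, Store.set_apply, hc, h4, DEParams.slackTo]
      omega

/-- Truncates the error bounds in array `12`, and computes the weights in array `13` and the total
number of errors in `16`. -/
def weightTables : Cmd :=
  seq (write 16 (const 0) (const 0))
    (forLt 1 45 (add (read 0 (const 2)) (const 1))
      (seq (write 12 (var 45) (sub (read 12 (var 45)) (sub (read 12 (var 45)) (read 11 (var 45)))))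
        (seq (dbl 1 44 28 22 (add (read 12 (var 45)) (sub (const 1) (read 12 (var 45))))
            (read 11 (var 45)))
          (seq (write 13 (var 45) (var 28))
            (write 16 (const 0) (add (var 16) (read 12 (var 45))))))))

theorem weightTables_spec {P : DEParams} (hv : P.totalSB ≤ P.n) {σ : Store} (h : HasParams P σ)
    (h11 : ∀ i < P.tB + 1, σ 11 i = P.classSize i)
    (h12 : ∀ i < P.tB + 1, σ 12 i = P.classCap i) :
    (∀ i < P.tB + 1, weightTables.den σ 12 i = P.classErr i ∧
      weightTables.den σ 13 i = P.classWeight i) ∧ weightTables.den σ 16 0 = P.totalErr := by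
  set σ1 := σ.set 16 0 0 with hσ1
  have f1 : ∀ a, a ≠ 16 → σ1 a = σ a := fun a ha => Store.set_ne ha
  have hp1 : HasParams P σ1 := h.congr (f1 _ (by decide)) (f1 _ (by decide)) (f1 _ (by decide))
    (f1 _ (by decide))
  have := forLt_spec (σ := σ1) (k := 1) (c := 45) (B := add (read 0 (const 2)) (const 1))
    (p := seq (write 12 (var 45) (sub (read 12 (var 45)) (sub (read 12 (var 45))
        (read 11 (var 45)))))
        (seq (dbl 1 44 28 22 (add (read 12 (var 45)) (sub (const 1) (read 12 (var 45))))
            (read 11 (var 45)))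
          (seq (write 13 (var 45) (var 28))
            (write 16 (const 0) (add (var 16) (read 12 (var 45)))))))
    -- Array `12` is truncated in place, so entries from `j` on still hold the original bounds.
    (fun j τ => (∀ i < P.tB + 1, τ 12 i = if i < j then P.classErr i else P.classCap i) ∧
      (∀ i < j, τ 13 i = P.classWeight i) ∧ τ 16 0 = ∑ i ∈ range j, P.classErr i)
    (P.tB + 1) (by rw [hp1.size, DEParams.size]; omega) (by decide) ?_ ?_ ?_ ?_
  · refine ⟨fun i hi => ⟨?_, this.2.1 i hi⟩, this.2.2⟩
    exact (this.1 i hi).trans (if_pos hi)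
  · intro τ hτ
    simp [hτ 0 (by decide), hp1.tB]
  · intro j τ x hI
    rwa [Store.set_ne (by decide), Store.set_ne (by decide), Store.set_ne (by decide)]
  · refine ⟨fun i hi => ?_, fun i hi => by omega, ?_⟩
    · rw [f1 _ (by decide), h12 i hi]; simp
    · simp [hσ1, Store.set_apply]
  · intro j hj τ hτ hc ⟨hI1, hI2, hI3⟩
    have e11 : τ 11 j = P.classSize j := by rw [hτ 11 (by decide), f1 _ (by decide), h11 j hj]
    have e12 : τ 12 j = P.classCap j := by rw [hI1 j hj, if_neg (lt_irrefl _)]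
    have e0 : τ 0 = σ 0 := by rw [hτ 0 (by decide), f1 _ (by decide)]
    -- With truncated subtraction, `a - (a - b)` is `min a b`.
    have emin : P.classCap j - (P.classCap j - P.classSize j) = P.classErr j := by
      unfold DEParams.classErr; omega
    set τ1 := τ.set 12 j (P.classErr j) with hτ1
    have g1 : ∀ a, a ≠ 12 → τ1 a = τ a := fun a ha => Store.set_ne ha
    set τ2 := (dbl 1 44 28 22 (add (read 12 (var 45)) (sub (const 1) (read 12 (var 45))))
            (read 11 (var 45))).den τ1 with hτ2
    have g2 : ∀ a, a ∉ [28, 22, 44] → τ2 a = τ1 a := fun a ha =>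
      den_frame _ (by simp at ha; simp [dbl, forLt, writes]; tauto) τ1
    have d2 : τ2 28 0 = P.classWeight j := by
      -- Likewise `e + (1 - e)` is `max e 1`, which keeps the divisor positive.
      refine (dbl_spec (max (P.classErr j) 1) (P.classSize j) (by decide) ?_ (by omega)
        (fun τ' hτ' => ?_) ?_).1
      · simp [hc, hτ1, Store.set_apply]; omega
      · simp [hτ' 11 (by decide), hτ' 45 (by decide), g1 45 (by decide), g1 11 (by decide), hc,
          e11]
      · have h1 : (P.classSize j / max (P.classErr j) 1).size ≤ P.n :=
          (DEParams.size_le_self _).trans ((Nat.div_le_self _ _).trans (P.classSize_le hv hj))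
        have h2 : τ1.size = P.size := by
          rw [← h.size, Store.size, g1 0 (by decide), e0]; rfl
        rw [h2, DEParams.size]; omega
    have d45 : τ2 45 0 = j := by rw [g2 45 (by decide), g1 45 (by decide), hc]
    have d12 : ∀ i, τ2 12 i = if i = j then P.classErr j else τ 12 i := by
      intro i; rw [g2 12 (by decide), hτ1, Store.set_apply]; simp
    have d16 : τ2 16 0 = ∑ i ∈ range j, P.classErr i := by
      rw [g2 16 (by decide), g1 16 (by decide), hI3]
    have d13 : τ2 13 = τ 13 := by rw [g2 13 (by decide), g1 13 (by decide)]
    have hden : (seq (write 12 (var 45) (sub (read 12 (var 45)) (sub (read 12 (var 45))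
        (read 11 (var 45)))))
        (seq (dbl 1 44 28 22 (add (read 12 (var 45)) (sub (const 1) (read 12 (var 45))))
            (read 11 (var 45)))
          (seq (write 13 (var 45) (var 28))
            (write 16 (const 0) (add (var 16) (read 12 (var 45))))))).den τ =
        (τ2.set 13 j (P.classWeight j)).set 16 0 (∑ i ∈ range (j + 1), P.classErr i) := by
      simp only [den, eval_read, eval_const, eval_sub, hc, e11, e12, emin, ← hτ1, ← hτ2]
      simp [d45, d2, Store.set_ne, d16, d12, sum_range_succ]
    rw [hden]
    refine ⟨fun i hi => ?_, fun i hi => ?_, ?_⟩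
    · rw [Store.set_ne (by decide), Store.set_ne (by decide), d12, hI1 i hi]
      by_cases hij : i = j
      · simp [hij]
      · have : i < j ↔ i < j + 1 := by omega
        simp [hij, this]
    · rw [Store.set_ne (by decide), Store.set_apply, d13]
      by_cases hij : i = j
      · simp [hij]
      · simp [hij, hI2 i (by omega)]
    · simp [Store.set_apply]

/-- The number of stages, in `31`. -/
def stageCount : Cmd :=
  ite (var 14) (dbl 1 44 31 22 (const 1) (sub (add (var 15) (var 15)) (const 1)))
    (write 31 (const 0) (const 0))

theorem stageCount_spec {P : DEParams} {σ : Store} (h : HasParams P σ)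
    (h14 : σ 14 0 = P.slack) (h15 : σ 15 0 = P.lenBits) :
    stageCount.den σ 31 0 = P.numStages := by
  by_cases hs : P.slack = 0
  · rw [stageCount, den, if_neg (by simp [h14, hs])]
    simp [den, Store.set_apply, DEParams.numStages, hs]
  · rw [stageCount, den, if_pos (by simp [h14, hs])]
    rw [(dbl_spec 1 (2 * P.lenBits - 1) (by decide) rfl one_pos
      (fun τ hτ => by simp [hτ 15 (by decide), h15, two_mul]) ?_).1, Nat.div_one]
    · simp [DEParams.numStages, hs]
    · rw [h.size, Nat.div_one, Nat.size_le, one_mul]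
      have h1 := P.lenBits_le
      have h2 : P.n < 2 ^ P.n := Nat.lt_two_pow_self
      have h3 : (2 : ℕ) ^ (P.n + 1) ≤ 2 ^ P.size :=
        Nat.pow_le_pow_right (by norm_num) (by unfold DEParams.size; omega)
      rw [pow_succ] at h3
      omega

/-- Copies the string to array `10`. -/
def copyString : Cmd := forLt 1 42 (read 0 (const 0)) (write 10 (var 42) (read 5 (var 42)))

theorem copyString_spec {P : DEParams} {σ : Store} (h : HasParams P σ) :
    ∀ i < P.n, copyString.den σ 10 i = σ 5 i := by
  refine forLt_spec (σ := σ) (fun j τ => ∀ i < j, τ 10 i = σ 5 i) P.n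
    (by rw [h.size, DEParams.size]; omega) (by decide) ?_ ?_ ?_ ?_
  · intro τ hτ
    simp [hτ 0 (by decide), h.n]
  · intro j τ x hI
    rwa [Store.set_ne (by decide)]
  · intro i hi; omega
  · intro j _ τ hτ hc hI i hi
    have h5 : τ 5 = σ 5 := hτ 5 (by decide)
    by_cases hij : i = j
    · simp [den, Store.set_apply, hij, hc, h5]
    · simp [den, Store.set_apply, hij, hc, hI i (by omega)]

/-- All computations that precede the first stage. -/
def prelude : Cmd :=
  seq classTables (seq minTables (seq weightTables (seq stageCount (seq copyString
    (seq (write 17 (const 0) (const 1)) (write 18 (const 0) (var 16)))))))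

/-- The memory contains everything that the stages need to know about the parameters. -/
structure HasTables (P : DEParams) (σ : Store) : Prop where
  n : σ 0 0 = P.n
  tB : σ 0 2 = P.tB
  size : σ.size = P.size
  err : ∀ i < P.tB + 1, σ 12 i = P.classErr i
  weight : ∀ i < P.tB + 1, σ 13 i = P.classWeight i
  slack : σ 14 0 = P.slack
  stages : σ 31 0 = P.numStages

theorem HasTables.congr {P : DEParams} {σ τ : Store} (h : HasTables P σ)
    (he : ∀ a ∈ [0, 12, 13, 14, 31], τ a = σ a) : HasTables P τ := by
  have h0 := he 0 (by decide)
  exact ⟨by rw [h0, h.n], by rw [h0, h.tB], by rw [Store.size, h0, ← h.size]; rfl,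
    by rw [he 12 (by decide)]; exact h.err, by rw [he 13 (by decide)]; exact h.weight,
    by rw [he 14 (by decide)]; exact h.slack, by rw [he 31 (by decide)]; exact h.stages⟩

theorem prelude_spec {P : DEParams} (hv : P.totalSB ≤ P.n) {σ : Store} (h : HasParams P σ) :
    HasTables P (prelude.den σ) ∧ (∀ i < P.n, prelude.den σ 10 i = σ 5 i) ∧
      prelude.den σ 17 0 = 1 ∧ prelude.den σ 18 0 = P.totalErr := by
  set σ1 := classTables.den σ with hσ1
  set σ2 := minTables.den σ1 with hσ2
  set σ3 := weightTables.den σ2 with hσ3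
  set σ4 := stageCount.den σ3 with hσ4
  set σ5 := copyString.den σ4 with hσ5
  have f1 : ∀ a, a ∉ classTables.writes → σ1 a = σ a := fun a ha => den_frame _ ha _
  have f2 : ∀ a, a ∉ minTables.writes → σ2 a = σ1 a := fun a ha => den_frame _ ha _
  have f3 : ∀ a, a ∉ weightTables.writes → σ3 a = σ2 a := fun a ha => den_frame _ ha _
  have f4 : ∀ a, a ∉ stageCount.writes → σ4 a = σ3 a := fun a ha => den_frame _ ha _
  have f5 : ∀ a, a ∉ copyString.writes → σ5 a = σ4 a := fun a ha => den_frame _ ha _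
  have h1 : HasParams P σ1 := h.congr (f1 _ (by decide)) (f1 _ (by decide)) (f1 _ (by decide))
    (f1 _ (by decide))
  have h2 : HasParams P σ2 := h1.congr (f2 _ (by decide)) (f2 _ (by decide)) (f2 _ (by decide))
    (f2 _ (by decide))
  have h3 : HasParams P σ3 := h2.congr (f3 _ (by decide)) (f3 _ (by decide)) (f3 _ (by decide))
    (f3 _ (by decide))
  have h4 : HasParams P σ4 := h3.congr (f4 _ (by decide)) (f4 _ (by decide)) (f4 _ (by decide))
    (f4 _ (by decide))
  have h5 : HasParams P σ5 := h4.congr (f5 _ (by decide)) (f5 _ (by decide)) (f5 _ (by decide))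
    (f5 _ (by decide))
  have s1 := classTables_spec h
  have s2 := minTables_spec h1 fun i hi => (s1 i hi).2
  have s3 := weightTables_spec hv h2
    (fun i hi => by rw [← (s1 i hi).1, ← hσ1, f2 11 (by decide)])
    (fun i hi => by rw [← (s1 i hi).2, ← hσ1, f2 12 (by decide)])
  have s4 := stageCount_spec h3 (by rw [f3 14 (by decide)]; exact s2.2)
    (by rw [f3 15 (by decide)]; exact s2.1)
  have s5 : ∀ i < P.n, σ5 10 i = σ4 5 i := copyString_spec h4
  have hden : prelude.den σ = (σ5.set 17 0 1).set 18 0 P.totalErr := by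
    have : σ5 16 0 = P.totalErr := by rw [f5 16 (by decide), f4 16 (by decide)]; exact s3.2
    simp only [prelude, den, ← hσ1, ← hσ2, ← hσ3, ← hσ4, ← hσ5]
    simp [Store.set_ne, this]
  have f6 : ∀ a, a ∉ [17, 18] → prelude.den σ a = σ5 a := by
    intro a ha
    simp only [List.mem_cons, not_or] at ha
    rw [hden, Store.set_ne ha.2.1, Store.set_ne ha.1]
  refine ⟨⟨?_, ?_, ?_, ?_, ?_, ?_, ?_⟩, ?_, ?_, ?_⟩
  · rw [f6 0 (by decide), h5.n]
  · rw [f6 0 (by decide), h5.tB]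
  · rw [← h5.size, Store.size, f6 0 (by decide)]; rfl
  · rw [f6 12 (by decide), f5 12 (by decide), f4 12 (by decide)]
    exact fun i hi => (s3.1 i hi).1
  · rw [f6 13 (by decide), f5 13 (by decide), f4 13 (by decide)]
    exact fun i hi => (s3.1 i hi).2
  · rw [f6 14 (by decide), f5 14 (by decide), f4 14 (by decide), f3 14 (by decide)]
    exact s2.2
  · rw [f6 31 (by decide), f5 31 (by decide)]
    exact s4
  · intro i hi
    rw [f6 10 (by decide), s5 i hi, f4 5 (by decide), f3 5 (by decide), f2 5 (by decide),
      f1 5 (by decide)]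
  · rw [hden, Store.set_ne (by decide)]; simp [Store.set_apply]
  · rw [hden]; simp [Store.set_apply]

end RAM.Cmd

/-! ### Hash values, bucket parities and the evolution of the string. -/

/-- The number with the binary digits `f 0, …, f (a - 1)`, the most significant one first. -/
def hashVal (f : ℕ → ℕ) : ℕ → ℕ
  | 0 => 0
  | a + 1 => 2 * hashVal f a + f a

theorem hashVal_lt {f : ℕ → ℕ} (hf : ∀ i, f i < 2) (a : ℕ) : hashVal f a < 2 ^ a := by
  induction a with
  | zero => simp [hashVal]
  | succ a ih => have := hf a; rw [hashVal, pow_succ]; omega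

/-- The sum of the entries of `z` at the positions with hash value `u`. -/
def bucketSum (n : ℕ) (h z : ℕ → ℕ) (u : ℕ) : ℕ := ∑ p ∈ range n, if h p = u then z p else 0

namespace DEParams

variable (P : DEParams)

/-- The hash value with `a` bits of position `p`, for the hash function number `γ`. -/
def posHash (ρ : ℕ → ℕ) (a γ p : ℕ) : ℕ :=
  hashVal (fun j => ρ ((γ * P.n + p) * (P.size + 25) + j)) a

/-- The hash function number `g` of stage `r`. -/
def stageHash (D : ℕ) (ρ : ℕ → ℕ) (r g : ℕ) : ℕ → ℕ :=
  P.posHash ρ (P.width r) (D * (2 ^ r - 1) + g)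

/-- The location in the message of the parity of bucket `u` of the hash function `g` of stage `r`. -/
def bitPos (D r g u : ℕ) : ℕ := P.offset D r + g * 2 ^ P.width r + u

/-- The number of hash functions of stage `r` that report an error at position `p`. -/
def votes (D : ℕ) (ρ msg : ℕ → ℕ) (r : ℕ) (z : ℕ → ℕ) (p : ℕ) : ℕ :=
  ∑ g ∈ range (D * 2 ^ r), (msg (P.bitPos D r g (P.stageHash D ρ r g p)) +
    bucketSum P.n (P.stageHash D ρ r g) z (P.stageHash D ρ r g p)) % 2

/-- The string before stage `r`. If `flip` holds, in each stage those entries change which have a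
sufficiently small weight and for which a majority of the hash functions report an error. -/
def stageString (flip : Bool) (D : ℕ) (ρ wt msg z : ℕ → ℕ) : ℕ → ℕ → ℕ
  | 0 => z
  | r + 1 => fun p =>
      if flip = true ∧ wt p ≤ 2 ^ r ∧
          D * 2 ^ r < 2 * P.votes D ρ msg r (stageString flip D ρ wt msg z r) p then
        1 - stageString flip D ρ wt msg z r p
      else stageString flip D ρ wt msg z r p

end DEParams

/-! ### The program of one stage. -/

namespace RAM.Cmd

open RAM.Expr

/-- Computes the hash value of a position in `28`. -/
def hashCmd : Cmd :=
  seq (write 28 (const 0) (const 0))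
    (forLt 32 43 (var 26)
      (write 28 (const 0) (add (add (var 28) (var 28)) (read 7 (add (var 24) (var 43))))))

theorem hashCmd_spec {σ : Store} {a : ℕ} (ha : σ 26 0 = a) (hle : a ≤ 32 * σ.size) :
    hashCmd.den σ 28 0 = hashVal (fun j => σ 7 (σ 24 0 + j)) a := by
  set σ1 := σ.set 28 0 0 with hσ1
  have f1 : ∀ b, b ≠ 28 → σ1 b = σ b := fun b hb => Store.set_ne hb
  refine forLt_spec (σ := σ1) (fun j τ => τ 28 0 = hashVal (fun j => σ 7 (σ 24 0 + j)) j) a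
    (by rw [Store.size, f1 0 (by decide)]; exact hle) (by decide) ?_ ?_ ?_ ?_
  · intro τ hτ
    simp [hτ 26 (by decide), f1 26 (by decide), ha]
  · intro j τ x hI
    rwa [Store.set_ne (by decide)]
  · simp [hσ1, Store.set_apply, hashVal]
  · intro j _ τ hτ hc hI
    have h7 : τ 7 = σ 7 := by rw [hτ 7 (by decide), f1 7 (by decide)]
    have h24 : τ 24 = σ 24 := by rw [hτ 24 (by decide), f1 24 (by decide)]
    simp [den, Store.set_apply, hashVal, hI, hc, h7, h24, two_mul]

/-- Adds the position with index `42` to its bucket. -/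
def posCmd : Cmd :=
  seq hashCmd (seq (write 29 (var 42) (var 28))
    (seq (write 24 (const 0) (add (var 24) (add sizeExpr (const 25))))
      (ite (read 10 (var 42)) (write 9 (add (var 19) (var 28))
        (sub (const 1) (read 9 (add (var 19) (var 28))))) skip)))

/-- Adds all positions to their buckets. -/
def bucketCmd : Cmd := forLt 1 42 (read 0 (const 0)) posCmd

/-- The pointer into the random string advances by one block per position, which avoids
multiplication. Replacing a bit `b` by `1 - b` is addition modulo two. -/
theorem bucketCmd_spec {P : DEParams} {σ : Store} {a γ off : ℕ} {z : ℕ → ℕ} (h : HasTables P σ)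
    (ha : σ 26 0 = a) (hle : a ≤ 32 * P.size) (hoff : σ 19 0 = off)
    (hptr : σ 24 0 = γ * P.n * (P.size + 25)) (hz : ∀ p < P.n, σ 10 p = z p)
    (hz2 : ∀ p, z p < 2) (h9 : ∀ i, σ 9 i < 2) :
    (∀ p < P.n, bucketCmd.den σ 29 p = P.posHash (σ 7) a γ p) ∧
      bucketCmd.den σ 24 0 = (γ + 1) * P.n * (P.size + 25) ∧
      ∀ i, bucketCmd.den σ 9 i = (σ 9 i + ∑ p ∈ range P.n,
        if off + P.posHash (σ 7) a γ p = i then z p else 0) % 2 := by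
  have := forLt_spec (σ := σ) (k := 1) (c := 42) (B := read 0 (const 0)) (p := posCmd)
    (fun j τ => (∀ p < j, τ 29 p = P.posHash (σ 7) a γ p) ∧
      τ 24 0 = (γ * P.n + j) * (P.size + 25) ∧
      ∀ i, τ 9 i = (σ 9 i + ∑ p ∈ range j,
        if off + P.posHash (σ 7) a γ p = i then z p else 0) % 2) P.n
    (by rw [h.size, DEParams.size]; omega) (by decide) ?_ ?_ ?_ ?_
  · refine ⟨this.1, ?_, this.2.2⟩
    refine this.2.1.trans ?_
    ring
  · intro τ hτ
    simp [hτ 0 (by decide), h.n]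
  · intro j τ x hI
    rwa [Store.set_ne (by decide), Store.set_ne (by decide), Store.set_ne (by decide)]
  · refine ⟨fun p hp => by omega, by simp [hptr], fun i => ?_⟩
    simp [Nat.mod_eq_of_lt (h9 i)]
  · intro j hj τ hτ hc ⟨hI1, hI2, hI3⟩
    have e0 : τ 0 = σ 0 := hτ 0 (by decide)
    have e7 : τ 7 = σ 7 := hτ 7 (by decide)
    have e10 : τ 10 = σ 10 := hτ 10 (by decide)
    have e19 : τ 19 = σ 19 := hτ 19 (by decide)
    have e26 : τ 26 = σ 26 := hτ 26 (by decide)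
    have esz : τ.size = P.size := by rw [← h.size, Store.size, e0]; rfl
    set τ1 := hashCmd.den τ with hτ1
    have g1 : ∀ b, b ∉ [28, 43] → τ1 b = τ b := fun b hb =>
      den_frame _ (by simp at hb; simp [hashCmd, forLt, writes]; tauto) τ
    have d28 : τ1 28 0 = P.posHash (σ 7) a γ j := by
      rw [hτ1, hashCmd_spec (by rw [e26, ha]) (by rw [esz]; exact hle), hI2, e7]; rfl
    set H := P.posHash (σ 7) a γ j with hH
    set τ2 := (τ1.set 29 j H).set 24 0 ((γ * P.n + (j + 1)) * (P.size + 25)) with hτ2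
    have g2 : ∀ b, b ∉ [29, 24] → τ2 b = τ1 b := by
      intro b hb
      simp only [List.mem_cons, not_or] at hb
      rw [hτ2, Store.set_ne hb.2.1, Store.set_ne hb.1]
    have hden : posCmd.den τ = (ite (read 10 (var 42)) (write 9 (add (var 19) (var 28))
        (sub (const 1) (read 9 (add (var 19) (var 28))))) skip).den τ2 := by
      have e42 : τ1 42 0 = j := by rw [g1 42 (by decide), hc]
      have e24 : τ1 24 0 = (γ * P.n + j) * (P.size + 25) := by rw [g1 24 (by decide), hI2]
      have esz1 : (τ1.set 29 j H).size = P.size := by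
        rw [← esz, Store.size, Store.set_ne (by decide), g1 0 (by decide)]; rfl
      have ering : (γ * P.n + (j + 1)) * (P.size + 25) =
          (γ * P.n + j) * (P.size + 25) + (P.size + 25) := by ring
      simp only [posCmd, den, ← hτ1]
      simp only [eval_read, eval_const, eval_add, e42, d28, eval_sizeExpr, esz1,
        Store.set_ne (show (24 : ℕ) ≠ 29 by decide), e24, ← ering, ← hτ2]
      rfl
    have c42 : τ2 42 0 = j := by rw [g2 42 (by decide), g1 42 (by decide), hc]
    have c19 : τ2 19 0 = off := by rw [g2 19 (by decide), g1 19 (by decide), e19, hoff]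
    have c28 : τ2 28 0 = H := by rw [g2 28 (by decide), d28]
    have c10 : τ2 10 j = z j := by
      rw [g2 10 (by decide), g1 10 (by decide), e10, hz j hj]
    have c9 : ∀ i, τ2 9 i = (σ 9 i + ∑ p ∈ range j,
        if off + P.posHash (σ 7) a γ p = i then z p else 0) % 2 := by
      intro i; rw [g2 9 (by decide), g1 9 (by decide), hI3]
    have c29 : ∀ p < j + 1, τ2 29 p = P.posHash (σ 7) a γ p := by
      intro p hp
      rw [hτ2, Store.set_ne (by decide), Store.set_apply, g1 29 (by decide)]
      by_cases hpj : p = j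
      · simp [hpj, hH]
      · simp [hpj, hI1 p (by omega)]
    have c24 : τ2 24 0 = (γ * P.n + (j + 1)) * (P.size + 25) := by
      simp [hτ2, Store.set_apply]
    rw [hden]
    by_cases hzj : z j = 0
    · rw [den, if_neg (by simp [c42, c10, hzj])]
      refine ⟨c29, c24, fun i => ?_⟩
      simp only [den]
      rw [c9, sum_range_succ, hzj]
      simp
    · have hz1 : z j = 1 := by have := hz2 j; omega
      rw [den, if_pos (by simp [c42, c10, hzj])]
      simp only [den]
      rw [Store.set_ne (by decide), Store.set_ne (by decide)]
      refine ⟨c29, c24, fun i => ?_⟩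
      simp only [eval_sub, eval_const, eval_read, eval_add, c19, c28, Store.set_apply, c9]
      rw [sum_range_succ, ← hH, hz1]
      by_cases hi : i = off + H
      · subst hi
        simp only [if_true, and_self]
        omega
      · rw [if_neg (by simp [hi]), if_neg (Ne.symm hi)]
        simp

/-- Processes one hash function: updates the parities, and counts the votes in array `30`. -/
def groupCmd : Cmd :=
  seq bucketCmd
    (seq (forLt 1 42 (read 0 (const 0)) (write 30 (var 42)
        (add (read 30 (var 42)) (read 9 (add (var 19) (read 29 (var 42)))))))
      (write 19 (const 0) (add (var 19) (var 27))))

/-- Votes are read after all positions have entered their buckets; a bucket then holds the incoming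
bit plus the own parity, which for Bob signals a mismatch with Alice's string. -/
theorem groupCmd_spec {P : DEParams} {σ : Store} {a γ off : ℕ} {z : ℕ → ℕ} (h : HasTables P σ)
    (ha : σ 26 0 = a) (hle : a ≤ 32 * P.size) (hm : σ 27 0 = 2 ^ a) (hoff : σ 19 0 = off)
    (hptr : σ 24 0 = γ * P.n * (P.size + 25)) (hz : ∀ p < P.n, σ 10 p = z p)
    (hz2 : ∀ p, z p < 2) (h9 : ∀ i, σ 9 i < 2) (h7 : ∀ i, σ 7 i < 2) :
    groupCmd.den σ 24 0 = (γ + 1) * P.n * (P.size + 25) ∧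
      groupCmd.den σ 19 0 = off + 2 ^ a ∧
      (∀ i, i < off ∨ off + 2 ^ a ≤ i → groupCmd.den σ 9 i = σ 9 i) ∧
      (∀ u, groupCmd.den σ 9 (off + u) =
        (σ 9 (off + u) + bucketSum P.n (P.posHash (σ 7) a γ) z u) % 2) ∧
      (∀ i, groupCmd.den σ 9 i < 2) ∧
      (∀ p < P.n, groupCmd.den σ 30 p = σ 30 p + (σ 9 (off + P.posHash (σ 7) a γ p) +
        bucketSum P.n (P.posHash (σ 7) a γ) z (P.posHash (σ 7) a γ p)) % 2) := by
  obtain ⟨b1, b2, b3⟩ := bucketCmd_spec h ha hle hoff hptr hz hz2 h9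
  set H := P.posHash (σ 7) a γ with hH
  have hHlt : ∀ p, H p < 2 ^ a := fun p => hashVal_lt (fun i => h7 _) a
  set σ1 := bucketCmd.den σ with hσ1
  have f1 : ∀ b, b ∉ bucketCmd.writes → σ1 b = σ b := fun b hb => den_frame _ hb σ
  set q : Cmd := forLt 1 42 (read 0 (const 0)) (write 30 (var 42)
        (add (read 30 (var 42)) (read 9 (add (var 19) (read 29 (var 42))))))
  set σ2 := q.den σ1 with hσ2
  have f2 : ∀ b, b ∉ q.writes → σ2 b = σ1 b := fun b hb => den_frame _ hb σ1
  have e2 : ∀ p < P.n, σ2 30 p = σ1 30 p + σ1 9 (off + H p) := by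
    have := forLt_spec (σ := σ1) (k := 1) (c := 42) (B := read 0 (const 0))
      (p := write 30 (var 42)
        (add (read 30 (var 42)) (read 9 (add (var 19) (read 29 (var 42))))))
      (fun j τ => ∀ p, τ 30 p = if p < j then σ1 30 p + σ1 9 (off + H p) else σ1 30 p) P.n
      (by rw [Store.size, f1 0 (by decide)]; have := h.size; have := h.n
          simp only [Store.size] at *; omega) (by decide) ?_ ?_ ?_ ?_
    · intro p hp
      exact (this p).trans (if_pos hp)
    · intro τ hτ
      simp [hτ 0 (by decide), f1 0 (by decide), h.n]
    · intro j τ x hI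
      rwa [Store.set_ne (by decide)]
    · simp
    · intro j hj τ hτ hc hI p
      have e9 : τ 9 = σ1 9 := hτ 9 (by decide)
      have e29 : τ 29 j = H j := by rw [hτ 29 (by decide), b1 j hj]
      have e19 : τ 19 0 = off := by rw [hτ 19 (by decide), f1 19 (by decide), hoff]
      by_cases hpj : p = j
      · subst hpj
        simp [den, Store.set_apply, hc, e9, e19, e29, hI]
      · have : p < j + 1 ↔ p < j := by omega
        simp [den, Store.set_apply, hc, hI, hpj, this]
  have hden : groupCmd.den σ = σ2.set 19 0 (off + 2 ^ a) := by
    have e19 : σ2 19 0 = off := by rw [f2 19 (by decide), f1 19 (by decide), hoff]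
    have e27 : σ2 27 0 = 2 ^ a := by rw [f2 27 (by decide), f1 27 (by decide), hm]
    simp only [groupCmd, den, ← hσ1]
    change Store.set σ2 19 0 (σ2 19 0 + σ2 27 0) = _
    rw [e19, e27]
  have c9 : groupCmd.den σ 9 = σ1 9 := by
    rw [hden, Store.set_ne (by decide), f2 9 (by decide)]
  have c30 : groupCmd.den σ 30 = σ2 30 := by rw [hden, Store.set_ne (by decide)]
  have hbk : ∀ u, σ1 9 (off + u) = (σ 9 (off + u) + bucketSum P.n H z u) % 2 := by
    intro u
    simp [b3, bucketSum]
  refine ⟨?_, ?_, ?_, ?_, ?_, ?_⟩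
  · rw [hden, Store.set_ne (by decide), f2 24 (by decide), b2]
  · simp [hden, Store.set_apply]
  · intro i hi
    rw [c9, b3, sum_eq_zero, add_zero, Nat.mod_eq_of_lt (h9 i)]
    intro p _
    have := hHlt p
    rw [if_neg (by omega)]
  · intro u
    rw [c9, hbk]
  · intro i
    rw [c9, b3]
    exact Nat.mod_lt _ (by norm_num)
  · intro p hp
    rw [c30, e2 p hp, hbk, f1 30 (by decide)]

/-- Computes the width of the hash values of a stage in `26`, and the number of buckets in `27`. -/
def widthCmd : Cmd :=
  seq (write 25 (const 0) (add (var 18) (var 14)))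
    (seq (forLt 1 45 (add (read 0 (const 2)) (const 1))
        (ite (sub (add (read 13 (var 45)) (read 13 (var 45))) (var 17))
          (write 25 (const 0) (add (var 25) (read 12 (var 45)))) skip))
      (dbl 32 44 26 27 (const 1) (mulc (2 ^ 20) (var 25))))

theorem widthCmd_spec {P : DEParams} (hv : P.totalSB ≤ P.n) {σ : Store} {r : ℕ}
    (h : HasTables P σ) (h17 : σ 17 0 = 2 ^ r) (h18 : σ 18 0 = P.totalErr / 4 ^ r) :
    widthCmd.den σ 26 0 = P.width r ∧ widthCmd.den σ 27 0 = 2 ^ P.width r := by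
  set σ1 := σ.set 25 0 (P.totalErr / 4 ^ r + P.slack) with hσ1
  have f1 : ∀ b, b ≠ 25 → σ1 b = σ b := fun b hb => Store.set_ne hb
  set q := (forLt 1 45 (add (read 0 (const 2)) (const 1))
        (ite (sub (add (read 13 (var 45)) (read 13 (var 45))) (var 17))
          (write 25 (const 0) (add (var 25) (read 12 (var 45)))) skip)) with hq
  set σ2 := q.den σ1 with hσ2
  have f2 : ∀ b, b ∉ [25, 45] → σ2 b = σ1 b := fun b hb =>
    den_frame _ (by simp at hb; simp [hq, forLt, writes]; tauto) σ1
  have e2 : σ2 25 0 = P.load r := by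
    refine forLt_spec (σ := σ1) (fun j τ => τ 25 0 = P.totalErr / 4 ^ r + P.slack +
      ∑ i ∈ range j, if 2 ^ r < 2 * P.classWeight i then P.classErr i else 0) (P.tB + 1) ?_
      (by decide) ?_ ?_ ?_ ?_
    · rw [Store.size, f1 0 (by decide)]; have := h.size; have := h.tB
      simp only [Store.size] at *; omega
    · intro τ hτ
      simp [hτ 0 (by decide), f1 0 (by decide), h.tB]
    · intro j τ x hI
      rwa [Store.set_ne (by decide)]
    · simp [hσ1, Store.set_apply]
    · intro j hj τ hτ hc hI
      have e12 : τ 12 j = P.classErr j := by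
        rw [hτ 12 (by decide), f1 12 (by decide), h.err j hj]
      have e13 : τ 13 j = P.classWeight j := by
        rw [hτ 13 (by decide), f1 13 (by decide), h.weight j hj]
      have e17 : τ 17 0 = 2 ^ r := by rw [hτ 17 (by decide), f1 17 (by decide), h17]
      rw [sum_range_succ]
      by_cases hlt : 2 ^ r < 2 * P.classWeight j
      · rw [den, if_pos (by simp [hc, e13, e17]; omega), if_pos hlt]
        simp [den, Store.set_apply, hI, hc, e12, add_assoc]
      · rw [den, if_neg (by simp [hc, e13, e17]; omega), if_neg hlt]
        simp [den, hI]
  have hden : widthCmd.den σ = (dbl 32 44 26 27 (const 1) (mulc (2 ^ 20) (var 25))).den σ2 := by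
    simp [widthCmd, den, h18, h.slack, ← hσ1, ← hq, ← hσ2]
  rw [hden]
  have := dbl_spec (k := 32) (c := 44) (out := 26) (tmp := 27) (X := const 1)
    (B := mulc (2 ^ 20) (var 25)) (σ := σ2) 1 (2 ^ 20 * P.load r) (by decide) rfl one_pos
    (fun τ hτ => by simp [hτ 25 (by decide), e2]) ?_
  · rw [Nat.div_one, one_mul] at this
    exact this
  · have hs : σ2.size = P.size := by
      rw [← h.size, Store.size, f2 0 (by decide), f1 0 (by decide)]; rfl
    rw [hs, Nat.div_one]
    have := P.width_le hv r
    simp only [DEParams.width, DEParams.size] at *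
    omega

/-- The changes of the string at the end of a stage. -/
def flipCmd (flip : Bool) (D : ℕ) : Cmd :=
  forLt 1 42 (read 0 (const 0))
    (seq (ite (sub (add (var 17) (const 1)) (read 13 (read 6 (var 42))))
        (ite (sub (mulc 2 (read 30 (var 42))) (mulc D (var 17)))
          (ite (const flip.toNat) (write 10 (var 42) (sub (const 1) (read 10 (var 42)))) skip)
          skip) skip)
      (write 30 (var 42) (const 0)))

theorem flipCmd_spec {P : DEParams} {σ : Store} (flip : Bool) (D : ℕ) (h : HasTables P σ) :
    ∀ p < P.n, (flipCmd flip D).den σ 30 p = 0 ∧ (flipCmd flip D).den σ 10 p =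
      if flip = true ∧ σ 13 (σ 6 p) ≤ σ 17 0 ∧ D * σ 17 0 < 2 * σ 30 p then 1 - σ 10 p
      else σ 10 p := by
  have := forLt_spec (σ := σ) (k := 1) (c := 42) (B := read 0 (const 0))
    (p := (seq (ite (sub (add (var 17) (const 1)) (read 13 (read 6 (var 42))))
        (ite (sub (mulc 2 (read 30 (var 42))) (mulc D (var 17)))
          (ite (const flip.toNat) (write 10 (var 42) (sub (const 1) (read 10 (var 42)))) skip)
          skip) skip)
      (write 30 (var 42) (const 0))))
    (fun j τ => (∀ p, τ 30 p = if p < j then 0 else σ 30 p) ∧ ∀ p, τ 10 p = if p < j then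
      (if flip = true ∧ σ 13 (σ 6 p) ≤ σ 17 0 ∧ D * σ 17 0 < 2 * σ 30 p then 1 - σ 10 p
      else σ 10 p) else σ 10 p) P.n (by rw [h.size, DEParams.size]; omega) (by
        simp [writes]) ?_ ?_ ?_ ?_
  · intro p hp
    exact ⟨(this.1 p).trans (if_pos hp), (this.2 p).trans (if_pos hp)⟩
  · intro τ hτ
    simp [hτ 0 (by simp [writes]), h.n]
  · intro j τ x hI
    rwa [Store.set_ne (by decide), Store.set_ne (by decide)]
  · simp
  · intro j hj τ hτ hc ⟨hI1, hI2⟩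
    have e6 : τ 6 = σ 6 := hτ 6 (by simp [writes])
    have e13 : τ 13 = σ 13 := hτ 13 (by simp [writes])
    have e17 : τ 17 = σ 17 := hτ 17 (by simp [writes])
    have e30 : τ 30 j = σ 30 j := by simp [hI1]
    have e10 : τ 10 j = σ 10 j := by simp [hI2]
    have hin : (ite (sub (add (var 17) (const 1)) (read 13 (read 6 (var 42))))
        (ite (sub (mulc 2 (read 30 (var 42))) (mulc D (var 17)))
          (ite (const flip.toNat) (write 10 (var 42) (sub (const 1) (read 10 (var 42)))) skip)
          skip) skip).den τ = τ.set 10 j (if flip = true ∧ σ 13 (σ 6 j) ≤ σ 17 0 ∧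
            D * σ 17 0 < 2 * σ 30 j then 1 - σ 10 j else σ 10 j) := by
      have hself : τ = τ.set 10 j (σ 10 j) := by
        funext b i
        rw [Store.set_apply]
        split_ifs with hb
        · rw [hb.1, hb.2, e10]
        · rfl
      by_cases h1 : σ 13 (σ 6 j) ≤ σ 17 0
      · rw [den, if_pos (by simp [hc, e6, e13, e17]; omega)]
        by_cases h2 : D * σ 17 0 < 2 * σ 30 j
        · rw [den, if_pos (by simp [hc, e30, e17]; omega)]
          cases flip
          · rw [den, if_neg (by simp), if_neg (by simp)]
            exact hself
          · rw [den, if_pos (by simp), if_pos ⟨rfl, h1, h2⟩]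
            simp [den, hc, e10]
        · rw [den, if_neg (by simp [hc, e30, e17]; omega), if_neg (by tauto)]
          exact hself
      · rw [den, if_neg (by simp [hc, e6, e13, e17]; omega), if_neg (by tauto)]
        exact hself
    rw [den, hin, den]
    simp only [eval_read, eval_const]
    rw [Store.set_ne (show (42 : ℕ) ≠ 10 by decide), hc]
    refine ⟨fun p => ?_, fun p => ?_⟩
    · rw [Store.set_apply, Store.set_ne (by decide)]
      by_cases hpj : p = j
      · simp [hpj]
      · have : p < j + 1 ↔ p < j := by omega
        simp [hpj, this, hI1]
    · rw [Store.set_ne (by decide), Store.set_apply]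
      by_cases hpj : p = j
      · simp [hpj]
      · have : p < j + 1 ↔ p < j := by omega
        simp [hpj, this, hI2]

/-- Divides `18` by four. -/
def quarterCmd : Cmd :=
  seq (write 23 (const 0) (const 0))
    (seq (forLt 1 45 (read 0 (const 0)) (ite (sub (var 18) (const 3))
        (seq (write 18 (const 0) (sub (var 18) (const 4)))
          (write 23 (const 0) (add (var 23) (const 1)))) skip))
      (write 18 (const 0) (var 23)))

theorem quarterCmd_spec {P : DEParams} {σ : Store} {m : ℕ} (h : HasTables P σ) (hm : σ 18 0 = m)
    (hle : m ≤ P.n) : quarterCmd.den σ 18 0 = m / 4 := by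
  set σ1 := σ.set 23 0 0 with hσ1
  have f1 : ∀ b, b ≠ 23 → σ1 b = σ b := fun b hb => Store.set_ne hb
  have := forLt_spec (σ := σ1) (k := 1) (c := 45) (B := read 0 (const 0))
    (p := (ite (sub (var 18) (const 3))
        (seq (write 18 (const 0) (sub (var 18) (const 4)))
          (write 23 (const 0) (add (var 23) (const 1)))) skip))
    -- Division by repeated subtraction; `n` rounds suffice because `m ≤ n`.
    (fun j τ => τ 18 0 + 4 * τ 23 0 = m ∧ τ 23 0 = min j (m / 4)) P.n ?_ (by decide) ?_ ?_ ?_ ?_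
  · have h2 : quarterCmd.den σ 18 0 = ((forLt 1 45 (read 0 (const 0)) (ite (sub (var 18) (const 3))
        (seq (write 18 (const 0) (sub (var 18) (const 4)))
          (write 23 (const 0) (add (var 23) (const 1)))) skip)).den σ1) 23 0 := by
      simp only [quarterCmd, den]
      simp [Store.set_apply, hσ1]
    rw [h2, this.2]
    omega
  · rw [Store.size, f1 0 (by decide)]; have := h.size; have := h.n
    simp only [Store.size] at *; omega
  · intro τ hτ
    simp [hτ 0 (by decide), f1 0 (by decide), h.n]
  · intro j τ x hI
    rwa [Store.set_ne (by decide), Store.set_ne (by decide)]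
  · simp [hσ1, Store.set_apply, hm]
  · intro j hj τ hτ hc ⟨hI1, hI2⟩
    by_cases hlt : 3 < τ 18 0
    · rw [den, if_pos (by simp; omega)]
      simp [den, Store.set_apply]
      omega
    · rw [den, if_neg (by simp; omega)]
      simp only [den]
      omega

end RAM.Cmd

/-! ### All hash functions of a stage, and all stages. -/

namespace RAM.Cmd

open RAM.Expr

/-- All hash functions of a stage. -/
def groupsCmd (D : ℕ) : Cmd := forLt (2 * D) 41 (mulc D (var 17)) groupCmd

theorem groupsCmd_spec {P : DEParams} (hv : P.totalSB ≤ P.n) {σ : Store} {D r : ℕ} {z : ℕ → ℕ}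
    (h : HasTables P σ) (hr : r < P.numStages) (h17 : σ 17 0 = 2 ^ r)
    (ha : σ 26 0 = P.width r) (hm : σ 27 0 = 2 ^ P.width r) (hoff : σ 19 0 = P.offset D r)
    (hptr : σ 24 0 = D * (2 ^ r - 1) * P.n * (P.size + 25)) (hz : ∀ p < P.n, σ 10 p = z p)
    (hz2 : ∀ p, z p < 2) (h9 : ∀ i, σ 9 i < 2) (h7 : ∀ i, σ 7 i < 2)
    (h30 : ∀ p < P.n, σ 30 p = 0) :
    (groupsCmd D).den σ 24 0 = D * (2 ^ (r + 1) - 1) * P.n * (P.size + 25) ∧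
      (groupsCmd D).den σ 19 0 = P.offset D (r + 1) ∧
      (∀ i, i < P.offset D r ∨ P.offset D (r + 1) ≤ i → (groupsCmd D).den σ 9 i = σ 9 i) ∧
      (∀ g < D * 2 ^ r, ∀ u < 2 ^ P.width r, (groupsCmd D).den σ 9 (P.bitPos D r g u) =
        (σ 9 (P.bitPos D r g u) + bucketSum P.n (P.stageHash D (σ 7) r g) z u) % 2) ∧
      (∀ i, (groupsCmd D).den σ 9 i < 2) ∧
      ∀ p < P.n, (groupsCmd D).den σ 30 p = P.votes D (σ 7) (σ 9) r z p := by
  set w := P.width r with hw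
  set o := P.offset D r with ho
  -- The size is at least `2`, so `size + 25` is below `32 * size`.
  have hwle : w ≤ 32 * P.size := by
    have := P.width_le hv r
    simp only [DEParams.size] at *
    omega
  have hHlt : ∀ g p, P.stageHash D (σ 7) r g p < 2 ^ w := fun g p => hashVal_lt (fun i => h7 _) _
  have hbound : D * 2 ^ r ≤ 2 * D * P.size := by
    have h1 := P.numStages_pow_lt hr
    have h2 := P.lenBits_le
    have h3 : 2 ^ r ≤ 2 * P.size := by unfold DEParams.size; omega
    calc D * 2 ^ r ≤ D * (2 * P.size) := Nat.mul_le_mul_left _ h3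
      _ = _ := by ring
  have hoff1 : P.offset D (r + 1) = o + D * 2 ^ r * 2 ^ w := by
    rw [DEParams.offset, sum_range_succ]; rfl
  have := forLt_spec (σ := σ) (k := 2 * D) (c := 41) (B := mulc D (var 17)) (p := groupCmd)
    (fun j τ => τ 24 0 = (D * (2 ^ r - 1) + j) * P.n * (P.size + 25) ∧
      τ 19 0 = o + j * 2 ^ w ∧
      (∀ i, i < o ∨ o + j * 2 ^ w ≤ i → τ 9 i = σ 9 i) ∧
      (∀ g < j, ∀ u < 2 ^ w, τ 9 (P.bitPos D r g u) =
        (σ 9 (P.bitPos D r g u) + bucketSum P.n (P.stageHash D (σ 7) r g) z u) % 2) ∧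
      (∀ i, τ 9 i < 2) ∧
      ∀ p < P.n, τ 30 p = ∑ g ∈ range j, (σ 9 (P.bitPos D r g (P.stageHash D (σ 7) r g p)) +
        bucketSum P.n (P.stageHash D (σ 7) r g) z (P.stageHash D (σ 7) r g p)) % 2)
    (D * 2 ^ r) (by rw [h.size]; exact hbound) (by decide) ?_ ?_ ?_ ?_
  · obtain ⟨t1, t2, t3, t4, t5, t6⟩ := this
    refine ⟨t1.trans ?_, t2.trans hoff1.symm, fun i hi => t3 i (by rwa [← hoff1]), t4, t5, t6⟩
    have : 2 ^ (r + 1) - 1 = (2 ^ r - 1) + 2 ^ r := by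
      have : 0 < 2 ^ r := by positivity
      rw [pow_succ]; omega
    rw [this]; ring
  · intro τ hτ
    simp [hτ 17 (by decide), h17]
  · intro j τ x hI
    rwa [Store.set_ne (by decide), Store.set_ne (by decide), Store.set_ne (by decide),
      Store.set_ne (by decide)]
  · refine ⟨by simp [hptr], by simp [hoff], fun _ _ => rfl, fun g hg => by omega, h9, ?_⟩
    simpa using h30
  · intro j hj τ hτ hc ⟨t1, t2, t3, t4, t5, t6⟩
    have e7 : τ 7 = σ 7 := hτ 7 (by decide)
    have hT : HasTables P τ := h.congr (by
      intro a ha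
      exact hτ a (by revert a; decide))
    obtain ⟨s1, s2, s3, s4, s5, s6⟩ := groupCmd_spec (a := w) (γ := D * (2 ^ r - 1) + j)
      (off := o + j * 2 ^ w) (z := z) hT
      (by rw [hτ 26 (by decide), ha]) hwle (by rw [hτ 27 (by decide), hm]) t2 t1
      (fun p hp => by rw [hτ 10 (by decide), hz p hp]) hz2 t5 (by rw [e7]; exact h7)
    have hH : P.posHash (τ 7) w (D * (2 ^ r - 1) + j) = P.stageHash D (σ 7) r j := by
      rw [e7]; rfl
    rw [hH] at s4 s6
    -- Different hash functions own disjoint blocks of the message, so block `j` still holds its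
    -- incoming bits.
    have hge : ∀ u, τ 9 (P.bitPos D r j u) = σ 9 (P.bitPos D r j u) := fun u =>
      t3 _ (Or.inr (by unfold DEParams.bitPos; rw [← hw, ← ho]; omega))
    have hsucc : o + (j + 1) * 2 ^ w = o + j * 2 ^ w + 2 ^ w := by ring
    refine ⟨s1, by rw [s2, hsucc], fun i hi => ?_, fun g hg u hu => ?_, s5, fun p hp => ?_⟩
    · rw [hsucc] at hi
      rw [s3 i (by omega), t3 i (by omega)]
    · rcases Nat.lt_succ_iff_lt_or_eq.1 hg with hg' | rfl
      · rw [s3 _ (Or.inl ?_), t4 g hg' u hu]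
        have : (g + 1) * 2 ^ w ≤ j * 2 ^ w := Nat.mul_le_mul_right _ hg'
        rw [add_mul, one_mul] at this
        change o + g * 2 ^ w + u < _
        omega
      · rw [← hge u]
        exact s4 u
    · rw [s6 p hp, t6 p hp, sum_range_succ, ← hge]
      rfl

/-- One stage. -/
def stageCmd (flip : Bool) (D : ℕ) : Cmd :=
  seq widthCmd (seq (groupsCmd D) (seq (flipCmd flip D)
    (seq (write 17 (const 0) (add (var 17) (var 17))) quarterCmd)))

/-- The program of both parties; it changes the string only if `flip` holds. -/
def mainCmd (flip : Bool) (D : ℕ) : Cmd :=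
  seq prelude (seq (forLt 2 40 (var 31) (stageCmd flip D)) (write 8 (const 0) (var 19)))

/-- The parameters affect only expressions and loop lengths, so questions about written arrays
reduce to a closed list, where `decide` applies. -/
theorem writes_stageCmd (flip : Bool) (D : ℕ) : (stageCmd flip D).writes =
    (stageCmd false 0).writes := rfl

theorem writes_mainCmd (flip : Bool) (D : ℕ) : (mainCmd flip D).writes =
    (mainCmd false 0).writes := rfl

theorem wf_mainCmd (flip : Bool) (D : ℕ) : (mainCmd flip D).WF := by
  have h1 : (mainCmd flip D).WF = (mainCmd false 0).WF := rfl
  rw [h1]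
  simp [mainCmd, WF, prelude, classTables, minTables, weightTables, stageCount, copyString,
    stageCmd, widthCmd, groupsCmd, groupCmd, bucketCmd, posCmd, hashCmd, flipCmd, quarterCmd,
    sumInto, dbl, forLt, writes]

theorem zero_notMem_writes_mainCmd (flip : Bool) (D : ℕ) : 0 ∉ (mainCmd flip D).writes := by
  rw [writes_mainCmd]; decide

theorem stageString_lt_two {P : DEParams} {flip : Bool} {D : ℕ} {ρ wt msg z : ℕ → ℕ}
    (hz : ∀ p, z p < 2) (r p : ℕ) : P.stageString flip D ρ wt msg z r p < 2 := by
  induction r generalizing p with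
  | zero => exact hz p
  | succ r ih =>
      have := ih p
      simp only [DEParams.stageString]
      split_ifs <;> omega

/-- The state of the memory before stage `r`. -/
structure StageInv (P : DEParams) (flip : Bool) (D : ℕ) (σ : Store) (z : ℕ → ℕ) (r : ℕ)
    (τ : Store) : Prop where
  tables : HasTables P τ
  level : τ 17 0 = 2 ^ r
  err : τ 18 0 = P.totalErr / 4 ^ r
  offset : τ 19 0 = P.offset D r
  ptr : τ 24 0 = D * (2 ^ r - 1) * P.n * (P.size + 25)
  string : ∀ p < P.n, τ 10 p =
    P.stageString flip D (σ 7) (fun p => τ 13 (σ 6 p)) (σ 9) z r p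
  votes : ∀ p < P.n, τ 30 p = 0
  rest : ∀ i, P.offset D r ≤ i → τ 9 i = σ 9 i
  done : ∀ q < r, ∀ g < D * 2 ^ q, ∀ u < 2 ^ P.width q, τ 9 (P.bitPos D q g u) =
    (σ 9 (P.bitPos D q g u) + bucketSum P.n (P.stageHash D (σ 7) q g)
      (P.stageString flip D (σ 7) (fun p => τ 13 (σ 6 p)) (σ 9) z q) u) % 2
  bits : ∀ i, τ 9 i < 2

theorem bitPos_lt_offset (P : DEParams) {D q g u : ℕ} (hg : g < D * 2 ^ q)
    (hu : u < 2 ^ P.width q) : P.bitPos D q g u < P.offset D (q + 1) := by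
  rw [DEParams.offset, sum_range_succ, DEParams.bitPos, DEParams.offset]
  have : (g + 1) * 2 ^ P.width q ≤ D * 2 ^ q * 2 ^ P.width q := Nat.mul_le_mul_right _ hg
  rw [add_mul, one_mul] at this
  omega

theorem offset_mono (P : DEParams) (D : ℕ) : Monotone (P.offset D) :=
  fun _ _ h => sum_le_sum_of_subset (range_subset_range.2 h)

theorem stageCmd_spec {P : DEParams} (hv : P.totalSB ≤ P.n) {flip : Bool} {D r : ℕ}
    {σ τ : Store} {z : ℕ → ℕ} (hr : r < P.numStages) (hz2 : ∀ p, z p < 2) (h6 : τ 6 = σ 6)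
    (h7 : τ 7 = σ 7) (h72 : ∀ i, σ 7 i < 2) (hI : StageInv P flip D σ z r τ) :
    StageInv P flip D σ z (r + 1) ((stageCmd flip D).den τ) := by
  set τ1 := widthCmd.den τ with hτ1
  set τ2 := (groupsCmd D).den τ1 with hτ2
  set τ3 := (flipCmd flip D).den τ2 with hτ3
  set τ4 := τ3.set 17 0 (τ3 17 0 + τ3 17 0) with hτ4
  have hden : (stageCmd flip D).den τ = quarterCmd.den τ4 := rfl
  rw [hden]
  set τ5 := quarterCmd.den τ4 with hτ5
  have f1 : ∀ a, a ∉ widthCmd.writes → τ1 a = τ a := fun a ha => den_frame _ ha _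
  have f2 : ∀ a, a ∉ (groupsCmd 0).writes → τ2 a = τ1 a := fun a ha =>
    den_frame (groupsCmd D) ha τ1
  have f3 : ∀ a, a ∉ (flipCmd false 0).writes → τ3 a = τ2 a := fun a ha =>
    den_frame (flipCmd flip D) ha τ2
  have f4 : ∀ a, a ≠ 17 → τ4 a = τ3 a := fun a ha => Store.set_ne ha
  have f5 : ∀ a, a ∉ quarterCmd.writes → τ5 a = τ4 a := fun a ha => den_frame _ ha _
  have t1 : HasTables P τ1 := hI.tables.congr fun a ha => f1 a (by revert a; decide)
  have t2 : HasTables P τ2 := t1.congr fun a ha => f2 a (by revert a; decide)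
  have t3 : HasTables P τ3 := t2.congr fun a ha => f3 a (by revert a; decide)
  have t4 : HasTables P τ4 := t3.congr fun a ha => f4 a (by revert a; decide)
  have t5 : HasTables P τ5 := t4.congr fun a ha => f5 a (by revert a; decide)
  obtain ⟨w1, w2⟩ := widthCmd_spec hv hI.tables hI.level hI.err
  set Z := P.stageString flip D (σ 7) (fun p => τ 13 (σ 6 p)) (σ 9) z with hZ
  have hZ2 : ∀ p, Z r p < 2 := stageString_lt_two hz2 r
  have e7 : τ1 7 = σ 7 := by rw [f1 7 (by decide), h7]
  obtain ⟨g1, g2, g3, g4, g5, g6⟩ := groupsCmd_spec (D := D) (z := Z r) hv t1 hr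
    (by rw [f1 17 (by decide), hI.level]) w1 w2 (by rw [f1 19 (by decide), hI.offset])
    (by rw [f1 24 (by decide), hI.ptr])
    (fun p hp => by rw [f1 10 (by decide), hI.string p hp]) hZ2
    (by rw [f1 9 (by decide)]; exact hI.bits) (by rw [e7]; exact h72)
    (by rw [f1 30 (by decide)]; exact hI.votes)
  have e9 : τ1 9 = τ 9 := f1 9 (by decide)
  rw [e9] at g3 g4 g6
  rw [e7] at g4 g6
  rw [← hτ2] at g1 g2 g3 g4 g5 g6
  have h13 : τ5 13 = τ 13 := by
    rw [f5 13 (by decide), f4 13 (by decide), f3 13 (by decide), f2 13 (by decide),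
      f1 13 (by decide)]
  have h9 : τ5 9 = τ2 9 := by rw [f5 9 (by decide), f4 9 (by decide), f3 9 (by decide)]
  have h17 : τ2 17 0 = 2 ^ r := by rw [f2 17 (by decide), f1 17 (by decide), hI.level]
  have hrest : ∀ g u, τ 9 (P.bitPos D r g u) = σ 9 (P.bitPos D r g u) := fun g u =>
    hI.rest _ (by unfold DEParams.bitPos; omega)
  have hflip := flipCmd_spec flip D t2
  rw [← hτ3] at hflip
  have hvotes : ∀ p < P.n, τ2 30 p = P.votes D (σ 7) (σ 9) r (Z r) p := by
    intro p hp
    rw [g6 p hp]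
    simp only [DEParams.votes, hrest]
  refine ⟨t5, ?_, ?_, ?_, ?_, ?_, ?_, ?_, ?_, ?_⟩
  · rw [f5 17 (by decide), hτ4, Store.set_apply, f3 17 (by simp [flipCmd, forLt, writes]), h17]
    simp [pow_succ, mul_two]
  · rw [hτ5, quarterCmd_spec (m := P.totalErr / 4 ^ r) t4, Nat.div_div_eq_div_mul, pow_succ]
    · rw [f4 18 (by decide), f3 18 (by decide), f2 18 (by decide), f1 18 (by decide), hI.err]
    · exact (Nat.div_le_self _ _).trans (P.totalErr_le hv)
  · rw [f5 19 (by decide), f4 19 (by decide), f3 19 (by decide)]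
    exact g2
  · rw [f5 24 (by decide), f4 24 (by decide), f3 24 (by decide)]
    exact g1
  · intro p hp
    rw [h13, ← hZ, f5 10 (by decide), f4 10 (by decide), (hflip p hp).2, h17, hvotes p hp,
      f2 13 (by decide), f1 13 (by decide), f2 6 (by decide), f1 6 (by decide), h6,
      f2 10 (by decide), f1 10 (by decide), hI.string p hp, ← hZ]
    rfl
  · intro p hp
    rw [f5 30 (by decide), f4 30 (by decide)]
    exact (hflip p hp).1
  · intro i hi
    rw [h9, g3 i (Or.inr hi), hI.rest i ((offset_mono P D (Nat.le_succ r)).trans hi)]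
  · intro q hq g hg u hu
    rw [h13, ← hZ, h9]
    rcases Nat.lt_succ_iff_lt_or_eq.1 hq with hq' | rfl
    · rw [g3 _ (Or.inl ((bitPos_lt_offset P hg hu).trans_le (offset_mono P D hq'))),
        hI.done q hq' g hg u hu]
    · rw [g4 g hg u hu, hrest]
  · rw [h9]
    exact g5

/-- Serves both parties: Alice needs the bits in array `9`, Bob the string in array `10`. The weight
table is determined only for labels up to `tB`; Alice's labels refer to her own sets and may be
larger, which is harmless as her string never changes. -/
theorem mainCmd_spec {P : DEParams} (hv : P.totalSB ≤ P.n) {flip : Bool} {D : ℕ}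
    {σ : Store} {z : ℕ → ℕ} (h : HasParams P σ) (hz2 : ∀ p, z p < 2) (hz : ∀ p < P.n, σ 5 p = z p)
    (h72 : ∀ i, σ 7 i < 2) (h92 : ∀ i, σ 9 i < 2) (h19 : σ 19 0 = 0) (h24 : σ 24 0 = 0)
    (h30 : ∀ p, σ 30 p = 0) :
    ∃ wt : ℕ → ℕ, (∀ p, σ 6 p < P.tB + 1 → wt p = P.classWeight (σ 6 p)) ∧
      (mainCmd flip D).den σ 8 0 = P.offset D P.numStages ∧
      (∀ p < P.n, (mainCmd flip D).den σ 10 p =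
        P.stageString flip D (σ 7) wt (σ 9) z P.numStages p) ∧
      ∀ q < P.numStages, ∀ g < D * 2 ^ q, ∀ u < 2 ^ P.width q,
        (mainCmd flip D).den σ 9 (P.bitPos D q g u) =
        (σ 9 (P.bitPos D q g u) + bucketSum P.n (P.stageHash D (σ 7) q g)
          (P.stageString flip D (σ 7) wt (σ 9) z q) u) % 2 := by
  set σ1 := prelude.den σ with hσ1
  have f1 : ∀ a, a ∉ prelude.writes → σ1 a = σ a := fun a ha => den_frame _ ha _
  obtain ⟨p1, p2, p3, p4⟩ := prelude_spec hv h
  rw [← hσ1] at p1 p2 p3 p4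
  have key := forLt_spec (σ := σ1) (k := 2) (c := 40) (B := var 31) (p := stageCmd flip D)
    (fun j τ => StageInv P flip D σ z j τ) P.numStages ?_ (by
      rw [writes_stageCmd]; decide) ?_ ?_ ?_ ?_
  · set τ := (forLt 2 40 (var 31) (stageCmd flip D)).den σ1 with hτ
    have hden : (mainCmd flip D).den σ = τ.set 8 0 (P.offset D P.numStages) := by
      have h1 : (mainCmd flip D).den σ = τ.set 8 0 (τ 19 0) := rfl
      rw [h1, key.offset]
    refine ⟨fun p => τ 13 (σ 6 p), fun p hp => key.tables.weight _ hp, ?_, ?_, ?_⟩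
    · simp [hden, Store.set_apply]
    · rw [hden, Store.set_ne (by decide)]
      exact key.string
    · rw [hden, Store.set_ne (by decide)]
      exact key.done
  · rw [p1.size, DEParams.size]
    have := P.numStages_le
    omega
  · intro τ hτ
    have := hτ 31 (by rw [writes_stageCmd]; decide)
    simp [this, p1.stages]
  · intro j τ x hI
    have h40 : ∀ a, a ≠ 40 → (τ.set 40 0 x) a = τ a := fun a ha => Store.set_ne ha
    obtain ⟨i1, i2, i3, i4, i5, i6, i7, i8, i9, i10⟩ := hI
    refine ⟨i1.congr fun a ha => h40 a (by revert a; decide), ?_, ?_, ?_, ?_, ?_, ?_, ?_, ?_, ?_⟩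
    · rwa [h40 _ (by decide)]
    · rwa [h40 _ (by decide)]
    · rwa [h40 _ (by decide)]
    · rwa [h40 _ (by decide)]
    · rwa [h40 _ (by decide), h40 _ (by decide)]
    · rwa [h40 _ (by decide)]
    · rwa [h40 _ (by decide)]
    · rwa [h40 _ (by decide), h40 _ (by decide)]
    · rwa [h40 _ (by decide)]
  · refine ⟨p1, by rw [p3, pow_zero], by rw [p4]; simp, ?_, ?_, ?_, ?_, ?_, ?_, ?_⟩
    · rw [f1 19 (by decide), h19]; rfl
    · rw [f1 24 (by decide), h24]; simp
    · intro p hp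
      rw [p2 p hp, hz p hp]; rfl
    · intro p hp
      rw [f1 30 (by decide), h30]
    · intro i _
      rw [f1 9 (by decide)]
    · intro q hq; omega
    · rw [f1 9 (by decide)]; exact h92
  · intro j hj τ hτ _ hI
    refine stageCmd_spec hv hj hz2 ?_ ?_ h72 hI
    · rw [hτ 6 (by rw [writes_stageCmd]; decide), f1 6 (by decide)]
    · rw [hτ 7 (by rw [writes_stageCmd]; decide), f1 7 (by decide)]

end RAM.Cmd

/-! ### Uniform probability and independence of coordinates. -/

section Averages

open scoped BigOperators

/-- The probability of an event under the uniform distribution on a finite type. -/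
noncomputable def prob {Ω : Type*} [Fintype Ω] (E : Ω → Prop) : ℝ :=
  open scoped Classical in 𝔼 ω, if E ω then (1 : ℝ) else 0

theorem prob_eq {Ω : Type*} [Fintype Ω] (E : Ω → Prop) [DecidablePred E] :
    prob E = 𝔼 ω, if E ω then (1 : ℝ) else 0 :=
  expect_congr rfl fun ω _ => by congr

theorem prob_nonneg {Ω : Type*} [Fintype Ω] (E : Ω → Prop) : 0 ≤ prob E :=
  expect_nonneg fun _ _ => by split_ifs <;> norm_num

theorem prob_mono {Ω : Type*} [Fintype Ω] {E F : Ω → Prop} (h : ∀ ω, E ω → F ω) :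
    prob E ≤ prob F := by
  refine expect_le_expect fun ω _ => ?_
  by_cases hE : E ω
  · simp [hE, h ω hE]
  · rw [if_neg hE]; split_ifs <;> norm_num

theorem prob_or_le {Ω : Type*} [Fintype Ω] (E F : Ω → Prop) :
    prob (fun ω => E ω ∨ F ω) ≤ prob E + prob F := by
  unfold prob
  rw [← expect_add_distrib]
  refine expect_le_expect fun ω _ => ?_
  by_cases hE : E ω <;> by_cases hF : F ω <;> simp [hE, hF]

theorem prob_exists_le {Ω ι : Type*} [Fintype Ω] (s : Finset ι) (E : ι → Ω → Prop) :
    prob (fun ω => ∃ i ∈ s, E i ω) ≤ ∑ i ∈ s, prob (E i) := by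
  classical
  induction s using Finset.induction_on with
  | empty => simp [prob]
  | insert i s hi ih =>
      rw [sum_insert hi]
      refine le_trans (prob_mono (F := fun ω => E i ω ∨ ∃ j ∈ s, E j ω) ?_)
        ((prob_or_le _ _).trans (by gcongr))
      rintro ω ⟨j, hj, hE⟩
      rcases mem_insert.1 hj with rfl | hj
      · exact Or.inl hE
      · exact Or.inr ⟨j, hj, hE⟩

theorem prob_not {Ω : Type*} [Fintype Ω] [Nonempty Ω] (E : Ω → Prop) :
    prob (fun ω => ¬ E ω) = 1 - prob E := by
  have h : prob E + prob (fun ω => ¬ E ω) = 1 := by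
    unfold prob
    rw [← expect_add_distrib, ← Fintype.expect_const (ι := Ω) (1 : ℝ)]
    exact expect_congr rfl fun ω _ => by by_cases hE : E ω <;> simp [hE]
  linarith

theorem prob_le_expect {Ω : Type*} [Fintype Ω] {E : Ω → Prop} {f : Ω → ℝ} (h0 : ∀ ω, 0 ≤ f ω)
    (h1 : ∀ ω, E ω → 1 ≤ f ω) : prob E ≤ 𝔼 ω, f ω := by
  refine expect_le_expect fun ω _ => ?_
  split_ifs with hE
  · exact h1 ω hE
  · exact h0 ω

/-- Some coordinates may be resampled. -/
theorem expect_resample {ι X : Type*} [Fintype ι] [DecidableEq ι] [Fintype X] [Nonempty X]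
    (I : Finset ι) (f : (ι → X) → ℝ) :
    𝔼 ω, f ω = 𝔼 ω : ι → X, 𝔼 ω' : ι → X, f (fun i => if i ∈ I then ω' i else ω i) := by
  -- Swapping the coordinates in `I` between two independent copies is an involution, hence
  -- preserves the average.
  let e : (ι → X) × (ι → X) → (ι → X) × (ι → X) := fun p =>
    (fun i => if i ∈ I then p.2 i else p.1 i, fun i => if i ∈ I then p.1 i else p.2 i)
  have he : Function.Involutive e := by
    rintro ⟨a, b⟩
    simp only [e, Prod.mk.injEq]
    constructor <;> funext i <;> split_ifs <;> rfl
  have h1 : 𝔼 p : (ι → X) × (ι → X), f p.1 = 𝔼 p : (ι → X) × (ι → X), f (e p).1 :=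
    (Fintype.expect_equiv he.toPerm (fun p => f (e p).1) (fun p => f p.1) fun _ => rfl).symm
  have h2 : 𝔼 p : (ι → X) × (ι → X), f p.1 = 𝔼 ω, f ω := by
    rw [← univ_product_univ, expect_product]
    simp only
    exact expect_congr rfl fun ω _ => Fintype.expect_const _
  rw [← h2, h1, ← univ_product_univ, expect_product]

/-- One coordinate may be resampled. -/
theorem expect_update {ι X : Type*} [Fintype ι] [DecidableEq ι] [Fintype X] [Nonempty X]
    (i : ι) (f : (ι → X) → ℝ) :
    𝔼 ω, f ω = 𝔼 ω, 𝔼 x, f (Function.update ω i x) := by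
  let e : (ι → X) × X → (ι → X) × X := fun p => (Function.update p.1 i p.2, p.1 i)
  have he : Function.Involutive e := by
    rintro ⟨a, b⟩
    simp [e]
  have h1 : 𝔼 p : (ι → X) × X, f p.1 = 𝔼 p : (ι → X) × X, f (e p).1 :=
    (Fintype.expect_equiv he.toPerm (fun p => f (e p).1) (fun p => f p.1) fun _ => rfl).symm
  have h2 : 𝔼 p : (ι → X) × X, f p.1 = 𝔼 ω, f ω := by
    rw [← univ_product_univ, expect_product]
    simp only
    exact expect_congr rfl fun ω _ => Fintype.expect_const _
  rw [← h2, h1, ← univ_product_univ, expect_product]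

/-- Distinct coordinates are independent. -/
theorem expect_prod {ι X : Type*} [Fintype ι] [DecidableEq ι] [Fintype X] [Nonempty X]
    (I : Finset ι) (F : X → ℝ) :
    𝔼 ω : ι → X, ∏ i ∈ I, F (ω i) = (𝔼 x, F x) ^ #I := by
  have h1 : ∀ ω : ι → X, ∏ i ∈ I, F (ω i) = ∏ i, if i ∈ I then F (ω i) else 1 := fun ω => by
    rw [prod_ite_mem, univ_inter]
  have h2 : ∑ ω : ι → X, ∏ i, (if i ∈ I then F (ω i) else 1) =
      ∏ i, ∑ x, if i ∈ I then F x else 1 := by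
    rw [prod_univ_sum]; simp
  simp only [h1]
  rw [Fintype.expect_eq_sum_div_card, h2, Fintype.expect_eq_sum_div_card, Fintype.card_fun,
    Nat.cast_pow, ← Finset.card_univ (α := ι), ← prod_const, ← prod_div_distrib, div_pow]
  have hX : (Fintype.card X : ℝ) ≠ 0 := by exact_mod_cast Fintype.card_ne_zero
  rw [← prod_const (s := I), ← prod_const (s := I), ← prod_div_distrib]
  have h3 : ∀ i : ι, (∑ x, if i ∈ I then F x else 1) / (Fintype.card X : ℝ) =
      if i ∈ I then (∑ x, F x) / (Fintype.card X : ℝ) else 1 := by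
    intro i
    split_ifs
    · rfl
    · simp [hX]
  simp only [h3]
  rw [prod_ite_mem, univ_inter]

/-- A function of some of the coordinates. -/
theorem expect_comp_embedding {ι κ X : Type*} [Fintype ι] [DecidableEq ι] [Fintype κ]
    [DecidableEq κ] [Fintype X] [Nonempty X] (e : κ ↪ ι) (f : (κ → X) → ℝ) :
    𝔼 ω : ι → X, f (fun k => ω (e k)) = 𝔼 ω, f ω := by
  classical
  -- Coordinates outside the range of `e` are split off and averaged out.
  let φ : (κ ⊕ ((Set.range e)ᶜ : Set ι)) ≃ ι :=
    ((Equiv.ofInjective e e.injective).sumCongr (Equiv.refl _)).trans (Equiv.Set.sumCompl _)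
  have hφ : ∀ k, φ (Sum.inl k) = e k := fun k => by simp [φ]
  have h1 : 𝔼 ω : ι → X, f (fun k => ω (e k)) =
      𝔼 p : (κ → X) × (((Set.range e)ᶜ : Set ι) → X), f p.1 := by
    refine Fintype.expect_equiv ((φ.arrowCongr (Equiv.refl X)).symm.trans
      (Equiv.sumArrowEquivProdArrow _ _ _)) _ _ fun ω => ?_
    congr 1
  rw [h1, ← univ_product_univ, expect_product]
  simp only
  exact expect_congr rfl fun ω _ => Fintype.expect_const _

end Averages

/-! ### Exponential moment of the number of collisions under one hash function. -/

section Collisions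

open scoped BigOperators

variable {α V : Type*} [DecidableEq α]

/-- The hash value of `p` is also that of another element of `e`. -/
def Collides (hv : V → ℕ) (e : Finset α) (β : α → V) (p : α) : Prop :=
  ∃ q ∈ e, q ≠ p ∧ hv (β q) = hv (β p)

open scoped Classical in
/-- The elements of `T` whose hash values are also those of other elements of `e`. -/
noncomputable def collSet (hv : V → ℕ) (e T : Finset α) (β : α → V) : Finset α :=
  T.filter (Collides hv e β)

open scoped Classical in
-- If `p` meets the hash value of an earlier element of `e`, the new colliding points are `p` and
-- old points that collide only with `p`. There is at most one of the latter: they arise only if `p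
-- ∈ e`, then `A ⊆ e`, and two of them would already have collided with each other. If `p` meets no
-- such value, nothing is added; the condition `h` is again what excludes a collision of an old
-- point with `p`.
theorem card_collSet_insert_le (hv : V → ℕ) (e T A : Finset α) (β : α → V) {p : α} (hp : p ∉ A)
    (h : A ⊆ e ∨ p ∉ e) :
    #(collSet hv (e ∩ insert p A) (T ∩ insert p A) β) ≤ #(collSet hv (e ∩ A) (T ∩ A) β) +
      if ∃ q ∈ e ∩ A, hv (β q) = hv (β p) then 2 else 0 := by
  split_ifs with hit
  · set X := (T ∩ A).filter fun x => p ∈ e ∧ hv (β x) = hv (β p) ∧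
      ¬ Collides hv (e ∩ A) β x with hX
    have hX1 : #X ≤ 1 := by
      refine card_le_one.2 fun x hx y hy => ?_
      simp only [hX, mem_filter, mem_inter] at hx hy
      by_contra hxy
      have hA : A ⊆ e := h.resolve_right (by simp [hx.2.1])
      exact hx.2.2.2 ⟨y, mem_inter.2 ⟨hA hy.1.2, hy.1.2⟩, Ne.symm hxy,
        hy.2.2.1.trans hx.2.2.1.symm⟩
    have hsub : collSet hv (e ∩ insert p A) (T ∩ insert p A) β ⊆
        collSet hv (e ∩ A) (T ∩ A) β ∪ ({p} ∪ X) := by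
      intro x hx
      simp only [collSet, mem_filter, mem_inter, mem_insert] at hx
      obtain ⟨⟨hxT, hxA⟩, q, hq, hqx, hh⟩ := hx
      by_cases hxp : x = p
      · simp [hxp]
      have hxA' : x ∈ A := hxA.resolve_left hxp
      by_cases hc : Collides hv (e ∩ A) β x
      · exact mem_union_left _ (by simp [collSet, hxT, hxA', hc])
      · refine mem_union_right _ (mem_union_right _ ?_)
        have hqp : q = p := by
          by_contra hne
          simp only [mem_inter, mem_insert, hne, false_or] at hq
          exact hc ⟨q, mem_inter.2 hq, hqx, hh⟩
        subst hqp
        simp only [hX, mem_filter, mem_inter]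
        exact ⟨⟨hxT, hxA'⟩, (mem_inter.1 hq).1, hh.symm, hc⟩
    calc _ ≤ _ := card_le_card hsub
      _ ≤ #(collSet hv (e ∩ A) (T ∩ A) β) + (1 + 1) := by
        refine (card_union_le _ _).trans (Nat.add_le_add_left ?_ _)
        exact (card_union_le _ _).trans (by rw [card_singleton]; omega)
  · rw [add_zero]
    refine card_le_card fun x hx => ?_
    simp only [collSet, mem_filter, mem_inter, mem_insert] at hx ⊢
    obtain ⟨⟨hxT, hxA⟩, q, hq, hqx, hh⟩ := hx
    simp only [mem_inter, mem_insert] at hq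
    by_cases hxp : x = p
    · subst hxp
      exact absurd ⟨q, mem_inter.2 ⟨hq.1, hq.2.resolve_left hqx⟩, hh⟩ hit
    have hxA' := hxA.resolve_left hxp
    by_cases hqp : q = p
    · subst hqp
      have hA : A ⊆ e := h.resolve_right (by simp [hq.1])
      exact absurd ⟨x, mem_inter.2 ⟨hA hxA', hxA'⟩, hh.symm⟩ hit
    · exact ⟨⟨hxT, hxA'⟩, q, mem_inter.2 ⟨hq.1, hq.2.resolve_left hqp⟩, hqx, hh⟩

theorem collSet_update {hv : V → ℕ} {e T A : Finset α} (β : α → V) {p : α} (hp : p ∉ A) (b : V) :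
    collSet hv (e ∩ A) (T ∩ A) (Function.update β p b) = collSet hv (e ∩ A) (T ∩ A) β := by
  classical
  refine filter_congr fun x hx => ?_
  have hxp : x ≠ p := fun h => hp (h ▸ (mem_inter.1 hx).2)
  refine exists_congr fun q => and_congr_right fun hq => ?_
  have hqp : q ≠ p := fun h => hp (h ▸ (mem_inter.1 hq).2)
  rw [Function.update_of_ne hxp, Function.update_of_ne hqp]

open scoped Classical in
-- With all other hash values fixed, `p` meets the value of an element of `e` with probability at
-- most `#e * η`, and only then does the exponent grow, by at most two.
theorem expect_collSet_insert_le [Fintype α] [Fintype V] [Nonempty V] {hv : V → ℕ} {η : ℝ}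
    (hη : ∀ u, 𝔼 b, (if hv b = u then (1 : ℝ) else 0) ≤ η) {θ : ℝ} (hθ : 1 ≤ θ)
    (e T A : Finset α) {p : α} (hp : p ∉ A) (h : A ⊆ e ∨ p ∉ e) :
    𝔼 β : α → V, θ ^ #(collSet hv (e ∩ insert p A) (T ∩ insert p A) β) ≤
      (𝔼 β : α → V, θ ^ #(collSet hv (e ∩ A) (T ∩ A) β)) * (1 + θ ^ 2 * (#e * η)) := by
  have hη0 : 0 ≤ η := le_trans (expect_nonneg fun _ _ => by split_ifs <;> norm_num) (hη 0)
  rw [expect_update p, expect_mul]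
  refine expect_le_expect fun β _ => ?_
  set F := θ ^ #(collSet hv (e ∩ A) (T ∩ A) β) with hF
  have hF0 : 0 ≤ F := by positivity
  calc 𝔼 b, θ ^ #(collSet hv (e ∩ insert p A) (T ∩ insert p A) (Function.update β p b))
      ≤ 𝔼 b, F * (1 + θ ^ 2 * ∑ q ∈ e, if hv b = hv (β q) then (1 : ℝ) else 0) := by
        refine expect_le_expect fun b _ => ?_
        have hc := card_collSet_insert_le hv e T A (Function.update β p b) hp h
        rw [collSet_update β hp] at hc
        refine (pow_le_pow_right₀ hθ hc).trans ?_
        rw [pow_add, ← hF]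
        refine mul_le_mul_of_nonneg_left ?_ hF0
        have hsum : (0 : ℝ) ≤ ∑ q ∈ e, if hv b = hv (β q) then (1 : ℝ) else 0 :=
          sum_nonneg fun _ _ => by split_ifs <;> norm_num
        split_ifs with hit
        · obtain ⟨q, hq, hqp⟩ := hit
          have hqA := (mem_inter.1 hq).2
          have hne : q ≠ p := fun h => hp (h ▸ hqA)
          rw [Function.update_of_ne hne, Function.update_self] at hqp
          have h1 : (1 : ℝ) ≤ ∑ q ∈ e, if hv b = hv (β q) then (1 : ℝ) else 0 := by
            refine le_trans ?_ (single_le_sum (f := fun q =>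
              if hv b = hv (β q) then (1 : ℝ) else 0)
              (fun _ _ => by split_ifs <;> norm_num) (mem_inter.1 hq).1)
            simp [hqp]
          have h2 : (0 : ℝ) ≤ θ ^ 2 := by positivity
          nlinarith
        · have h2 : (0 : ℝ) ≤ θ ^ 2 := by positivity
          have := mul_nonneg h2 hsum
          simpa using this
    _ = F * (1 + θ ^ 2 * ∑ q ∈ e, 𝔼 b, if hv b = hv (β q) then (1 : ℝ) else 0) := by
        rw [← mul_expect, expect_add_distrib, Fintype.expect_const, ← mul_expect,
          expect_sum_comm]
    _ ≤ F * (1 + θ ^ 2 * (#e * η)) := by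
        refine mul_le_mul_of_nonneg_left ?_ hF0
        gcongr
        refine (sum_le_sum fun q _ => hη (hv (β q))).trans ?_
        simp

/-- Reveal first `e \ T`, which contributes nothing, then `T ∩ e`, and finally `T \ e`. This order
meets the side condition of the insertion step throughout, and only the elements of `T` cost a
factor. -/
theorem expect_collSet_le [Fintype α] [Fintype V] [Nonempty V] {hv : V → ℕ} {η : ℝ}
    (hη : ∀ u, 𝔼 b, (if hv b = u then (1 : ℝ) else 0) ≤ η) {θ : ℝ} (hθ : 1 ≤ θ)
    (e T : Finset α) :
    𝔼 β : α → V, θ ^ #(collSet hv e T β) ≤ (1 + θ ^ 2 * (#e * η)) ^ #T := by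
  classical
  have hη0 : 0 ≤ η := le_trans (expect_nonneg fun _ _ => by split_ifs <;> norm_num) (hη 0)
  have hx0 : (0 : ℝ) ≤ 1 + θ ^ 2 * (#e * η) := by positivity
  have h1 : ∀ B ⊆ T ∩ e, 𝔼 β : α → V, θ ^ #(collSet hv (e ∩ (B ∪ (e \ T)))
      (T ∩ (B ∪ (e \ T))) β) ≤ (1 + θ ^ 2 * (#e * η)) ^ #B := by
    intro B
    induction B using Finset.induction_on with
    | empty =>
        intro _
        have : T ∩ (∅ ∪ e \ T) = ∅ := by
          ext x; simp
        simp [collSet]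
    | insert p B hpB ih =>
        intro hsub
        rw [insert_subset_iff] at hsub
        have hpT := mem_inter.1 hsub.1
        rw [insert_union, card_insert_of_notMem hpB, pow_succ]
        refine (expect_collSet_insert_le hη hθ e T (B ∪ (e \ T)) ?_ (Or.inl ?_)).trans
          (mul_le_mul_of_nonneg_right (ih hsub.2) hx0)
        · simp [hpB, hpT.1]
        · intro x hx
          rcases mem_union.1 hx with hx | hx
          · exact (mem_inter.1 (hsub.2 hx)).2
          · exact (mem_sdiff.1 hx).1
  have h2 : ∀ B ⊆ T \ e, 𝔼 β : α → V, θ ^ #(collSet hv (e ∩ (B ∪ e))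
      (T ∩ (B ∪ e)) β) ≤ (1 + θ ^ 2 * (#e * η)) ^ (#B + #(T ∩ e)) := by
    intro B
    induction B using Finset.induction_on with
    | empty =>
        intro _
        have : (T ∩ e) ∪ (e \ T) = ∅ ∪ e := by
          ext x; simp; tauto
        have h := h1 (T ∩ e) subset_rfl
        rw [this] at h
        simpa using h
    | insert p B hpB ih =>
        intro hsub
        rw [insert_subset_iff] at hsub
        have hpT := mem_sdiff.1 hsub.1
        rw [insert_union, card_insert_of_notMem hpB, add_right_comm, pow_succ]
        refine (expect_collSet_insert_le hη hθ e T (B ∪ e) ?_ (Or.inr hpT.2)).trans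
          (mul_le_mul_of_nonneg_right (ih hsub.2) hx0)
        simp [hpB, hpT.2]
  have h3 := h2 (T \ e) subset_rfl
  have h4 : e ∩ (T \ e ∪ e) = e := by ext x; simp
  have h5 : T ∩ (T \ e ∪ e) = T := by ext x; simp; tauto
  rw [h4, h5, card_sdiff_add_card_inter] at h3
  exact h3

end Collisions

/-! ### Positions that collide under half of the hash functions of a stage. -/

section Majority

open scoped BigOperators

variable {Γ α V : Type*} [DecidableEq α]

open scoped Classical in
/-- The elements of `T` that collide with other elements of `e` for at least half of the hash
functions with indices in `I`. -/
noncomputable def badSet (hv : V → ℕ) (e : Finset α) (I : Finset Γ) (T : Finset α)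
    (ω : Γ → α → V) : Finset α :=
  T.filter fun p => #I ≤ 2 * #(I.filter fun g => Collides hv e (ω g) p)

variable [Fintype Γ] [DecidableEq Γ] [Fintype α] [Fintype V] [Nonempty V]

open scoped Classical in
-- If all of `T` is bad, the collisions summed over `I` number at least `#I * #T / 2`, so the
-- product of the `1024 ^ #collSet / 32 ^ #T` is at least `1`. The factors are independent, each of
-- mean at most `((1 + 1024 ^ 2 / 2 ^ 20) / 32) ^ #T = (1 / 16) ^ #T`; this is where the constant `2
-- ^ 20` comes from.
theorem prob_badSet_eq_le {hv : V → ℕ} {η : ℝ}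
    (hη : ∀ u, 𝔼 b, (if hv b = u then (1 : ℝ) else 0) ≤ η) (e : Finset α) (I : Finset Γ)
    (T : Finset α) (he : #e * η ≤ 1 / 2 ^ 20) :
    prob (fun ω : Γ → α → V => badSet hv e I T ω = T) ≤ ((1 / 16 : ℝ) ^ #I) ^ #T := by
  have h1 : prob (fun ω : Γ → α → V => badSet hv e I T ω = T) ≤
      𝔼 ω : Γ → α → V, ∏ g ∈ I, (1024 : ℝ) ^ #(collSet hv e T (ω g)) / 32 ^ #T := by
    refine prob_le_expect (fun ω => by positivity) fun ω hω => ?_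
    rw [prod_div_distrib, prod_const, prod_pow_eq_pow_sum, ← pow_mul,
      show (1024 : ℝ) = 32 ^ 2 by norm_num, ← pow_mul, one_le_div (by positivity)]
    refine pow_le_pow_right₀ (by norm_num) ?_
    have hsum : ∑ g ∈ I, #(collSet hv e T (ω g)) =
        ∑ p ∈ T, #(I.filter fun g => Collides hv e (ω g) p) := by
      simp only [collSet, card_filter]
      exact sum_comm
    rw [hsum, mul_sum, ← smul_eq_mul, ← sum_const]
    refine sum_le_sum fun p hp => ?_
    rw [← hω] at hp
    exact (mem_filter.1 hp).2
  refine h1.trans ?_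
  rw [expect_prod I (fun β : α → V => (1024 : ℝ) ^ #(collSet hv e T β) / 32 ^ #T), ← pow_mul,
    mul_comm, pow_mul]
  refine pow_le_pow_left₀ (expect_nonneg fun _ _ => by positivity) ?_ _
  rw [← expect_div, div_le_iff₀ (by positivity), ← mul_pow]
  refine (expect_collSet_le hη (by norm_num) e T).trans ?_
  have hη0 : 0 ≤ η := le_trans (expect_nonneg fun _ _ => by split_ifs <;> norm_num) (hη 0)
  refine pow_le_pow_left₀ (by positivity) ?_ _
  norm_num at he ⊢
  linarith

/-- Expand `(l + 1) ^ #B` over the subsets of the bad set `B` and bound the probability that each is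
entirely bad. The result is the moment of a binomial variable, although the positions are not
independent. -/
theorem expect_pow_card_badSet_le {hv : V → ℕ} {η : ℝ}
    (hη : ∀ u, 𝔼 b, (if hv b = u then (1 : ℝ) else 0) ≤ η) (e : Finset α) (I : Finset Γ)
    (T : Finset α) (he : #e * η ≤ 1 / 2 ^ 20) {l : ℝ} (hl : 0 ≤ l) :
    𝔼 ω : Γ → α → V, (l + 1) ^ #(badSet hv e I T ω) ≤ (l * (1 / 16) ^ #I + 1) ^ #T := by
  classical
  have h1 : ∀ ω : Γ → α → V, (l + 1) ^ #(badSet hv e I T ω) =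
      ∑ S ∈ T.powerset, l ^ #S * if badSet hv e I S ω = S then 1 else 0 := by
    intro ω
    have h2 : (l + 1) ^ #(badSet hv e I T ω) = ∑ S ∈ (badSet hv e I T ω).powerset, l ^ #S := by
      rw [← sum_pow_mul_eq_add_pow]
      simp
    have h3 : (badSet hv e I T ω).powerset =
        T.powerset.filter fun S => badSet hv e I S ω = S := by
      ext S
      simp only [mem_powerset, mem_filter, badSet, filter_eq_self]
      constructor
      · intro h
        exact ⟨h.trans (filter_subset _ _), fun p hp => (mem_filter.1 (h hp)).2⟩
      · intro h p hp
        exact mem_filter.2 ⟨h.1 hp, h.2 p hp⟩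
    rw [h2, h3, sum_filter]
    exact sum_congr rfl fun S _ => by split_ifs <;> simp
  simp only [h1]
  rw [expect_sum_comm, ← sum_pow_mul_eq_add_pow]
  refine sum_le_sum fun S _ => ?_
  rw [← mul_expect, one_pow, mul_one, mul_pow]
  refine mul_le_mul_of_nonneg_left ?_ (by positivity)
  have := prob_badSet_eq_le hη e I S he
  rw [prob_eq] at this
  exact this

/-- Markov's inequality with `l = 2 ^ #I`: the moment is at most `exp (#T / 8 ^ #I) ≤ e ^ t ≤ 4 ^
t`. -/
theorem prob_le_card_badSet_le {hv : V → ℕ} {η : ℝ}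
    (hη : ∀ u, 𝔼 b, (if hv b = u then (1 : ℝ) else 0) ≤ η) (e : Finset α) (I : Finset Γ)
    (T : Finset α) (he : #e * η ≤ 1 / 2 ^ 20) {t : ℕ} (hT : #T ≤ 8 ^ #I * t) :
    prob (fun ω : Γ → α → V => t ≤ #(badSet hv e I T ω)) ≤ (4 / 2 ^ #I) ^ t := by
  set l : ℝ := 2 ^ #I with hl
  have hl0 : 0 < l := by positivity
  have h1 : prob (fun ω : Γ → α → V => t ≤ #(badSet hv e I T ω)) ≤
      𝔼 ω : Γ → α → V, (l + 1) ^ #(badSet hv e I T ω) / l ^ t := by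
    refine prob_le_expect (fun ω => by positivity) fun ω hω => ?_
    rw [one_le_div (by positivity)]
    calc l ^ t ≤ (l + 1) ^ t := pow_le_pow_left₀ hl0.le (by linarith) _
      _ ≤ _ := pow_le_pow_right₀ (by linarith) hω
  refine h1.trans ?_
  rw [← expect_div, div_pow]
  refine div_le_div_of_nonneg_right ?_ (by positivity)
  refine (expect_pow_card_badSet_le hη e I T he hl0.le).trans ?_
  have h2 : l * (1 / 16) ^ #I = (1 / 8) ^ #I := by rw [hl, ← mul_pow]; norm_num
  rw [h2]
  calc ((1 / 8 : ℝ) ^ #I + 1) ^ #T ≤ (Real.exp ((1 / 8 : ℝ) ^ #I)) ^ #T :=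
        pow_le_pow_left₀ (by positivity) (Real.add_one_le_exp _) _
    _ = Real.exp (#T * (1 / 8 : ℝ) ^ #I) := by rw [← Real.exp_nat_mul]
    _ ≤ Real.exp (t * 1) := by
        refine Real.exp_le_exp.2 ?_
        have h3 : (#T : ℝ) ≤ 8 ^ #I * t := by exact_mod_cast hT
        calc (#T : ℝ) * (1 / 8 : ℝ) ^ #I ≤ (8 ^ #I * t) * (1 / 8 : ℝ) ^ #I := by gcongr
          _ = t * (8 * (1 / 8)) ^ #I := by rw [mul_pow]; ring
          _ = t * 1 := by norm_num
    _ = (Real.exp 1) ^ t := by rw [Real.exp_nat_mul]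
    _ ≤ 4 ^ t := pow_le_pow_left₀ (Real.exp_pos _).le (by
        have := Real.exp_one_lt_d9
        linarith) _

/-- The bound for one stage, for a set `e` that is determined by the other hash functions. -/
theorem prob_stage_le {hv : V → ℕ} {η : ℝ}
    (hη : ∀ u, 𝔼 b, (if hv b = u then (1 : ℝ) else 0) ≤ η) (I : Finset Γ)
    (e : (Γ → α → V) → Finset α) (he : ∀ ω ω', (∀ g ∉ I, ω g = ω' g) → e ω = e ω')
    (T : Finset α) {t : ℕ} (hT : #T ≤ 8 ^ #I * t) :
    prob (fun ω : Γ → α → V => #(e ω) * η ≤ 1 / 2 ^ 20 ∧ t ≤ #(badSet hv (e ω) I T ω)) ≤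
      (4 / 2 ^ #I) ^ t := by
  classical
  unfold prob
  -- Resampling the functions in `I` does not change `e`, so for fixed outer `ω` the error set is a
  -- constant.
  rw [expect_resample I]
  refine expect_le univ_nonempty fun ω _ => ?_
  have h1 : ∀ ω' : Γ → α → V, e (fun i => if i ∈ I then ω' i else ω i) = e ω := fun ω' =>
    he _ _ fun g hg => by simp [hg]
  have h2 : ∀ ω' : Γ → α → V, badSet hv (e ω) I T (fun i => if i ∈ I then ω' i else ω i) =
      badSet hv (e ω) I T ω' := by
    intro ω'
    unfold badSet
    refine filter_congr fun p _ => ?_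
    have : (I.filter fun g => Collides hv (e ω) (if g ∈ I then ω' g else ω g) p) =
        I.filter fun g => Collides hv (e ω) (ω' g) p :=
      filter_congr fun g hg => by rw [if_pos hg]
    rw [this]
  simp only [h1, h2]
  by_cases hle : #(e ω) * η ≤ 1 / 2 ^ 20
  · have := prob_le_card_badSet_le hη (e ω) I T hle hT
    rw [prob_eq] at this
    simpa only [hle, true_and] using this
  · simp only [hle, false_and, if_false, expect_const_zero]
    positivity

end Majority

/-! ### Evolution of the set of errors through the stages. -/

section ErrorSets

open scoped BigOperators

variable {α V : Type*} [Fintype α] [DecidableEq α]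

/-- The set of errors before stage `r`, if `e` is the initial set of errors and `h r g` is the
hash function number `g` of stage `r`. -/
def errSeq (D : ℕ) (h : ℕ → ℕ → α → ℕ) (wt : α → ℕ) (e : Finset α) : ℕ → Finset α
  | 0 => e
  | r + 1 => univ.filter fun p => (p ∈ errSeq D h wt e r ↔ ¬ (wt p ≤ 2 ^ r ∧ D * 2 ^ r <
      2 * ∑ g ∈ range (D * 2 ^ r), #((errSeq D h wt e r).filter fun q => h r g q = h r g p) % 2))

theorem errSeq_congr {D : ℕ} {h h' : ℕ → ℕ → α → ℕ} {wt : α → ℕ} {e : Finset α} (r : ℕ)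
    (hh : ∀ q < r, ∀ g < D * 2 ^ q, h q g = h' q g) :
    errSeq D h wt e r = errSeq D h' wt e r := by
  induction r with
  | zero => rfl
  | succ r ih =>
      rw [errSeq, errSeq, ih fun q hq => hh q (hq.trans r.lt_succ_self)]
      refine filter_congr fun p _ => ?_
      rw [sum_congr rfl fun g hg => by rw [hh r r.lt_succ_self g (mem_range.1 hg)]]

/-- Positions too heavy for the stages so far have never been flipped. -/
theorem mem_of_mem_errSeq {D : ℕ} {h : ℕ → ℕ → α → ℕ} {wt : α → ℕ} {e : Finset α} {r : ℕ} {p : α}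
    (hp : p ∈ errSeq D h wt e r) (hw : ∀ q < r, 2 ^ q < wt p) : p ∈ e := by
  induction r with
  | zero => exact hp
  | succ r ih =>
      have h1 := hw r r.lt_succ_self
      simp only [errSeq, mem_filter, mem_univ, true_and] at hp
      exact ih (hp.2 fun h => absurd h.1 (by omega)) fun q hq => hw q (hq.trans r.lt_succ_self)

open scoped Classical in
theorem mem_errSeq_succ {D : ℕ} {h : ℕ → ℕ → α → ℕ} {wt : α → ℕ} {e : Finset α} {r : ℕ} {p : α}
    (hp : p ∈ errSeq D h wt e (r + 1)) :
    (p ∈ e ∧ 2 ^ r < wt p) ∨ (wt p ≤ 2 ^ r ∧ D * 2 ^ r ≤ 2 * #((range (D * 2 ^ r)).filter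
      fun g => ∃ q ∈ errSeq D h wt e r, q ≠ p ∧ h r g q = h r g p)) := by
  by_cases hw : 2 ^ r < wt p
  · refine Or.inl ⟨mem_of_mem_errSeq hp fun q hq => lt_of_le_of_lt ?_ hw, hw⟩
    exact Nat.pow_le_pow_right (by norm_num) (by omega)
  refine Or.inr ⟨by omega, ?_⟩
  by_contra hlt
  push Not at hlt
  set E := errSeq D h wt e r with hE
  set bad : ℕ → Prop := fun g => ∃ q ∈ E, q ≠ p ∧ h r g q = h r g p with hbad
  set vote : ℕ → ℕ := fun g => #(E.filter fun q => h r g q = h r g p) % 2 with hvote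
  -- Without a collision the bucket of `p` contains no error except possibly `p`, so the vote is
  -- correct.
  have hgood : ∀ g, ¬ bad g → vote g = if p ∈ E then 1 else 0 := by
    intro g hg
    have h1 : (E.filter fun q => h r g q = h r g p) = if p ∈ E then {p} else ∅ := by
      ext q
      simp only [mem_filter]
      constructor
      · rintro ⟨hq, hqp⟩
        have : q = p := by
          by_contra hne
          exact hg ⟨q, hq, hne, hqp⟩
        subst this
        simp [hq]
      · split_ifs with hpE
        · intro hq
          rw [mem_singleton] at hq
          subst hq
          exact ⟨hpE, rfl⟩
        · simp
    simp only [hvote, h1]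
    split_ifs <;> simp
  have hvote2 : ∀ g, vote g < 2 := fun g => Nat.mod_lt _ (by norm_num)
  have hsplit : #((range (D * 2 ^ r)).filter bad) + #((range (D * 2 ^ r)).filter (¬ bad ·)) =
      D * 2 ^ r := by
    rw [card_filter_add_card_filter_not, card_range]
  have hlt' : 2 * #((range (D * 2 ^ r)).filter bad) < D * 2 ^ r := hlt
  have hmem := hp
  simp only [errSeq, mem_filter, mem_univ, true_and, ← hE] at hmem
  by_cases hpE : p ∈ E
  · refine hmem.1 hpE ⟨by omega, ?_⟩
    have h2 : #((range (D * 2 ^ r)).filter (¬ bad ·)) ≤ ∑ g ∈ range (D * 2 ^ r), vote g := by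
      rw [card_filter]
      refine sum_le_sum fun g _ => ?_
      split_ifs with hb
      · exact Nat.zero_le _
      · rw [hgood g hb, if_pos hpE]
    change D * 2 ^ r < 2 * ∑ g ∈ range (D * 2 ^ r), vote g
    omega
  · refine hpE (hmem.2 fun hcon => ?_)
    have h2 : ∑ g ∈ range (D * 2 ^ r), vote g ≤ #((range (D * 2 ^ r)).filter bad) := by
      rw [card_filter]
      refine sum_le_sum fun g _ => ?_
      split_ifs with hb
      · have := hvote2 g; omega
      · rw [hgood g hb, if_neg hpE]
    have h3 : D * 2 ^ r < 2 * ∑ g ∈ range (D * 2 ^ r), vote g := hcon.2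
    omega

/-- The hash functions of the stages, from a sequence of hash functions. -/
def stageFamily (D R : ℕ) (hv : ℕ → V → ℕ) (ω : Fin (D * (2 ^ R - 1)) → α → V) (r g : ℕ) (p : α) :
    ℕ :=
  if h : D * (2 ^ r - 1) + g < D * (2 ^ R - 1) then hv r (ω ⟨D * (2 ^ r - 1) + g, h⟩ p) else 0

/-- The indices of the hash functions of stage `r`. -/
def stageIdx (D R r : ℕ) : Finset (Fin (D * (2 ^ R - 1))) :=
  univ.filter fun γ => D * (2 ^ r - 1) ≤ γ ∧ (γ : ℕ) < D * (2 ^ (r + 1) - 1)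

/-- The stages before `r` use `D * (1 + 2 + … + 2 ^ (r - 1)) = D * (2 ^ r - 1)` hash functions,
which is the first index of stage `r`. -/
theorem mul_two_pow_succ_sub_one (D r : ℕ) :
    D * (2 ^ (r + 1) - 1) = D * (2 ^ r - 1) + D * 2 ^ r := by
  have : 2 ^ (r + 1) - 1 = (2 ^ r - 1) + 2 ^ r := by
    have : 0 < 2 ^ r := by positivity
    rw [pow_succ]; omega
  rw [this, mul_add]

theorem mul_two_pow_sub_one_mono {D r R : ℕ} (h : r ≤ R) :
    D * (2 ^ r - 1) ≤ D * (2 ^ R - 1) :=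
  Nat.mul_le_mul_left _ (Nat.sub_le_sub_right (Nat.pow_le_pow_right (by norm_num) h) 1)

theorem card_stageIdx_filter {D R r : ℕ} (hr : r < R) (P : Fin (D * (2 ^ R - 1)) → Prop)
    (Q : ℕ → Prop) [DecidablePred P] [DecidablePred Q]
    (hPQ : ∀ g (h : D * (2 ^ r - 1) + g < D * (2 ^ R - 1)), P ⟨D * (2 ^ r - 1) + g, h⟩ ↔ Q g) :
    #((stageIdx D R r).filter P) = #((range (D * 2 ^ r)).filter Q) := by
  have h1 := mul_two_pow_succ_sub_one D r
  have h2 : D * (2 ^ (r + 1) - 1) ≤ D * (2 ^ R - 1) := mul_two_pow_sub_one_mono hr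
  have h3 : ∀ g, g < D * 2 ^ r → D * (2 ^ r - 1) + g < D * (2 ^ R - 1) := fun g hg => by omega
  symm
  refine card_bij (fun g hg => ⟨D * (2 ^ r - 1) + g,
    h3 g (mem_range.1 (mem_filter.1 hg).1)⟩) ?_ ?_ ?_
  · intro g hg
    obtain ⟨hg1, hg2⟩ := mem_filter.1 hg
    rw [mem_range] at hg1
    refine mem_filter.2 ⟨mem_filter.2 ⟨mem_univ _, ?_, ?_⟩, (hPQ g _).2 hg2⟩
    · simp
    · simp only; omega
  · intro g _ g' _ hgg
    simp only [Fin.mk.injEq] at hgg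
    omega
  · intro γ hγ
    obtain ⟨hγ1, hγ2⟩ := mem_filter.1 hγ
    obtain ⟨-, hγ3, hγ4⟩ := mem_filter.1 hγ1
    have he : D * (2 ^ r - 1) + (γ - D * (2 ^ r - 1)) = γ := by omega
    have hlt : D * (2 ^ r - 1) + (γ - D * (2 ^ r - 1)) < D * (2 ^ R - 1) := by
      rw [he]; exact γ.2
    have hγe : (⟨D * (2 ^ r - 1) + (γ - D * (2 ^ r - 1)), hlt⟩ : Fin (D * (2 ^ R - 1))) = γ :=
      Fin.ext he
    refine ⟨γ - D * (2 ^ r - 1), mem_filter.2 ⟨mem_range.2 (by omega), ?_⟩, hγe⟩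
    rw [← hPQ _ hlt, hγe]
    exact hγ2

theorem card_stageIdx {D R r : ℕ} (hr : r < R) : #(stageIdx D R r) = D * 2 ^ r := by
  have := card_stageIdx_filter (D := D) hr (fun _ => True) (fun _ => True) (fun _ _ => Iff.rfl)
  simpa using this

open scoped Classical in
/-- The probability that errors are left after the last stage. -/
theorem prob_errSeq_ne_empty_le [Fintype V] [Nonempty V] {D R : ℕ} (hR : 0 < R)
    {hv : ℕ → V → ℕ} {η : ℕ → ℝ}
    (hη : ∀ r < R, ∀ u, 𝔼 b, (if hv r b = u then (1 : ℝ) else 0) ≤ η r)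
    {wt : α → ℕ} {e : Finset α} {b t : ℕ → ℕ}
    (hb : ∀ r < R, b r * η r ≤ 1 / 2 ^ 20) (h0 : #e ≤ b 0)
    (hstep : ∀ r, r + 1 < R → #(e.filter fun p => 2 ^ r < wt p) + t r ≤ b (r + 1))
    (hT : ∀ r < R, #(univ.filter fun p => wt p ≤ 2 ^ r) ≤ 8 ^ (D * 2 ^ r) * t r)
    (hlast : ∀ p, wt p ≤ 2 ^ (R - 1)) (htlast : t (R - 1) = 1) :
    prob (fun ω : Fin (D * (2 ^ R - 1)) → α → V =>
      errSeq D (stageFamily D R hv ω) wt e R ≠ ∅) ≤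
      ∑ r ∈ range R, (4 / 2 ^ (D * 2 ^ r)) ^ t r := by
  have hη0 : ∀ r < R, 0 ≤ η r := fun r hr =>
    le_trans (expect_nonneg fun _ _ => by split_ifs <;> norm_num) (hη r hr 0)
  set E : ℕ → (Fin (D * (2 ^ R - 1)) → α → V) → Finset α :=
    fun r ω => errSeq D (stageFamily D R hv ω) wt e r with hE
  set act : ℕ → Finset α := fun r => univ.filter fun p => wt p ≤ 2 ^ r with hact
  set fail : ℕ → (Fin (D * (2 ^ R - 1)) → α → V) → Prop := fun r ω =>
    #(E r ω) * η r ≤ 1 / 2 ^ 20 ∧ t r ≤ #(badSet (hv r) (E r ω) (stageIdx D R r) (act r) ω)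
    with hfail
  have hsub : ∀ r < R, ∀ ω, E (r + 1) ω ⊆ (e.filter fun p => 2 ^ r < wt p) ∪
      badSet (hv r) (E r ω) (stageIdx D R r) (act r) ω := by
    intro r hr ω p hp
    rcases mem_errSeq_succ hp with h | h
    · exact mem_union_left _ (mem_filter.2 h)
    · refine mem_union_right _ (mem_filter.2 ⟨mem_filter.2 ⟨mem_univ _, h.1⟩, ?_⟩)
      rw [card_stageIdx hr, card_stageIdx_filter hr _
        (fun g => ∃ q ∈ E r ω, q ≠ p ∧ stageFamily D R hv ω r g q = stageFamily D R hv ω r g p)]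
      · exact h.2
      · intro g hg
        simp only [Collides, stageFamily, hg, dif_pos]
  -- If no stage fails, the bound `b r` for the errors propagates from stage to stage, and the last
  -- stage leaves none.
  refine le_trans (prob_mono (F := fun ω => ∃ r ∈ range R, fail r ω) ?_)
    ((prob_exists_le _ _).trans (sum_le_sum fun r hr => ?_))
  · intro ω hne
    by_contra hno
    push Not at hno
    have hno' : ∀ r < R, #(E r ω) ≤ b r →
        #(badSet (hv r) (E r ω) (stageIdx D R r) (act r) ω) < t r := by
      intro r hr hle
      by_contra hge
      refine hno r (mem_range.2 hr) ⟨le_trans ?_ (hb r hr), by omega⟩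
      have := hη0 r hr
      gcongr
    have hEb : ∀ r < R, #(E r ω) ≤ b r := by
      intro r
      induction r with
      | zero => exact fun _ => h0
      | succ r ih =>
          intro hr
          have h1 := hno' r (by omega) (ih (by omega))
          have h2 := (card_le_card (hsub r (by omega) ω)).trans (card_union_le _ _)
          have h3 := hstep r hr
          omega
    apply hne
    have h1 := hno' (R - 1) (by omega) (hEb _ (by omega))
    rw [htlast, Nat.lt_one_iff, card_eq_zero] at h1
    have h2 := hsub (R - 1) (by omega) ω
    rw [h1, union_empty, Nat.sub_add_cancel hR] at h2
    refine subset_empty.1 (h2.trans ?_)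
    intro p hp
    have := hlast p
    exact absurd (mem_filter.1 hp).2 (by omega)
  · have hr' := mem_range.1 hr
    have := prob_stage_le (hη r hr') (stageIdx D R r) (E r) ?_ (act r) (t := t r)
      (by rw [card_stageIdx hr']; exact hT r hr')
    · rwa [card_stageIdx hr'] at this
    -- The errors before stage `r` depend only on the functions of earlier stages, whose indices lie
    -- outside `stageIdx D R r`.
    · intro ω ω' hωω
      refine errSeq_congr r fun q hq g hg => ?_
      funext p
      unfold stageFamily
      split_ifs with h
      · rw [hωω]
        intro hmem
        have h1 := (mem_filter.1 hmem).2.1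
        have h2 : D * (2 ^ (q + 1) - 1) ≤ D * (2 ^ r - 1) := mul_two_pow_sub_one_mono hq
        rw [mul_two_pow_succ_sub_one] at h2
        simp only at h1
        omega
      · rfl

end ErrorSets

/-! ### Bob's string against Alice's string. -/

section Decoding

open RAM

theorem arrayOf_toNat_lt_two {m : ℕ} (x : Fin m → Bool) (i : ℕ) :
    arrayOf (fun j => (x j).toNat) i < 2 := by
  unfold arrayOf
  split_ifs
  · exact Bool.toNat_lt _
  · norm_num

/-- The parity of the differences of two strings in a bucket. -/
theorem bucketSum_mod_two_add {n : ℕ} (h x z : ℕ → ℕ) (hx : ∀ p, x p < 2) (hz : ∀ p, z p < 2)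
    (u : ℕ) : (bucketSum n h x u % 2 + bucketSum n h z u) % 2 =
      #((univ : Finset (Fin n)).filter fun p : Fin n => x p ≠ z p ∧ h p = u) % 2 := by
  -- For bits, `x + z` is the indicator of `x ≠ z` plus `2 * min x z`.
  have h1 : bucketSum n h x u + bucketSum n h z u =
      #((univ : Finset (Fin n)).filter fun p : Fin n => x p ≠ z p ∧ h p = u) +
        2 * ∑ p ∈ range n, if h p = u then min (x p) (z p) else 0 := by
    rw [bucketSum, bucketSum, ← sum_add_distrib, card_filter, mul_sum,
      Fin.sum_univ_eq_sum_range (fun p => if x p ≠ z p ∧ h p = u then 1 else 0) n,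
      ← sum_add_distrib]
    refine sum_congr rfl fun p _ => ?_
    have := hx p
    have := hz p
    by_cases hp : h p = u
    · by_cases hxz : x p = z p
      · simp [hp, hxz]; omega
      · simp [hp, hxz]; omega
    · simp [hp]
  omega

variable (P : DEParams)

/-- The differences between Alice's string and Bob's current string follow `errSeq`, if Bob has
received Alice's parities. -/
theorem stageString_ne_iff {D R : ℕ} {ρ wt msg x y : ℕ → ℕ} (hρ : ∀ i, ρ i < 2)
    (hx : ∀ p, x p < 2) (hy : ∀ p, y p < 2)
    (hmsg : ∀ q < R, ∀ g < D * 2 ^ q, ∀ u < 2 ^ P.width q,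
      msg (P.bitPos D q g u) = bucketSum P.n (P.stageHash D ρ q g) x u % 2)
    {r : ℕ} (hr : r ≤ R) (p : Fin P.n) :
    x p ≠ P.stageString true D ρ wt msg y r p ↔
      p ∈ errSeq D (fun q g (i : Fin P.n) => P.stageHash D ρ q g i) (fun i => wt i)
        (univ.filter fun i : Fin P.n => x i ≠ y i) r := by
  induction r generalizing p with
  | zero => simp [errSeq, DEParams.stageString]
  | succ r ih =>
      have ih' := ih (by omega)
      set z := P.stageString true D ρ wt msg y r with hz
      set E := errSeq D (fun q g (i : Fin P.n) => P.stageHash D ρ q g i) (fun i => wt i)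
        (univ.filter fun i : Fin P.n => x i ≠ y i) r with hE
      have hz2 : ∀ p, z p < 2 := RAM.Cmd.stageString_lt_two hy r
      have hvotes : P.votes D ρ msg r z p = ∑ g ∈ range (D * 2 ^ r),
          #(E.filter fun q : Fin P.n => P.stageHash D ρ r g q = P.stageHash D ρ r g p) % 2 := by
        refine sum_congr rfl fun g hg => ?_
        have hlt : P.stageHash D ρ r g p < 2 ^ P.width r := hashVal_lt (fun i => hρ _) _
        rw [hmsg r (by omega) g (mem_range.1 hg) (P.stageHash D ρ r g p) hlt,
          bucketSum_mod_two_add _ _ _ hx hz2]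
        congr 2
        ext q
        simp only [mem_filter, mem_univ, true_and, ih']
      have hstr : P.stageString true D ρ wt msg y (r + 1) p = if wt p ≤ 2 ^ r ∧
          D * 2 ^ r < 2 * P.votes D ρ msg r z p then 1 - z p else z p := by
        simp [DEParams.stageString, hz]
      rw [hstr, hvotes]
      simp only [errSeq, mem_filter, mem_univ, true_and, ← hE, ← ih']
      have h1 := hx p
      have h2 := hz2 p
      split_ifs with hc
      · rw [iff_not_comm, iff_true_left hc]; omega
      · rw [iff_true_right hc]

end Decoding

/-! ### Hash values from the shared random string. -/

section Uniform

open scoped BigOperators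
open RAM

theorem hashVal_congr {f g : ℕ → ℕ} {a : ℕ} (h : ∀ i < a, f i = g i) :
    hashVal f a = hashVal g a := by
  induction a with
  | zero => rfl
  | succ a ih => rw [hashVal, hashVal, ih fun i hi => h i (by omega), h a (by omega)]

theorem hashVal_inj {f g : ℕ → ℕ} (hf : ∀ i, f i < 2) (hg : ∀ i, g i < 2) {a : ℕ}
    (h : hashVal f a = hashVal g a) : ∀ i < a, f i = g i := by
  induction a with
  | zero => intro i hi; omega
  | succ a ih =>
      rw [hashVal, hashVal] at h
      have h1 := hf a
      have h2 := hg a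
      intro i hi
      rcases Nat.lt_succ_iff_lt_or_eq.1 hi with hi | rfl
      · exact ih (by omega) i hi
      · omega

/-- The hash value with `a` bits from `S` random bits. -/
def bitsHash (S a : ℕ) (b : Fin S → Bool) : ℕ := hashVal (arrayOf fun j => (b j).toNat) a

/-- Only the first `a` bits matter, and binary expansion is injective on them, so at most one of the
`2 ^ a` strings has the value `u`. -/
theorem expect_bitsHash_eq_le {S a : ℕ} (ha : a ≤ S) (u : ℕ) :
    𝔼 b : Fin S → Bool, (if bitsHash S a b = u then (1 : ℝ) else 0) ≤ 1 / 2 ^ a := by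
  have h1 : ∀ b : Fin S → Bool, bitsHash S a b =
      bitsHash a a (fun k => b ((Fin.castLEEmb ha) k)) := by
    intro b
    refine hashVal_congr fun i hi => ?_
    have : i < S := by omega
    simp [arrayOf, hi, this]
  simp only [h1]
  rw [expect_comp_embedding (Fin.castLEEmb ha)
    (fun b : Fin a → Bool => if bitsHash a a b = u then (1 : ℝ) else 0),
    Fintype.expect_eq_sum_div_card]
  simp only [Fintype.card_fun, Fintype.card_bool, Fintype.card_fin, Nat.cast_pow, Nat.cast_ofNat]
  refine div_le_div_of_nonneg_right ?_ (by positivity)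
  rw [sum_boole]
  norm_cast
  refine card_le_one.2 fun b hb b' hb' => ?_
  simp only [mem_filter, mem_univ, true_and] at hb hb'
  funext i
  have := hashVal_inj (arrayOf_toNat_lt_two b) (arrayOf_toNat_lt_two b') (hb.trans hb'.symm) i i.2
  simp only [arrayOf, i.2, dif_pos] at this
  revert this; cases b i <;> cases b' i <;> simp

/-- The entry of a finite bit string at a position, if there is one. -/
def bitAt {N : ℕ} (r : Fin N → Bool) (i : ℕ) : Bool := if h : i < N then r ⟨i, h⟩ else false

/-- Blocks of random bits that are read from a long random string are independent and uniform. -/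
theorem prob_blocks {G n S N : ℕ} (hN : G * n * S ≤ N)
    (E : (Fin G → Fin n → Fin S → Bool) → Prop) :
    prob (fun r : Fin N → Bool => E fun γ p j => bitAt r ((γ * n + p) * S + j)) = prob E := by
  classical
  let e : (Fin G × Fin n) × Fin S ↪ Fin N :=
    ((finProdFinEquiv.prodCongr (Equiv.refl _)).trans finProdFinEquiv).toEmbedding.trans
      (Fin.castLEEmb hN)
  have he : ∀ (γ : Fin G) (p : Fin n) (j : Fin S), (e ((γ, p), j) : ℕ) = (γ * n + p) * S + j := by
    intro γ p j
    simp [e]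
    ring
  have h1 : ∀ (r : Fin N → Bool) (γ : Fin G) (p : Fin n) (j : Fin S), bitAt r ((γ * n + p) * S + j) = r (e ((γ, p), j)) := by
    intro r γ p j
    unfold bitAt
    have h := he γ p j
    have hlt := (e ((γ, p), j)).2
    rw [h] at hlt
    rw [dif_pos hlt]
    congr 1
    exact Fin.ext h.symm
  simp only [h1]
  rw [prob_eq, prob_eq, expect_comp_embedding e
    (fun s : (Fin G × Fin n) × Fin S → Bool => if E fun γ p j => s ((γ, p), j) then (1 : ℝ) else 0)]
  exact Fintype.expect_equiv ((Equiv.curry _ _ _).trans (Equiv.curry _ _ _)) _ _ fun _ => rfl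

end Uniform

/-! ### Lower bounds for the entropy. -/

section Entropy

/-- The number of subsets with at most `k` elements of a set with `s` elements. -/
def ballCard (s k : ℕ) : ℕ := ∑ j ∈ range (k + 1), s.choose j

theorem ballCard_pos (s k : ℕ) : 0 < ballCard s k := by
  unfold ballCard
  rw [sum_range_succ']
  simp

theorem Hnat_eq (s k : ℕ) : Hnat s k = Real.logb 2 (ballCard s k) := by
  simp [Hnat, ballCard]

theorem Hnat_nonneg (s k : ℕ) : 0 ≤ Hnat s k := by
  rw [Hnat_eq]
  exact Real.logb_nonneg (by norm_num) (by exact_mod_cast ballCard_pos s k)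

theorem le_Hnat_of_two_pow_le {s k m : ℕ} (h : 2 ^ m ≤ ballCard s k) : (m : ℝ) ≤ Hnat s k := by
  rw [Hnat_eq, Real.le_logb_iff_rpow_le (by norm_num) (by exact_mod_cast ballCard_pos s k),
    Real.rpow_natCast]
  exact_mod_cast h

theorem Hnat_mono {s k k' : ℕ} (h : k ≤ k') : Hnat s k ≤ Hnat s k' := by
  rw [Hnat_eq, Hnat_eq]
  refine Real.logb_le_logb_of_le (by norm_num) (by exact_mod_cast ballCard_pos s k) ?_
  exact_mod_cast sum_le_sum_of_subset (range_subset_range.2 (by omega))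

/-- One element may be chosen from each of `j` blocks of size `q`. -/
theorem pow_le_choose_mul (q j : ℕ) : q ^ j ≤ (j * q).choose j := by
  induction j with
  | zero => simp
  | succ j ih =>
      rw [add_mul, one_mul, Nat.add_choose_eq, pow_succ]
      refine (Nat.mul_le_mul_right q ih).trans ?_
      have := single_le_sum (f := fun ij : ℕ × ℕ => (j * q).choose ij.1 * q.choose ij.2)
        (fun _ _ => Nat.zero_le _) (show (j, 1) ∈ antidiagonal (j + 1) by simp)
      simpa using this

theorem two_pow_size_le {m : ℕ} (hm : 0 < m) : 2 ^ Nat.size m ≤ 2 * m := by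
  have h1 : 0 < Nat.size m := Nat.size_pos.2 hm
  have h2 : 2 ^ (Nat.size m - 1) ≤ m := Nat.lt_size.1 (by omega)
  calc 2 ^ Nat.size m = 2 * 2 ^ (Nat.size m - 1) := by rw [← pow_succ']; congr 1; omega
    _ ≤ _ := by omega

/-- The entropy dominates the product of the number of errors and the weight. -/
theorem mul_size_le_two_mul_Hnat (s k : ℕ) :
    ((min k s * Nat.size (s / max (min k s) 1) : ℕ) : ℝ) ≤ 2 * Hnat s k := by
  set m := min k s with hm
  rcases Nat.eq_zero_or_pos m with h0 | hpos
  · rw [h0]; simpa using Hnat_nonneg s k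
  have hms : m ≤ s := min_le_right _ _
  have hmk : m ≤ k := min_le_left _ _
  rw [max_eq_left hpos]
  set q := s / m with hq
  have hq1 : 0 < q := Nat.div_pos hms hpos
  -- All subsets of an `m`-element set are counted. This supplies the summand `m` that is lost when
  -- the weight is replaced by the weight minus one below.
  have h1 : (m : ℝ) ≤ Hnat s k := by
    refine le_Hnat_of_two_pow_le ?_
    rw [← Nat.sum_range_choose]
    exact (sum_le_sum fun j _ => Nat.choose_le_choose j hms).trans
      (sum_le_sum_of_subset (range_subset_range.2 (by omega)))
  have h2 : (((Nat.size q - 1) * m : ℕ) : ℝ) ≤ Hnat s k := by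
    refine le_Hnat_of_two_pow_le ?_
    rw [pow_mul]
    have hs : 0 < Nat.size q := Nat.size_pos.2 hq1
    calc (2 ^ (Nat.size q - 1)) ^ m ≤ q ^ m :=
          Nat.pow_le_pow_left (Nat.lt_size.1 (by omega)) _
      _ ≤ (m * q).choose m := pow_le_choose_mul q m
      _ ≤ s.choose m := Nat.choose_le_choose m (Nat.mul_div_le s m)
      _ ≤ ballCard s k := single_le_sum (f := fun j => s.choose j) (fun _ _ => Nat.zero_le _)
          (mem_range.2 (by omega))
  have h3 : m * Nat.size q = (Nat.size q - 1) * m + m := by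
    have hs : 0 < Nat.size q := Nat.size_pos.2 hq1
    obtain ⟨w, hw⟩ : ∃ w, Nat.size q = w + 1 := ⟨Nat.size q - 1, by omega⟩
    rw [hw]; simp; ring
  rw [h3]
  push_cast
  push_cast at h2
  linarith

/-- A small subset of a disjoint union is determined by its two parts, which are both small; in
formulas, Vandermonde's identity. -/
theorem ballCard_add_le (a b k : ℕ) : ballCard (a + b) k ≤ ballCard a k * ballCard b k := by
  unfold ballCard
  rw [sum_mul_sum, ← sum_product']
  simp only [Nat.add_choose_eq]
  rw [sum_sigma']
  refine le_trans (le_of_eq ?_) (sum_le_sum_of_subset (f := fun p : ℕ × ℕ =>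
    a.choose p.1 * b.choose p.2) (s := ((range (k + 1)).sigma fun j => antidiagonal j).image
      fun x => x.2) ?_)
  · rw [sum_image]
    rintro ⟨i, p⟩ hp ⟨j, q⟩ hq h
    simp only [coe_sigma, Set.mem_sigma_iff, mem_coe, HasAntidiagonal.mem_antidiagonal] at hp hq
    simp only at h
    subst h
    obtain ⟨-, rfl⟩ := hp
    obtain ⟨-, rfl⟩ := hq
    rfl
  · intro p hp
    simp only [mem_image, mem_sigma, mem_range, HasAntidiagonal.mem_antidiagonal, Sigma.exists] at hp
    obtain ⟨j, q, ⟨hj, hq⟩, rfl⟩ := hp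
    simp only [mem_product, mem_range]
    omega

theorem Hnat_sum_le (s : ℕ → ℕ) (k m : ℕ) :
    Hnat (∑ i ∈ range m, s i) k ≤ ∑ i ∈ range m, Hnat (s i) k := by
  induction m with
  | zero =>
      have : ballCard 0 k = 1 := by
        unfold ballCard
        rw [sum_range_succ']
        simp
      simp [Hnat_eq, this]
  | succ m ih =>
      rw [sum_range_succ, sum_range_succ]
      refine le_trans ?_ (add_le_add_left ih _)
      rw [Hnat_eq, Hnat_eq, Hnat_eq, ← Real.logb_mul]
      · refine Real.logb_le_logb_of_le (by norm_num) (by exact_mod_cast ballCard_pos _ k) ?_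
        exact_mod_cast ballCard_add_le _ _ k
      · exact_mod_cast (ballCard_pos _ k).ne'
      · exact_mod_cast (ballCard_pos _ k).ne'

/-- A divisor `m` of at most the bit length `l` of `n` is at most `2 ^ (l / 2 + 1)`, so the quotient
retains about half of the bits. -/
theorem size_le_four_mul_size_div {n m : ℕ} (hm : 0 < m) (hmn : m ≤ Nat.size n) :
    Nat.size n ≤ 4 * Nat.size (n / m) := by
  set l := Nat.size n with hl
  have hln : l ≤ n := DEParams.size_le_self n
  have h1 : 2 ^ (l - 1) ≤ n := Nat.lt_size.1 (by omega)
  set w := Nat.size (n / m) with hw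
  have hw1 : 0 < w := Nat.size_pos.2 (Nat.div_pos (by omega) hm)
  have h2 : n < 2 ^ w * m := (Nat.div_lt_iff_lt_mul hm).1 (Nat.lt_size_self _)
  have h3 : l ≤ 2 ^ (l / 2 + 1) := by
    have : l / 2 + 1 ≤ 2 ^ (l / 2) := Nat.lt_two_pow_self
    rw [pow_succ]; omega
  have h4 : 2 ^ (l - 1) < 2 ^ (w + (l / 2 + 1)) := by
    rw [pow_add]
    calc 2 ^ (l - 1) ≤ n := h1
      _ < 2 ^ w * m := h2
      _ ≤ 2 ^ w * 2 ^ (l / 2 + 1) := Nat.mul_le_mul_left _ (hmn.trans h3)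
  have h5 := (Nat.pow_lt_pow_iff_right (by norm_num : 1 < 2)).1 h4
  omega

end Entropy

/-! ### The length of the message. -/

namespace DEParams

variable (P : DEParams)

/-- The entropy in the bound for the length of the message. -/
theorem entropy_eq : Hnat (P.n - P.totalSB) P.totalKA + Hvec P.sB P.kB =
    ∑ i ∈ range (P.tB + 1), Hnat (P.classSize i) (P.classCap i) := by
  rw [sum_range_succ', add_comm]
  congr 1
  rw [Hvec, ← Fin.sum_univ_eq_sum_range (fun i => Hnat (P.classSize (i + 1)) (P.classCap (i + 1)))]
  refine sum_congr rfl fun i _ => ?_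
  simp [classSize, classCap, RAM.arrayOf]

theorem slackTo_le_classCap {i j : ℕ} (h : i < j) : P.slackTo j ≤ P.classCap i := by
  induction j with
  | zero => omega
  | succ j ih =>
      rcases Nat.lt_succ_iff_lt_or_eq.1 h with h' | rfl
      · exact (min_le_left _ _).trans (ih h')
      · exact min_le_right _ _

theorem slack_le_classCap {i : ℕ} (h : i < P.tB + 1) : P.slack ≤ P.classCap i :=
  P.slackTo_le_classCap h

theorem slack_le_lenBits : P.slack ≤ P.lenBits := P.slackTo_le _

/-- The sum of the products of errors and weights. -/
def totalWeight : ℕ := ∑ i ∈ range (P.tB + 1), P.classErr i * P.classWeight i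

theorem totalWeight_le : (P.totalWeight : ℝ) ≤
    2 * (Hnat (P.n - P.totalSB) P.totalKA + Hvec P.sB P.kB) := by
  rw [entropy_eq, totalWeight, mul_sum, Nat.cast_sum]
  exact sum_le_sum fun i _ => mul_size_le_two_mul_Hnat (P.classSize i) (P.classCap i)

/-- All error bounds are at least `slack`, so subadditivity bounds `H(n, slack)` by the total
entropy. As `slack` is at most logarithmic in `n`, the ratio `n / slack` still has bit length
proportional to `log n`. -/
theorem lenBits_mul_slack_le (hv : P.totalSB ≤ P.n) : ((P.lenBits * P.slack : ℕ) : ℝ) ≤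
    8 * (Hnat (P.n - P.totalSB) P.totalKA + Hvec P.sB P.kB) := by
  have h1 : Hnat P.n P.slack ≤ Hnat (P.n - P.totalSB) P.totalKA + Hvec P.sB P.kB := by
    rw [entropy_eq, ← P.sum_classSize hv]
    exact (Hnat_sum_le _ _ _).trans
      (sum_le_sum fun i hi => Hnat_mono (P.slack_le_classCap (mem_range.1 hi)))
  rcases Nat.eq_zero_or_pos P.slack with h0 | hpos
  · rw [h0]
    have := (Hnat_nonneg P.n P.slack).trans h1
    simp only [mul_zero, Nat.cast_zero]
    linarith
  have h2 := mul_size_le_two_mul_Hnat P.n P.slack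
  have h3 : min P.slack P.n = P.slack := min_eq_left (P.slack_le_lenBits.trans P.lenBits_le)
  rw [h3, max_eq_left hpos] at h2
  have h4 : P.lenBits * P.slack ≤ 4 * (P.slack * Nat.size (P.n / P.slack)) := by
    have := Nat.mul_le_mul_right P.slack (size_le_four_mul_size_div hpos P.slack_le_lenBits)
    calc _ ≤ _ := this
      _ = _ := by ring
  have h5 : ((P.lenBits * P.slack : ℕ) : ℝ) ≤
      4 * ((P.slack * Nat.size (P.n / P.slack) : ℕ) : ℝ) := by exact_mod_cast h4
  linarith

theorem classWeight_pos {i : ℕ} (h : 0 < P.classErr i) : 0 < P.classWeight i := by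
  refine Nat.size_pos.2 (Nat.div_pos ?_ (by omega))
  have : P.classErr i ≤ P.classSize i := min_le_right _ _
  omega

theorem totalErr_le_totalWeight : P.totalErr ≤ P.totalWeight := by
  refine sum_le_sum fun i _ => ?_
  rcases Nat.eq_zero_or_pos (P.classErr i) with h0 | hpos
  · simp [h0]
  · exact Nat.le_mul_of_pos_right _ (P.classWeight_pos hpos)

/-- The first bound makes the induction for the second work: a new term `2 ^ R < X` at most doubles
`2 ^ R`. -/
theorem sum_two_pow_lt_le (X R : ℕ) :
    (∑ q ∈ range R, if 2 ^ q < X then 2 ^ q else 0) ≤ 2 ^ R ∧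
      (∑ q ∈ range R, if 2 ^ q < X then 2 ^ q else 0) ≤ 2 * X := by
  induction R with
  | zero => simp
  | succ R ih =>
      rw [sum_range_succ, pow_succ]
      split_ifs <;> omega

theorem sum_div_two_pow_le (K R : ℕ) : ∑ q ∈ range R, K / 2 ^ q + 2 * (K / 2 ^ R) ≤ 2 * K := by
  induction R with
  | zero => simp
  | succ R ih =>
      rw [sum_range_succ, pow_succ, ← Nat.div_div_eq_div_mul]
      omega

theorem sum_two_pow_le (R : ℕ) : ∑ q ∈ range R, 2 ^ q ≤ 2 ^ R := by
  induction R with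
  | zero => simp
  | succ R ih => rw [sum_range_succ, pow_succ]; omega

theorem two_pow_mul_div_four_pow_le (K q : ℕ) : 2 ^ q * (K / 4 ^ q) ≤ K / 2 ^ q := by
  rw [Nat.le_div_iff_mul_le (by positivity)]
  calc 2 ^ q * (K / 4 ^ q) * 2 ^ q = (2 * 2) ^ q * (K / 4 ^ q) := by rw [mul_pow]; ring
    _ ≤ K := Nat.mul_div_le K (4 ^ q)

theorem two_pow_numStages_le : P.slack ≠ 0 → 2 ^ P.numStages ≤ 4 * P.lenBits := by
  intro h
  have h1 := P.slack_le_lenBits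
  unfold numStages
  rw [if_neg h]
  have := two_pow_size_le (m := 2 * P.lenBits - 1) (by omega)
  omega

/-- Three geometric sums: the decaying part behaves like the sum of `totalErr / 2 ^ q`, `slack` is
charged in all stages, and a class is charged only while `2 ^ q` is below twice its weight. -/
theorem sum_two_pow_mul_load_le (R : ℕ) :
    ∑ q ∈ range R, 2 ^ q * P.load q ≤ 2 * P.totalErr + 2 ^ R * P.slack + 4 * P.totalWeight := by
  unfold load
  simp only [mul_add, sum_add_distrib]
  refine Nat.add_le_add (Nat.add_le_add ?_ ?_) ?_
  · have h1 := sum_le_sum fun q (_ : q ∈ range R) => two_pow_mul_div_four_pow_le P.totalErr q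
    have h2 := sum_div_two_pow_le P.totalErr R
    omega
  · rw [← sum_mul]
    exact Nat.mul_le_mul_right _ (sum_two_pow_le R)
  · simp only [mul_sum]
    rw [sum_comm, totalWeight, mul_sum]
    refine sum_le_sum fun i _ => ?_
    have h1 : ∀ q, 2 ^ q * (if 2 ^ q < 2 * P.classWeight i then P.classErr i else 0) =
        P.classErr i * (if 2 ^ q < 2 * P.classWeight i then 2 ^ q else 0) := by
      intro q; split_ifs <;> ring
    simp only [h1]
    rw [← mul_sum]
    calc _ ≤ P.classErr i * (2 * (2 * P.classWeight i)) :=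
          Nat.mul_le_mul_left _ (sum_two_pow_lt_le _ _).2
      _ = _ := by ring

theorem offset_numStages_le (D : ℕ) (hv : P.totalSB ≤ P.n) :
    (P.offset D P.numStages : ℝ) ≤
      D * 2 ^ 27 * (Hnat (P.n - P.totalSB) P.totalKA + Hvec P.sB P.kB) := by
  set E := Hnat (P.n - P.totalSB) P.totalKA + Hvec P.sB P.kB with hE
  have hW := P.totalWeight_le
  have hL := P.lenBits_mul_slack_le hv
  rw [← hE] at hW hL
  have hE0 : 0 ≤ E := by
    have : (0 : ℝ) ≤ P.totalWeight := Nat.cast_nonneg _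
    linarith
  -- Without slack there are no stages and the message is empty. Otherwise all loads are positive,
  -- so rounding to a power of two costs at most a factor of two.
  by_cases hs : P.slack = 0
  · have : P.numStages = 0 := by simp [numStages, hs]
    rw [this]
    simp only [offset, range_zero, sum_empty, Nat.cast_zero]
    positivity
  have h1 : P.offset D P.numStages ≤ D * 2 ^ 21 * (6 * P.totalWeight +
      4 * (P.lenBits * P.slack)) := by
    have h2 : ∀ q, D * 2 ^ q * 2 ^ P.width q ≤ D * 2 ^ 21 * (2 ^ q * P.load q) := by
      intro q
      have hpos : 0 < P.load q := (Nat.pos_of_ne_zero hs).trans_le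
        ((Nat.le_add_left _ _).trans (Nat.le_add_right _ _))
      calc D * 2 ^ q * 2 ^ P.width q ≤ D * 2 ^ q * (2 * (2 ^ 20 * P.load q)) :=
            Nat.mul_le_mul_left _ (two_pow_size_le (by omega))
        _ = _ := by ring
    unfold offset
    refine (sum_le_sum fun q _ => h2 q).trans ?_
    rw [← mul_sum]
    refine Nat.mul_le_mul_left _ ((P.sum_two_pow_mul_load_le _).trans ?_)
    have h3 := P.totalErr_le_totalWeight
    have h4 := Nat.mul_le_mul_right P.slack (P.two_pow_numStages_le hs)
    rw [mul_assoc] at h4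
    omega
  have h5 : (P.offset D P.numStages : ℝ) ≤ D * 2 ^ 21 * (6 * (P.totalWeight : ℝ) +
      4 * ((P.lenBits * P.slack : ℕ) : ℝ)) := by exact_mod_cast h1
  refine h5.trans ?_
  calc (D : ℝ) * 2 ^ 21 * (6 * (P.totalWeight : ℝ) + 4 * ((P.lenBits * P.slack : ℕ) : ℝ))
      -- The constants add up to `6 * 2 + 4 * 8 = 44`, rounded up to `64`.
      ≤ D * 2 ^ 21 * (64 * E) := by gcongr; linarith
    _ = _ := by ring

end DEParams

/-! ### Position labels and disjoint sets. -/

section SetVectors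

open OneRoundProtocol

variable {n t : ℕ} {s : Fin t → ℕ} {S : Fin t → Finset (Fin n)}

theorem IsSetVector.setTable_eq (h : IsSetVector s S) {i : Fin t} {p : Fin n} (hp : p ∈ S i) :
    setTable S p = i + 1 := by
  unfold setTable
  rw [sum_eq_single i, if_pos hp]
  · intro j _ hj
    exact if_neg fun hpj => disjoint_left.1 (h.disjoint j i hj) hpj hp
  · simp

theorem setTable_eq_zero {p : Fin n} (hp : ∀ i, p ∉ S i) : setTable S p = 0 := by
  simp [setTable, hp]

theorem IsSetVector.setTable_lt (h : IsSetVector s S) (p : Fin n) : setTable S p < t + 1 := by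
  by_cases hp : ∃ i, p ∈ S i
  · obtain ⟨i, hi⟩ := hp
    rw [h.setTable_eq hi]
    omega
  · push Not at hp
    rw [setTable_eq_zero hp]
    omega

theorem IsSetVector.setTable_eq_succ_iff (h : IsSetVector s S) (i : Fin t) (p : Fin n) :
    setTable S p = i + 1 ↔ p ∈ S i := by
  refine ⟨fun hp => ?_, fun hp => h.setTable_eq hp⟩
  by_cases hq : ∃ j, p ∈ S j
  · obtain ⟨j, hj⟩ := hq
    rw [h.setTable_eq hj] at hp
    have : j = i := Fin.ext (by omega)
    rwa [← this]
  · push Not at hq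
    rw [setTable_eq_zero hq] at hp
    omega

theorem IsSetVector.sum_le (h : IsSetVector s S) : ∑ i, s i ≤ n := by
  rw [← sum_congr rfl fun i _ => h.card_eq i,
    ← card_biUnion fun i _ j _ hij => h.disjoint i j hij]
  simpa using card_le_univ (univ.biUnion S)

theorem card_filter_label_le {α : Type*} (s : Finset α) (f : α → ℕ) {m : ℕ} (hf : ∀ a ∈ s, f a < m)
    {c : ℕ → ℕ} (hc : ∀ i < m, #(s.filter fun a => f a = i) ≤ c i) (Q : ℕ → Prop)
    [DecidablePred Q] : #(s.filter fun a => Q (f a)) ≤ ∑ i ∈ range m, if Q i then c i else 0 := by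
  rw [card_eq_sum_card_fiberwise (f := f) (t := range m)
    fun a ha => by simpa using hf a (mem_filter.1 ha).1]
  refine sum_le_sum fun i hi => ?_
  split_ifs with hQ
  · exact (card_le_card fun a ha => by simp at ha ⊢; exact ⟨ha.1.1, ha.2⟩).trans
      (hc i (mem_range.1 hi))
  · rw [Nat.le_zero, card_eq_zero, filter_eq_empty_iff]
    rintro a ha rfl
    exact hQ (mem_filter.1 ha).2

end SetVectors

/-! ### Errors per class and the total failure probability. -/

namespace DEParams

open OneRoundProtocol

variable {P : DEParams} {SA : Fin P.tA → Finset (Fin P.n)} {SB : Fin P.tB → Finset (Fin P.n)}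
  {x y : Fin P.n → Bool}

theorem card_filter_setTable (h : IsSetVector P.sB SB) {i : ℕ} (hi : i < P.tB + 1) :
    #(univ.filter fun p => setTable SB p = i) = P.classSize i := by
  have hsucc : ∀ j : Fin P.tB, #(univ.filter fun p => setTable SB p = (j : ℕ) + 1) =
      P.classSize (j + 1) := by
    intro j
    simp only [h.setTable_eq_succ_iff]
    simp [h.card_eq, classSize, RAM.arrayOf]
  match i with
  | i + 1 => exact hsucc ⟨i, by omega⟩
  | 0 =>
      have h1 : ∑ i ∈ range (P.tB + 1), #(univ.filter fun p => setTable SB p = i) = P.n := by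
        rw [← card_eq_sum_card_fiberwise fun p _ => by simpa using h.setTable_lt p]
        simp
      rw [sum_range_succ', ← Fin.sum_univ_eq_sum_range
        (fun i => #(univ.filter fun p => setTable SB p = i + 1)),
        sum_congr rfl fun j _ => hsucc j] at h1
      have h2 := P.sum_classSize h.sum_le
      rw [sum_range_succ', ← Fin.sum_univ_eq_sum_range (fun i => P.classSize (i + 1))] at h2
      omega

theorem IsConfig.card_diff_le (h : P.IsConfig SA SB x y) {i : ℕ} (hi : i < P.tB + 1) :
    #((univ.filter fun p => x p ≠ y p).filter fun p => setTable SB p = i) ≤ P.classErr i := by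
  refine le_min ?_ ?_
  · match i with
    | i + 1 =>
        have h1 := h.distB ⟨i, by omega⟩
        have h2 : P.classCap (i + 1) = P.kB ⟨i, by omega⟩ := by
          simp [classCap, RAM.arrayOf, show i < P.tB by omega]
        rw [h2]
        refine (card_le_card fun p hp => ?_).trans h1
        simp only [mem_filter, mem_univ, true_and, diffIn] at hp ⊢
        exact ⟨(h.setsB.setTable_eq_succ_iff ⟨i, by omega⟩ p).1 hp.2, hp.1⟩
    | 0 =>
        -- Errors outside Bob's sets must lie in Alice's sets.
        refine le_trans (card_le_card (t := univ.biUnion fun i => diffIn x y (SA i)) fun p hp => ?_)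
          (card_biUnion_le.trans (sum_le_sum fun i _ => h.distA i))
        simp only [mem_filter, mem_univ, true_and, diffIn, mem_biUnion] at hp ⊢
        rcases h.covered p hp.1 with ⟨j, hj⟩ | ⟨j, hj⟩
        · exact ⟨j, hj, hp.1⟩
        · rw [h.setsB.setTable_eq hj] at hp
          omega
  · rw [← card_filter_setTable h.setsB hi]
    exact card_le_card fun p hp => by
      simp only [mem_filter, mem_univ, true_and] at hp ⊢; exact hp.2

theorem IsConfig.card_diff_filter_le (h : P.IsConfig SA SB x y) (Q : ℕ → Prop) [DecidablePred Q] :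
    #((univ.filter fun p => x p ≠ y p).filter fun p => Q (setTable SB p)) ≤
      ∑ i ∈ range (P.tB + 1), if Q i then P.classErr i else 0 :=
  card_filter_label_le _ _ (fun p _ => h.setsB.setTable_lt p) (fun _ hi => h.card_diff_le hi) Q

/-- Positive slack makes every error bound positive, so a class with truncated bound `0` is empty;
otherwise the weight bounds the ratio of size and errors. -/
theorem classSize_le_classErr_mul (hs : P.slack ≠ 0) {i v : ℕ} (hi : i < P.tB + 1)
    (hw : P.classWeight i ≤ v) : P.classSize i ≤ P.classErr i * 2 ^ v := by
  have h1 := P.slack_le_classCap hi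
  have h2 : P.classErr i = min (P.classCap i) (P.classSize i) := rfl
  rcases Nat.eq_zero_or_pos (P.classErr i) with h0 | hpos
  · omega
  have h3 : P.classSize i < 2 ^ P.classWeight i * max (P.classErr i) 1 :=
    (Nat.div_lt_iff_lt_mul (by omega)).1 (Nat.lt_size_self _)
  rw [max_eq_left hpos, mul_comm] at h3
  exact h3.le.trans (Nat.mul_le_mul_left _ (Nat.pow_le_pow_right (by norm_num) hw))

theorem card_filter_classWeight_le (h : IsSetVector P.sB SB) (hs : P.slack ≠ 0) (v : ℕ) :
    #(univ.filter fun p => P.classWeight (setTable SB p) ≤ v) ≤ P.totalErr * 2 ^ v := by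
  refine (card_filter_label_le univ (setTable SB) (fun p _ => h.setTable_lt p)
    (fun i hi => (card_filter_setTable h hi).le) (fun i => P.classWeight i ≤ v)).trans ?_
  rw [totalErr, sum_mul]
  refine sum_le_sum fun i hi => ?_
  split_ifs with hw
  · exact classSize_le_classErr_mul hs (mem_range.1 hi) hw
  · exact Nat.zero_le _

theorem classWeight_le (hv : P.totalSB ≤ P.n) {i : ℕ} (hi : i < P.tB + 1) :
    P.classWeight i ≤ P.lenBits :=
  Nat.size_le_size ((Nat.div_le_self _ _).trans (P.classSize_le hv hi))

theorem numStages_pos (hs : P.slack ≠ 0) : 0 < P.numStages := by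
  have := P.slack_le_lenBits
  rw [numStages, if_neg hs]
  exact Nat.size_pos.2 (by omega)

theorem lenBits_le_two_pow (hs : P.slack ≠ 0) : P.lenBits ≤ 2 ^ (P.numStages - 1) := by
  have h1 := P.slack_le_lenBits
  have h2 : 2 * P.lenBits - 1 < 2 ^ P.numStages := by
    rw [numStages, if_neg hs]
    exact Nat.lt_size_self _
  have h3 : 2 ^ P.numStages = 2 * 2 ^ (P.numStages - 1) := by
    rw [← pow_succ', Nat.sub_add_cancel (numStages_pos hs)]
  omega

/-- The number of positions for which stage `r` may fail. -/
def tolerance (P : DEParams) (r : ℕ) : ℕ :=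
  if r + 1 = P.numStages then 1 else P.totalErr / 4 ^ (r + 1) + P.slack

/-- Since `r + 1 ≤ 2 ^ r`, the loss `4 ^ (r + 1)` is at most `4 ^ 2 ^ r`, and `4 * 2 = 8`. -/
theorem mul_two_pow_le_pow_mul (hs : P.slack ≠ 0) {D : ℕ} (hD : 0 < D) (r : ℕ) :
    P.totalErr * 2 ^ 2 ^ r ≤ 8 ^ (D * 2 ^ r) * (P.totalErr / 4 ^ (r + 1) + P.slack) := by
  set t := P.totalErr / 4 ^ (r + 1) + P.slack
  have h1 : P.totalErr ≤ 4 ^ (r + 1) * t := by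
    have h2 := Nat.lt_mul_div_succ P.totalErr (show 0 < 4 ^ (r + 1) by positivity)
    exact h2.le.trans (Nat.mul_le_mul_left _ (by omega))
  have h3 : (4 : ℕ) ^ (r + 1) ≤ 4 ^ 2 ^ r :=
    Nat.pow_le_pow_right (by norm_num) Nat.lt_two_pow_self
  calc P.totalErr * 2 ^ 2 ^ r ≤ (4 ^ 2 ^ r * t) * 2 ^ 2 ^ r :=
        Nat.mul_le_mul_right _ (h1.trans (Nat.mul_le_mul_right _ h3))
    _ = (4 * 2) ^ 2 ^ r * t := by rw [mul_pow]; ring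
    _ ≤ 8 ^ (D * 2 ^ r) * t := Nat.mul_le_mul_right _
        (Nat.pow_le_pow_right (by norm_num) (Nat.le_mul_of_pos_left _ hD))

theorem IsConfig.prob_errSeq_le (h : P.IsConfig SA SB x y) (hs : P.slack ≠ 0) {D : ℕ}
    (hD : 0 < D) :
    prob (fun ω : Fin (D * (2 ^ P.numStages - 1)) → Fin P.n → Fin (P.size + 25) → Bool =>
      errSeq D (stageFamily D P.numStages (fun r => bitsHash (P.size + 25) (P.width r)) ω)
        (fun p => P.classWeight (setTable SB p)) (univ.filter fun p => x p ≠ y p)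
        P.numStages ≠ ∅) ≤
      ∑ r ∈ range P.numStages, (4 / 2 ^ (D * 2 ^ r) : ℝ) ^ P.tolerance r := by
  have hv : P.totalSB ≤ P.n := h.setsB.sum_le
  have hR := numStages_pos hs
  refine prob_errSeq_ne_empty_le (b := P.load) (η := fun r => 1 / 2 ^ P.width r) hR
    (fun r _ u => expect_bitsHash_eq_le (P.width_le hv r) u) ?_ ?_ ?_ ?_ ?_ ?_
  · intro r _
    have h1 : 2 ^ 20 * P.load r < 2 ^ P.width r := Nat.lt_size_self _
    have h2 : (2 : ℝ) ^ 20 * P.load r ≤ 2 ^ P.width r := by exact_mod_cast h1.le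
    rw [mul_one_div, div_le_div_iff₀ (by positivity) (by positivity)]
    linarith
  · have h1 := h.card_diff_filter_le fun _ => True
    simp only [filter_true, if_true] at h1
    refine h1.trans ?_
    change P.totalErr ≤ _
    unfold load
    simp
    omega
  · intro r hr
    have h1 := h.card_diff_filter_le fun i => 2 ^ r < P.classWeight i
    -- The factor two in the threshold of `load` makes stage `r + 1` count exactly the classes that
    -- stage `r` does not treat.
    have h2 : P.load (r + 1) = P.totalErr / 4 ^ (r + 1) + P.slack +
        ∑ i ∈ range (P.tB + 1), if 2 ^ r < P.classWeight i then P.classErr i else 0 := by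
      unfold load
      congr 1
      refine sum_congr rfl fun i _ => ?_
      rw [pow_succ']
      simp
    rw [h2, tolerance, if_neg (by omega)]
    omega
  · intro r hr
    unfold tolerance
    split_ifs with hl
    -- In the last stage, `2 ^ r` is at least the bit length of `n`, so even all `n` positions are
    -- few enough for tolerance `1`.
    · rw [mul_one]
      have h1 : P.n < 2 ^ P.lenBits := Nat.lt_size_self _
      have h2 : P.lenBits ≤ 2 ^ r := by
        rw [show r = P.numStages - 1 by omega]; exact lenBits_le_two_pow hs
      calc _ ≤ P.n := by simpa using card_le_univ (univ.filter fun p : Fin P.n =>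
            P.classWeight (setTable SB p) ≤ 2 ^ r)
        _ ≤ 2 ^ 2 ^ r := h1.le.trans (Nat.pow_le_pow_right (by norm_num) h2)
        _ ≤ 8 ^ 2 ^ r := Nat.pow_le_pow_left (by norm_num) _
        _ ≤ 8 ^ (D * 2 ^ r) := Nat.pow_le_pow_right (by norm_num) (Nat.le_mul_of_pos_left _ hD)
    · exact (card_filter_classWeight_le h.setsB hs _).trans (mul_two_pow_le_pow_mul hs hD r)
  · intro p
    exact (classWeight_le hv (h.setsB.setTable_lt p)).trans (lenBits_le_two_pow hs)
  · rw [tolerance, if_pos (by omega)]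

theorem le_slackTo_iff {m i : ℕ} :
    m ≤ P.slackTo i ↔ m ≤ P.lenBits ∧ ∀ j < i, m ≤ P.classCap j := by
  induction i with
  | zero => simp [slackTo]
  | succ i ih =>
      rw [slackTo, le_min_iff, ih, Nat.forall_lt_succ_right]
      tauto

theorem slack_eq_min (P : DEParams) : P.slack = min P.lenBits P.minK := by
  refine eq_of_forall_le_iff fun m => ?_
  rw [slack, le_slackTo_iff, le_min_iff, minK, le_min'_iff]
  refine and_congr_right fun _ => ?_
  simp only [mem_insert, mem_image, mem_univ, true_and, forall_eq_or_imp, forall_exists_index,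
    forall_apply_eq_imp_iff]
  constructor
  · intro h
    refine ⟨h 0 (by omega), fun i => ?_⟩
    have := h (i + 1) (by omega)
    simpa [classCap, RAM.arrayOf] using this
  · rintro ⟨h0, h1⟩ j hj
    match j with
    | 0 => exact h0
    | j + 1 =>
        have := h1 ⟨j, by omega⟩
        simpa [classCap, RAM.arrayOf, show j < P.tB by omega] using this

/-- The exponent `(D * 2 ^ r - 2) * M` is at least `(D - 3) * M + r + 1`; the surplus `r + 1` makes
the sum over the stages converge. -/
theorem four_div_pow_pow_le {D : ℕ} (hD : 3 ≤ D) (r : ℕ) {M t : ℕ} (hM : 0 < M) (ht : M ≤ t) :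
    (4 / 2 ^ (D * 2 ^ r) : ℝ) ^ t ≤ 1 / 2 ^ ((D - 3) * M) * (1 / 2 ^ (r + 1)) := by
  obtain ⟨E, rfl⟩ : ∃ E, D = E + 3 := ⟨D - 3, by omega⟩
  obtain ⟨v, hv⟩ : ∃ v, 2 ^ r = v + 1 := ⟨2 ^ r - 1, by
    have : 0 < 2 ^ r := by positivity
    omega⟩
  have hrv : r ≤ v := by
    have : r < 2 ^ r := Nat.lt_two_pow_self
    omega
  have h1 : (4 / 2 ^ ((E + 3) * 2 ^ r) : ℝ) = 1 / 2 ^ (E + 1 + (E + 3) * v) := by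
    rw [hv, show (E + 3) * (v + 1) = 2 + (E + 1 + (E + 3) * v) by ring, pow_add]
    norm_num
    field_simp
  rw [h1, one_div_pow, ← pow_mul, one_div_mul_one_div, ← pow_add]
  refine one_div_le_one_div_of_le (by positivity) (pow_le_pow_right₀ (by norm_num) ?_)
  have h2 := Nat.mul_le_mul_left (E + 1 + (E + 3) * v) ht
  have h3 : 1 * (1 + (E + 3) * v) ≤ M * (1 + (E + 3) * v) := Nat.mul_le_mul_right _ hM
  have h4 : 1 * v ≤ (E + 3) * v := Nat.mul_le_mul_right _ (by omega)
  have h5 : (E + 1 + (E + 3) * v) * M = E * M + M * (1 + (E + 3) * v) := by ring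
  simp only [Nat.add_sub_cancel]
  omega

theorem sum_pow_tolerance_le (hs : P.slack ≠ 0) {D : ℕ} (hD : 3 ≤ D) :
    ∑ r ∈ range P.numStages, (4 / 2 ^ (D * 2 ^ r) : ℝ) ^ P.tolerance r ≤
      1 / 2 ^ ((D - 3) * P.slack) + 1 / 2 ^ ((D - 2) * P.lenBits) := by
  obtain ⟨R, hR⟩ : ∃ R, P.numStages = R + 1 := ⟨P.numStages - 1, by
    have := numStages_pos hs; omega⟩
  have hl : P.lenBits ≤ 2 ^ R := by simpa [hR] using lenBits_le_two_pow hs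
  have hl1 := P.slack_le_lenBits
  rw [hR, sum_range_succ]
  refine add_le_add ?_ ?_
  · have hgeo : ∀ m : ℕ, ∑ r ∈ range m, (1 / 2 ^ (r + 1) : ℝ) = 1 - 1 / 2 ^ m := by
      intro m
      induction m with
      | zero => simp
      | succ m ih => rw [sum_range_succ, ih, pow_succ]; ring
    calc _ ≤ ∑ r ∈ range R, (1 / 2 ^ ((D - 3) * P.slack) * (1 / 2 ^ (r + 1)) : ℝ) := by
          refine sum_le_sum fun r hr => four_div_pow_pow_le hD r (by omega) ?_
          have := mem_range.1 hr
          rw [tolerance, if_neg (by omega)]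
          exact Nat.le_add_left _ _
      _ = 1 / 2 ^ ((D - 3) * P.slack) * (1 - 1 / 2 ^ R) := by rw [← mul_sum, hgeo]
      _ ≤ 1 / 2 ^ ((D - 3) * P.slack) * 1 := by
          gcongr
          have : (0 : ℝ) ≤ 1 / 2 ^ R := by positivity
          linarith
      _ = _ := mul_one _
  · rw [tolerance, if_pos hR.symm, pow_one, div_le_div_iff₀ (by positivity) (by positivity), one_mul,
      show (4 : ℝ) = 2 ^ 2 by norm_num, ← pow_add]
    refine pow_le_pow_right₀ (by norm_num) ?_
    obtain ⟨E, rfl⟩ : ∃ E, D = E + 2 := ⟨D - 2, by omega⟩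
    have h1 := Nat.mul_le_mul_left (E + 2) hl
    have h2 : (E + 2) * P.lenBits = E * P.lenBits + 2 * P.lenBits := by ring
    simp only [Nat.add_sub_cancel]
    omega

/-- If `l ≤ μ`, both terms are at most half of `2 ^ (-2 * c * l)`, hence the polynomial term pays
for both. If `μ ≤ l`, each term on the left is matched with one on the right. -/
theorem one_div_add_one_div_le {c l μ s : ℕ} (hl : 0 < l) (hs : s + 1 ≤ (2 ^ l) ^ 2) :
    (1 / 2 ^ ((2 * c + 1) * min l μ) + 1 / 2 ^ ((2 * c + 2) * l) : ℝ) ≤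
      1 / 2 ^ μ + 1 / ((s : ℝ) + 1) ^ c := by
  have h1 : (1 / 2 ^ (2 * c * l) : ℝ) ≤ 1 / ((s : ℝ) + 1) ^ c := by
    refine one_div_le_one_div_of_le (by positivity) ?_
    rw [show 2 * c * l = l * 2 * c by ring, pow_mul, pow_mul]
    exact pow_le_pow_left₀ (by positivity) (by exact_mod_cast hs) c
  have hmono : ∀ {a b : ℕ}, a ≤ b → (1 / 2 ^ b : ℝ) ≤ 1 / 2 ^ a := fun hab =>
    one_div_le_one_div_of_le (by positivity) (pow_le_pow_right₀ (by norm_num) hab)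
  rcases le_total l μ with h | h
  · rw [min_eq_left h]
    have h2 : (1 / 2 ^ ((2 * c + 1) * l) : ℝ) ≤ 1 / 2 ^ (2 * c * l) / 2 := by
      rw [div_div, ← pow_succ]
      refine hmono ?_
      rw [add_mul]; omega
    have h3 : (1 / 2 ^ ((2 * c + 2) * l) : ℝ) ≤ 1 / 2 ^ ((2 * c + 1) * l) :=
      hmono (Nat.mul_le_mul_right _ (by omega))
    have h4 : (0 : ℝ) ≤ 1 / 2 ^ μ := by positivity
    linarith
  · rw [min_eq_right h]
    refine add_le_add (hmono (Nat.le_mul_of_pos_left _ (by omega))) (le_trans (hmono ?_) h1)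
    exact Nat.mul_le_mul_right _ (by omega)

end DEParams

/-! ### From the random string to the hash family. -/

namespace DEParams

open RAM OneRoundProtocol

theorem two_le_size (P : DEParams) : 2 ≤ P.size := by unfold size; omega

theorem hash_bits_le (P : DEParams) (hs : P.slack ≠ 0) (D : ℕ) :
    D * (2 ^ P.numStages - 1) * P.n * (P.size + 25) ≤ P.size ^ (D + 10) := by
  have hN := P.two_le_size
  have hn : P.n ≤ P.size := by unfold size; omega
  have h1 : 2 ^ P.numStages - 1 ≤ P.size ^ 3 := by
    have h2 := P.two_pow_numStages_le hs
    have h3 := P.lenBits_le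
    have h4 : 2 * 2 * P.size ≤ P.size * P.size * P.size := by gcongr
    rw [show P.size ^ 3 = P.size * P.size * P.size by ring]
    omega
  have h2 : P.size + 25 ≤ P.size ^ 6 := by
    have h3 : 2 ^ 5 * P.size ≤ P.size ^ 5 * P.size := by gcongr
    rw [show P.size ^ 6 = P.size ^ 5 * P.size by ring]
    omega
  have h3 : D ≤ P.size ^ D := (Nat.lt_pow_self (by omega)).le
  calc _ ≤ P.size ^ D * P.size ^ 3 * P.size * P.size ^ 6 := by gcongr
    _ = _ := by ring

theorem stageString_false (P : DEParams) (D : ℕ) (ρ wt msg z : ℕ → ℕ) (r : ℕ) :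
    P.stageString false D ρ wt msg z r = z := by
  induction r with
  | zero => rfl
  | succ r ih => funext p; simp [stageString, ih]

theorem hasParams_input (P : DEParams) {t ℓ : ℕ} (z : Fin P.n → Bool)
    (S : Fin t → Finset (Fin P.n)) (r : Fin ℓ → Bool) (w : List Bool) :
    Cmd.HasParams P (input P z S r w) :=
  ⟨rfl, rfl, rfl, rfl, rfl, rfl⟩

theorem stageHash_eq_stageFamily (P : DEParams) (hv : P.totalSB ≤ P.n) {N D R q g : ℕ}
    (r : Fin N → Bool) (hq : q < R) (hg : g < D * 2 ^ q) :
    (fun p : Fin P.n => P.stageHash D (arrayOf fun i => (r i).toNat) q g p) =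
      stageFamily D R (fun q => bitsHash (P.size + 25) (P.width q))
        (fun γ (p : Fin P.n) (j : Fin (P.size + 25)) => bitAt r ((γ * P.n + p) * (P.size + 25) + j)) q g := by
  funext p
  have h1 := mul_two_pow_succ_sub_one D q
  have h2 : D * (2 ^ (q + 1) - 1) ≤ D * (2 ^ R - 1) := mul_two_pow_sub_one_mono hq
  rw [stageFamily, dif_pos (by omega)]
  refine hashVal_congr fun i hi => ?_
  have h3 : i < P.size + 25 := hi.trans_le (P.width_le hv q)
  simp only [arrayOf, h3, dif_pos, bitAt]
  split_ifs <;> rfl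

end DEParams

/-! ### The protocol, its correctness and the main theorem. -/

namespace OneRoundProtocol

open RAM

/-- The message of Alice: the parities of all buckets of all hash functions. -/
@[irreducible] def hashEnc (D : ℕ) (P : DEParams) {N : ℕ} (x : Fin P.n → Bool)
    (SA : Fin P.tA → Finset (Fin P.n)) (r : Fin N → Bool) : List Bool :=
  outMessage ((Cmd.mainCmd false D).den (input P x SA r []))

/-- The output of Bob, who changes the entries that a majority of the hash functions reports. -/
@[irreducible] def hashDec (D : ℕ) (P : DEParams) {N : ℕ} (y : Fin P.n → Bool)
    (SB : Fin P.tB → Finset (Fin P.n)) (r : Fin N → Bool) (w : List Bool) : Fin P.n → Bool :=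
  outString P.n ((Cmd.mainCmd true D).den (input P y SB r w))

/-- The protocol with `D * 2 ^ r` hash functions in stage `r`. -/
def hashProtocol (D : ℕ) : OneRoundProtocol where
  randExp := D + 10
  enc P x SA r := hashEnc D P x SA r
  dec P y SB r w := hashDec D P y SB r w

theorem isExplicit_hashProtocol (D : ℕ) : (hashProtocol D).IsExplicit := by
  obtain ⟨a, ha⟩ := (Cmd.mainCmd false D).exists_pow_bound
  obtain ⟨b, hb⟩ := (Cmd.mainCmd true D).exists_pow_bound
  unfold hashProtocol IsExplicit
  dsimp only
  refine ⟨(Cmd.mainCmd false D).toProg, (Cmd.mainCmd true D).toProg, max a b,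
    fun P r => ⟨fun x SA _ => ?_, fun y SB w _ => ?_⟩⟩
  · obtain ⟨T, hT, hle⟩ := (Cmd.mainCmd false D).runs (Cmd.wf_mainCmd _ _)
      (Cmd.zero_notMem_writes_mainCmd _ _) (input P x SA r [])
    rw [(P.hasParams_input x SA r []).size] at hle
    have hpow : P.size ^ a ≤ P.size ^ max a b :=
      Nat.pow_le_pow_right (by have := P.two_le_size; omega) (le_max_left _ _)
    exact ⟨_, T, hT, (hle.trans (ha _ P.two_le_size)).trans hpow, by rw [hashEnc]⟩
  · obtain ⟨T, hT, hle⟩ := (Cmd.mainCmd true D).runs (Cmd.wf_mainCmd _ _)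
      (Cmd.zero_notMem_writes_mainCmd _ _) (input P y SB r w)
    rw [(P.hasParams_input y SB r w).size] at hle
    have hpow : P.size ^ b ≤ P.size ^ max a b :=
      Nat.pow_le_pow_right (by have := P.two_le_size; omega) (le_max_right _ _)
    have hbase : P.size ^ max a b ≤ (P.size + w.length) ^ max a b :=
      Nat.pow_le_pow_left (Nat.le_add_right _ _) _
    exact ⟨_, T, hT, ((hle.trans (hb _ P.two_le_size)).trans hpow).trans hbase, by rw [hashDec]⟩

variable {P : DEParams} {SA : Fin P.tA → Finset (Fin P.n)} {SB : Fin P.tB → Finset (Fin P.n)}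
  {x y : Fin P.n → Bool}

theorem hashEnc_spec (hv : P.totalSB ≤ P.n) (D : ℕ) {N : ℕ} (r : Fin N → Bool) :
    (hashEnc D P x SA r).length = P.offset D P.numStages ∧
      ∀ q < P.numStages, ∀ g < D * 2 ^ q, ∀ u < 2 ^ P.width q,
        ((hashEnc D P x SA r).getD (P.bitPos D q g u) false).toNat =
          bucketSum P.n (P.stageHash D (arrayOf fun i => (r i).toNat) q g)
            (arrayOf fun p => (x p).toNat) u % 2 := by
  obtain ⟨wt, -, hlen, -, hbits⟩ := Cmd.mainCmd_spec hv (flip := false) (D := D)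
    (σ := input P x SA r []) (z := arrayOf fun p => (x p).toNat) (P.hasParams_input x SA r [])
    (arrayOf_toNat_lt_two x) (fun _ _ => rfl) (arrayOf_toNat_lt_two r) (fun i => by simp [input])
    rfl rfl (fun _ => rfl)
  refine ⟨by simp [hashEnc, outMessage, hlen], fun q hq g hg u hu => ?_⟩
  have hpos := (Cmd.bitPos_lt_offset P hg hu).trans_le (Cmd.offset_mono P D hq)
  have hbit := hbits q hq g hg u hu
  rw [P.stageString_false] at hbit
  have h0 : input P x SA r [] 9 (P.bitPos D q g u) = 0 := by simp [input]
  rw [h0, zero_add] at hbit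
  have h1 : (hashEnc D P x SA r).getD (P.bitPos D q g u) false =
      decide ((Cmd.mainCmd false D).den (input P x SA r []) 9 (P.bitPos D q g u) ≠ 0) := by
    simp [hashEnc, outMessage, hlen, List.getD_eq_getElem?_getD, hpos]
  rw [h1, hbit]
  change _ = bucketSum P.n (P.stageHash D (input P x SA r [] 7) q g)
            (arrayOf fun p => (x p).toNat) u % 2
  rcases Nat.mod_two_eq_zero_or_one (bucketSum P.n (P.stageHash D (input P x SA r [] 7) q g)
    (arrayOf fun p => (x p).toNat) u) with h | h <;> simp [h]

/-- Links program and probability: by `stageString_ne_iff`, Bob's final string differs from `x`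
exactly on the last error set, computed with the hash blocks read from `r`. -/
theorem hashDec_eq (h : P.IsConfig SA SB x y) (D : ℕ) {N : ℕ} (r : Fin N → Bool)
    (hr : errSeq D (stageFamily D P.numStages (fun q => bitsHash (P.size + 25) (P.width q))
      fun γ (p : Fin P.n) (j : Fin (P.size + 25)) =>
        bitAt r ((γ * P.n + p) * (P.size + 25) + j))
        (fun p => P.classWeight (setTable SB p)) (univ.filter fun p => x p ≠ y p)
        P.numStages = ∅) :
    hashDec D P y SB r (hashEnc D P x SA r) = x := by
  have hv : P.totalSB ≤ P.n := h.setsB.sum_le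
  have henc := (hashEnc_spec (SA := SA) (x := x) hv D r).2
  set w := hashEnc D P x SA r
  obtain ⟨wt, hwt, -, hstr, -⟩ := Cmd.mainCmd_spec hv (flip := true) (D := D)
    (σ := input P y SB r w) (z := arrayOf fun p => (y p).toNat) (P.hasParams_input y SB r w)
    (arrayOf_toNat_lt_two y) (fun _ _ => rfl) (arrayOf_toNat_lt_two r)
    (fun i => Bool.toNat_lt _) rfl rfl (fun _ => rfl)
  have hval : ∀ (z : Fin P.n → Bool) (p : Fin P.n), arrayOf (fun p => (z p).toNat) p = (z p).toNat :=
    fun z p => by simp [arrayOf]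
  have hwt' : (fun p : Fin P.n => wt p) = fun p => P.classWeight (setTable SB p) := by
    funext p
    have h6 : input P y SB r w 6 p = setTable SB p := by simp [input, arrayOf]
    rw [hwt p (by rw [h6]; exact h.setsB.setTable_lt p), h6]
  have hdiff : (univ.filter fun p : Fin P.n => arrayOf (fun p => (x p).toNat) p ≠
      arrayOf (fun p => (y p).toNat) p) = univ.filter fun p => x p ≠ y p := by
    refine filter_congr fun p _ => ?_
    rw [hval, hval]
    cases x p <;> cases y p <;> simp
  funext p
  have hne := stageString_ne_iff P (D := D) (R := P.numStages) (wt := wt)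
    (ρ := arrayOf fun i => (r i).toNat) (msg := fun i => (w.getD i false).toNat)
    (arrayOf_toNat_lt_two r) (arrayOf_toNat_lt_two x) (arrayOf_toNat_lt_two y) henc le_rfl p
  rw [hwt', hdiff, errSeq_congr _ fun q hq g hg => P.stageHash_eq_stageFamily hv r hq hg, hr] at hne
  have heq := not_not.1 (mt hne.1 (notMem_empty p))
  have hout : (Cmd.mainCmd true D).den (input P y SB r w) 10 p = (x p).toNat := by
    rw [hstr p p.2, ← hval x p, heq]
    rfl
  rw [hashDec, outString, hout]
  cases x p <;> simp

theorem successProb_eq_prob (Q : OneRoundProtocol) (P : DEParams)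
    (SA : Fin P.tA → Finset (Fin P.n)) (SB : Fin P.tB → Finset (Fin P.n)) (x y : Fin P.n → Bool) :
    Q.successProb P SA SB x y = prob fun r => Q.dec P y SB r (Q.enc P x SA r) = x := by
  rw [prob_eq, Fintype.expect_eq_sum_div_card, sum_boole, successProb]
  simp

theorem le_successProb_hashProtocol (h : P.IsConfig SA SB x y) (hs : P.slack ≠ 0) (c : ℕ) :
    1 - 1 / (2 : ℝ) ^ P.minK - 1 / ((P.totalSA : ℝ) + (P.totalSB : ℝ) + 1) ^ c ≤
      (hashProtocol (2 * c + 4)).successProb P SA SB x y := by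
  set D := 2 * c + 4 with hD
  have hl := P.slack_le_lenBits
  have h1 := (h.prob_errSeq_le hs (D := D) (by omega)).trans
    (DEParams.sum_pow_tolerance_le hs (by omega))
  rw [← prob_blocks (P.hash_bits_le hs D)] at h1
  -- Both totals are at most `n < 2 ^ lenBits`, so the left side is at most `(n + 1) ^ 2`.
  have hsize : P.totalSA + P.totalSB + 1 ≤ (2 ^ P.lenBits) ^ 2 := by
    have hA : P.totalSA ≤ P.n := h.setsA.sum_le
    have hB : P.totalSB ≤ P.n := h.setsB.sum_le
    have hn : P.n + 1 ≤ 2 ^ P.lenBits := Nat.lt_size_self _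
    have := Nat.pow_le_pow_left hn 2
    nlinarith
  have h2 := DEParams.one_div_add_one_div_le (c := c) (μ := P.minK)
    (Nat.pos_of_ne_zero fun h0 => hs (by omega)) hsize
  rw [← P.slack_eq_min] at h2
  rw [show D - 3 = 2 * c + 1 by omega, show D - 2 = 2 * c + 2 by omega] at h1
  push_cast at h2
  have h3 : (hashProtocol D).successProb P SA SB x y =
      prob fun r : Fin (P.size ^ (D + 10)) → Bool =>
        hashDec D P y SB r (hashEnc D P x SA r) = x := successProb_eq_prob _ _ _ _ _ _
  rw [h3]
  have h4 := h1.trans h2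
  refine le_trans ?_ (prob_mono fun r hr => hashDec_eq h D r (not_not.1 hr))
  rw [prob_not]
  linarith

end OneRoundProtocol

theorem mainTheorem11 :
    ∃ δ : ℝ, 0 < δ ∧ ∀ c : ℕ, ∃ C : ℝ, 0 < C ∧ ∃ Q : OneRoundProtocol, Q.IsExplicit ∧
      ∀ (P : DEParams) (SA : Fin P.tA → Finset (Fin P.n)) (SB : Fin P.tB → Finset (Fin P.n))
        (x y : Fin P.n → Bool), P.IsConfig SA SB x y →
        (∀ r : Fin (P.size ^ Q.randExp) → Bool,
          ((Q.enc P x SA r).length : ℝ) ≤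
            C * (((chi P.sB P.kB : ℝ) + 1) ^ 2 *
              (Hnat (P.n - P.totalSB) P.totalKA + Hvec P.sB P.kB))) ∧
        1 - (2 : ℝ) ^ (-(δ * (P.minK : ℝ))) -
            1 / ((P.totalSA : ℝ) + (P.totalSB : ℝ) + 1) ^ c ≤
          Q.successProb P SA SB x y := by
  -- The choice `D = 2 * c + 4` yields the failure exponents `D - 3 = 2 * c + 1` and `D - 2 = 2 * c
  -- + 2`, enough for the power `c` because `s^A + s^B + 1` is at most quadratic in `2 ^ lenBits`.
  refine ⟨1, one_pos, fun c => ⟨((2 * c + 4 : ℕ) : ℝ) * 2 ^ 27, by positivity,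
    OneRoundProtocol.hashProtocol (2 * c + 4), OneRoundProtocol.isExplicit_hashProtocol _,
    fun P SA SB x y h => ⟨fun r => ?_, ?_⟩⟩⟩
  · have hv : P.totalSB ≤ P.n := h.setsB.sum_le
    have hlen : ((OneRoundProtocol.hashProtocol (2 * c + 4)).enc P x SA r).length =
        P.offset (2 * c + 4) P.numStages := (OneRoundProtocol.hashEnc_spec hv _ r).1
    rw [hlen]
    refine (P.offset_numStages_le (2 * c + 4) hv).trans
      (mul_le_mul_of_nonneg_left ?_ (by positivity))
    have hE : 0 ≤ Hnat (P.n - P.totalSB) P.totalKA + Hvec P.sB P.kB :=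
      add_nonneg (Hnat_nonneg _ _) (sum_nonneg fun _ _ => Hnat_nonneg _ _)
    have hchi : (1 : ℝ) ≤ ((chi P.sB P.kB : ℝ) + 1) ^ 2 :=
      one_le_pow₀ (by linarith [(Nat.cast_nonneg (chi P.sB P.kB) : (0 : ℝ) ≤ _)])
    exact le_mul_of_one_le_left hE hchi
  · have hpow : (2 : ℝ) ^ (-(1 * (P.minK : ℝ))) = 1 / 2 ^ P.minK := by
      rw [one_mul, Real.rpow_neg (by norm_num), Real.rpow_natCast, one_div]
    rw [hpow]
    -- Zero slack means `n = 0` or `μ = 0`; then one of the two error terms equals `1` and the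
    -- claimed probability is not positive.
    by_cases hs : P.slack = 0
    · have hprob : 0 ≤ (OneRoundProtocol.hashProtocol (2 * c + 4)).successProb P SA SB x y := by
        rw [OneRoundProtocol.successProb_eq_prob]
        exact prob_nonneg _
      rw [P.slack_eq_min, Nat.min_eq_zero_iff] at hs
      rcases hs with hs | hs
      · have hn : P.n = 0 := Nat.size_eq_zero.1 hs
        have hA : P.totalSA = 0 := Nat.le_zero.1 (hn ▸ h.setsA.sum_le)
        have hB : P.totalSB = 0 := Nat.le_zero.1 (hn ▸ h.setsB.sum_le)
        have : (0 : ℝ) ≤ 1 / 2 ^ P.minK := by positivity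
        rw [hA, hB]
        simp only [Nat.cast_zero, add_zero, zero_add, one_pow]
        linarith
      · have : (0 : ℝ) ≤ 1 / ((P.totalSA : ℝ) + (P.totalSB : ℝ) + 1) ^ c := by positivity
        rw [hs, pow_zero]
        linarith
    · exact OneRoundProtocol.le_successProb_hashProtocol h hs c
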